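/- Let $q$ be an odd prime power, $\overline{\mathbb F}_q$ an algebraic closure of $\mathbb F_q$, and $V(R)=M_2(R)\oplus M_2^0(R)$ (all $2\times2$ matrices plus the traceless ones) with the quadratic form $(X,Y)\mapsto\det X+\det Y$. Put $\mathrm{Spin}_7(q^\infty)=\mathrm{Spin}(V(\overline{\mathbb F}_q))$ and, for $n\ge1$, $\mathrm{Spin}_7(q^n)=\mathrm{Spin}(V(\mathbb F_{q^n}))\le\mathrm{Spin}_7(q^\infty)$. Let $\omega: SL_2(\overline{\mathbb F}_q)^3\to\mathrm{Spin}_7(q^\infty)$ be the homomorphism lifting the action $(X,Y)\mapsto(X_1XX_2^{-1},X_3YX_3^{-1})$ of $(X_1,X_2,X_3)$ on $V(\overline{\mathbb F}_q)$, and write $[X_1,X_2,X_3]=\omega(X_1,X_2,X_3)$. Fix $A\in SL_2(\mathbb F_q)$ of order $4$, let $C(q^\infty)$ be the group of elements of $2$-power order in the centralizer of $A$ in $SL_2(\overline{\mathbb F}_q)$, and set $A(q^\infty)=\omega(C(q^\infty)^3)$ and $A(q^n)=A(q^\infty)\cap\mathrm{Spin}_7(q^n)$. For subgroups $L,H$ of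 a group, $\mathrm{Aut}_L(H)$ denotes the group of automorphisms of $H$ of the form $x\mapsto gxg^{-1}$ with $g\in L$. Define automorphisms of $A(q^\infty)$ by $$\gamma([X_1,X_2,X_3])=[X_3,X_1,X_2],\qquad \delta_u([X_1,X_2,X_3])=[X_1,X_2,X_3^u],\qquad \gamma_u=\delta_u\gamma\delta_u^{-1}$$ for $X_1,X_2,X_3\in C(q^\infty)$ and $u\in\mathbb Z_2^\times$. Then there is $u\in\mathbb Z_2^\times$ with $u\equiv1\pmod 4$ such that the group $$\Omega_u=\langle \mathrm{Aut}_{\mathrm{Spin}_7(q^\infty)}(A(q^\infty)),\gamma_u\rangle\le\mathrm{Aut}(A(q^\infty))$$ is isomorphic to $C_2\times GL_3(2)$, and such that moreover: (a) the subgroup of those elements of $\Omega_u$ that act as the identity on all $x\in A(q^\infty)$ with $x^2=1$ has order $2$, and consists of the identity and the automorphism $g\mapsto g^{-1}$; (b) for each $n\ge1$, $\gamma_u$ restricts to an automorphism of $A(q^n)$, and $$\langle \mathrm{Aut}_{\mathrm{Spin}_7(q^n)}(A(q^n)),\gamma_u|_{A(q^n)}\rangle\cong C_2\times GL_3(2).$$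 -/

import Mathlib

set_option linter.unusedSimpArgs false
set_option linter.unusedSectionVars false
open CliffordAlgebra
noncomputable section
namespace SolSpin

abbrev Mat2 (R : Type*) := Matrix (Fin 2) (Fin 2) R
abbrev SL2 (R : Type*) [CommRing R] := Matrix.SpecialLinearGroup (Fin 2) R

section Form
variable (R : Type*) [CommRing R]

/-- The determinant, as a quadratic form on `M₂(R)`. -/
def detForm : QuadraticForm R (Mat2 R) where
  toFun := Matrix.det
  toFun_smul a X := by simp [Matrix.det_smul, sq]
  exists_companion' :=
    ⟨LinearMap.mk₂ R (fun X Y => X 0 0 * Y 1 1 + Y 0 0 * X 1 1 - X 0 1 * Y 1 0 - Y 0 1 * X 1 0)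
      (fun _ _ _ => by simp; ring) (fun _ _ _ => by simp; ring)
      (fun _ _ _ => by simp; ring) (fun _ _ _ => by simp; ring),
     fun X Y => by simp [Matrix.det_fin_two]; ring⟩

@[simp] theorem detForm_apply (X : Mat2 R) : detForm R X = X.det := rfl

/-- The space `M₂⁰(R)` of traceless `2 × 2` matrices. -/
abbrev Mat20 : Submodule R (Mat2 R) := LinearMap.ker (Matrix.traceLinearMap (Fin 2) R R)

/-- The space `V = M₂(R) ⊕ M₂⁰(R)`, free of rank 7. -/
abbrev V7 := Mat2 R × Mat20 R

/-- The quadratic form `(X, Y) ↦ det X + det Y` on `V`. -/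
def form7 : QuadraticForm R (V7 R) := (detForm R).prod ((detForm R).comp (Mat20 R).subtype)

@[simp] theorem form7_apply (v : V7 R) : form7 R v = v.1.det + (v.2 : Mat2 R).det := rfl

/-- The group `Spin(V)`, inside the Clifford algebra of `V` (with `v * v = det X + det Y` for `v = (X, Y)`). -/
abbrev Spin7 := spinGroup (form7 R)

/-- The Clifford algebra of `V`. -/
abbrev Cl7 := CliffordAlgebra (form7 R)

/-- The images in the Clifford algebra of the standard basis vectors of `V`: `vp, vr, vs, vq` are the
matrix units `E₁₁, E₁₂, E₂₁, E₂₂` of `M₂(R)`, and `vh, ve, vf` are `diag(1, -1), E₁₂, E₂₁` in `M₂⁰(R)`. -/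
def vp : Cl7 R := ι (form7 R) (!![1, 0; 0, 0], 0)
def vq : Cl7 R := ι (form7 R) (!![0, 0; 0, 1], 0)
def vr : Cl7 R := ι (form7 R) (!![0, 1; 0, 0], 0)
def vs : Cl7 R := ι (form7 R) (!![0, 0; 1, 0], 0)
def vh : Cl7 R := ι (form7 R) (0, ⟨!![1, 0; 0, -1], by simp⟩)
def ve : Cl7 R := ι (form7 R) (0, ⟨!![0, 1; 0, 0], by simp⟩)
def vf : Cl7 R := ι (form7 R) (0, ⟨!![0, 0; 1, 0], by simp⟩)
end Form

section Algebra
variable {R C : Type*} [CommRing R] [Ring C] [Algebra R C]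

/-- The linear map sending the matrix units `E₁₁, E₁₂, E₂₁, E₂₂` to `xy, x, y, yx`. -/
def unitsMap (x y : C) (M : Mat2 R) : C :=
  M 0 0 • (x * y) + M 0 1 • x + M 1 0 • y + M 1 1 • (y * x)

theorem unitsMap_mul {x y : C} (hx : x * x = 0) (hy : y * y = 0) (hxy : x * y * x = x)
    (hyx : y * x * y = y) (M N : Mat2 R) :
    unitsMap x y (M * N) = unitsMap x y M * unitsMap x y N := by
  have hx' : ∀ t, x * (x * t) = 0 := fun t => by rw [← mul_assoc, hx, zero_mul]
  have hy' : ∀ t, y * (y * t) = 0 := fun t => by rw [← mul_assoc, hy, zero_mul]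
  have hxy' : x * (y * x) = x := by rw [← mul_assoc, hxy]
  have hyx' : y * (x * y) = y := by rw [← mul_assoc, hyx]
  simp only [unitsMap, Matrix.mul_apply, Fin.sum_univ_two, mul_add, add_mul, smul_mul_assoc,
    mul_smul_comm, mul_assoc, hx, hy, hx', hy', hxy', hyx', mul_zero, smul_zero]
  module
end Algebra

section Rel
variable {R : Type*} [CommRing R]

theorem sq_of (v : V7 R) (c : R) (h : v.1.det + (v.2 : Mat2 R).det = c) :
    ι (form7 R) v * ι (form7 R) v = algebraMap R _ c := by
  rw [ι_sq_scalar, form7_apply, h]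

theorem swap_of (v w : V7 R) (c : R)
    (h : (w.1 + v.1).det + ((w.2 : Mat2 R) + v.2).det - (w.1.det + (w.2 : Mat2 R).det)
      - (v.1.det + (v.2 : Mat2 R).det) = c) :
    ι (form7 R) w * ι (form7 R) v = algebraMap R _ c - ι (form7 R) v * ι (form7 R) w := by
  rw [eq_sub_iff_add_eq, ι_mul_ι_add_swap, QuadraticMap.polar]
  simp only [form7_apply, Prod.fst_add, Prod.snd_add, Submodule.coe_add, h]

theorem pp : vp R * vp R = 0 := by rw [vp, sq_of _ 0 (by simp [Matrix.det_fin_two])]; simp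
theorem qq : vq R * vq R = 0 := by rw [vq, sq_of _ 0 (by simp [Matrix.det_fin_two])]; simp
theorem rr : vr R * vr R = 0 := by rw [vr, sq_of _ 0 (by simp [Matrix.det_fin_two])]; simp
theorem ss : vs R * vs R = 0 := by rw [vs, sq_of _ 0 (by simp [Matrix.det_fin_two])]; simp
theorem hh : vh R * vh R = -1 := by rw [vh, sq_of _ (-1) (by simp [Matrix.det_fin_two])]; simp
theorem ee : ve R * ve R = 0 := by rw [ve, sq_of _ 0 (by simp [Matrix.det_fin_two])]; simp
theorem ff : vf R * vf R = 0 := by rw [vf, sq_of _ 0 (by simp [Matrix.det_fin_two])]; simp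
theorem qp : vq R * vp R = 1 - vp R * vq R := by
  rw [vp, vq, swap_of _ _ 1 (by simp [Matrix.det_fin_two])]; simp
theorem sr : vs R * vr R = -1 - vr R * vs R := by
  rw [vs, vr, swap_of _ _ (-1) (by simp [Matrix.det_fin_two])]; simp
theorem fe : vf R * ve R = -1 - ve R * vf R := by
  rw [vf, ve, swap_of _ _ (-1) (by simp [Matrix.det_fin_two])]; simp
theorem rp : vr R * vp R = -(vp R * vr R) := by
  rw [vr, vp, swap_of _ _ 0 (by simp [Matrix.det_fin_two])]; simp
theorem sp : vs R * vp R = -(vp R * vs R) := by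
  rw [vs, vp, swap_of _ _ 0 (by simp [Matrix.det_fin_two])]; simp
theorem rq : vr R * vq R = -(vq R * vr R) := by
  rw [vr, vq, swap_of _ _ 0 (by simp [Matrix.det_fin_two])]; simp
theorem sq : vs R * vq R = -(vq R * vs R) := by
  rw [vs, vq, swap_of _ _ 0 (by simp [Matrix.det_fin_two])]; simp
theorem eh : ve R * vh R = -(vh R * ve R) := by
  rw [ve, vh, swap_of _ _ 0 (by simp [Matrix.det_fin_two])]; simp
theorem fh : vf R * vh R = -(vh R * vf R) := by
  rw [vf, vh, swap_of _ _ 0 (by simp [Matrix.det_fin_two])]; simp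
end Rel

section Omega
variable {R : Type*} [CommRing R]

theorem swap_mixed (X : Mat2 R) (Y : Mat20 R) :
    ι (form7 R) (0, Y) * ι (form7 R) (X, 0) = -(ι (form7 R) (X, 0) * ι (form7 R) (0, Y)) := by
  rw [swap_of _ _ 0 (by simp)]; simp

theorem pp_assoc (t : Cl7 R) : vp R * (vp R * t) = 0 := by
  rw [← mul_assoc, pp]; simp [sub_mul, mul_assoc]
theorem qq_assoc (t : Cl7 R) : vq R * (vq R * t) = 0 := by
  rw [← mul_assoc, qq]; simp [sub_mul, mul_assoc]
theorem rr_assoc (t : Cl7 R) : vr R * (vr R * t) = 0 := by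
  rw [← mul_assoc, rr]; simp [sub_mul, mul_assoc]
theorem ss_assoc (t : Cl7 R) : vs R * (vs R * t) = 0 := by
  rw [← mul_assoc, ss]; simp [sub_mul, mul_assoc]
theorem hh_assoc (t : Cl7 R) : vh R * (vh R * t) = -t := by
  rw [← mul_assoc, hh]; simp [sub_mul, mul_assoc]
theorem ee_assoc (t : Cl7 R) : ve R * (ve R * t) = 0 := by
  rw [← mul_assoc, ee]; simp [sub_mul, mul_assoc]
theorem ff_assoc (t : Cl7 R) : vf R * (vf R * t) = 0 := by
  rw [← mul_assoc, ff]; simp [sub_mul, mul_assoc]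
theorem qp_assoc (t : Cl7 R) : vq R * (vp R * t) = t - vp R * (vq R * t) := by
  rw [← mul_assoc, qp]; simp [sub_mul, mul_assoc]
theorem sr_assoc (t : Cl7 R) : vs R * (vr R * t) = -t - vr R * (vs R * t) := by
  rw [← mul_assoc, sr]; simp [sub_mul, mul_assoc]
theorem fe_assoc (t : Cl7 R) : vf R * (ve R * t) = -t - ve R * (vf R * t) := by
  rw [← mul_assoc, fe]; simp [sub_mul, mul_assoc]
theorem rp_assoc (t : Cl7 R) : vr R * (vp R * t) = -(vp R * (vr R * t)) := by
  rw [← mul_assoc, rp]; simp [sub_mul, mul_assoc]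
theorem sp_assoc (t : Cl7 R) : vs R * (vp R * t) = -(vp R * (vs R * t)) := by
  rw [← mul_assoc, sp]; simp [sub_mul, mul_assoc]
theorem rq_assoc (t : Cl7 R) : vr R * (vq R * t) = -(vq R * (vr R * t)) := by
  rw [← mul_assoc, rq]; simp [sub_mul, mul_assoc]
theorem sq_assoc (t : Cl7 R) : vs R * (vq R * t) = -(vq R * (vs R * t)) := by
  rw [← mul_assoc, sq]; simp [sub_mul, mul_assoc]
theorem eh_assoc (t : Cl7 R) : ve R * (vh R * t) = -(vh R * (ve R * t)) := by
  rw [← mul_assoc, eh]; simp [sub_mul, mul_assoc]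
theorem fh_assoc (t : Cl7 R) : vf R * (vh R * t) = -(vh R * (vf R * t)) := by
  rw [← mul_assoc, fh]; simp [sub_mul, mul_assoc]

/-- The even Clifford algebra of `(M₂(R), det)` is `M₂(R) × M₂(R)`, and that of `(M₂⁰(R), det)` is `M₂(R)`;
`blk1`, `blk2`, `blk3` are the inclusions of these three blocks `M₂(R)`. -/
def blk1 : Mat2 R → Cl7 R := unitsMap (-(vp R * vr R)) (-(vq R * vs R))
def blk2 : Mat2 R → Cl7 R := unitsMap (vq R * vr R) (vp R * vs R)
def blk3 : Mat2 R → Cl7 R := unitsMap (-(vh R * ve R)) (vh R * vf R)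

attribute [local simp] pp qq rr ss hh ee ff qp sr fe rp sp rq sq eh fh
attribute [local simp] pp_assoc qq_assoc rr_assoc ss_assoc hh_assoc ee_assoc ff_assoc qp_assoc
  sr_assoc fe_assoc rp_assoc sp_assoc rq_assoc sq_assoc eh_assoc fh_assoc

theorem blk1_mul (A B : Mat2 R) : blk1 (A * B) = blk1 A * blk1 B := by
  refine unitsMap_mul ?_ ?_ ?_ ?_ A B <;> simp [mul_assoc, mul_sub, sub_mul, mul_add, add_mul]
theorem blk2_mul (A B : Mat2 R) : blk2 (A * B) = blk2 A * blk2 B := by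
  refine unitsMap_mul ?_ ?_ ?_ ?_ A B <;> simp [mul_assoc, mul_sub, sub_mul, mul_add, add_mul]
theorem blk3_mul (A B : Mat2 R) : blk3 (A * B) = blk3 A * blk3 B := by
  refine unitsMap_mul ?_ ?_ ?_ ?_ A B <;> simp [mul_assoc, mul_sub, sub_mul, mul_add, add_mul]
theorem blk1_mul_blk2 (A B : Mat2 R) : blk1 A * blk2 B = 0 := by
  simp [blk1, blk2, unitsMap, mul_assoc, mul_sub, sub_mul, mul_add, add_mul]
  module
theorem blk2_mul_blk1 (A B : Mat2 R) : blk2 A * blk1 B = 0 := by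
  simp [blk1, blk2, unitsMap, mul_assoc, mul_sub, sub_mul, mul_add, add_mul]
  module
theorem blk12_one : blk1 (1 : Mat2 R) + blk2 1 = 1 := by
  simp [blk1, blk2, unitsMap, mul_assoc, mul_sub, sub_mul, mul_add, add_mul]
  abel
theorem blk3_one : blk3 (1 : Mat2 R) = 1 := by
  simp [blk3, unitsMap, mul_assoc, mul_sub, sub_mul, mul_add, add_mul]

def vec4 (X : Mat2 R) : Cl7 R := ι (form7 R) (X, 0)
def vec3 (Y : Mat20 R) : Cl7 R := ι (form7 R) (0, Y)

theorem vec4_eq (X : Mat2 R) :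
    vec4 X = X 0 0 • vp R + X 1 1 • vq R + X 0 1 • vr R + X 1 0 • vs R := by
  simp only [vec4, vp, vq, vr, vs, ← map_smul, ← map_add]
  congr 1
  ext i j <;> fin_cases i <;> fin_cases j <;> simp

theorem Mat20_11 (Y : Mat20 R) : (Y : Mat2 R) 1 1 = -(Y : Mat2 R) 0 0 := by
  have := Y.2
  simp only [LinearMap.mem_ker, Matrix.traceLinearMap_apply, Matrix.trace_fin_two] at this
  linear_combination this

theorem vec3_eq (Y : Mat20 R) :
    vec3 Y = (Y : Mat2 R) 0 0 • vh R + (Y : Mat2 R) 0 1 • ve R + (Y : Mat2 R) 1 0 • vf R := by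
  simp only [vec3, vh, ve, vf, ← map_smul, ← map_add]
  congr 1
  ext i j
  · simp
  · fin_cases i <;> fin_cases j <;> simp [Mat20_11]

theorem blk1_vec4 (A X : Mat2 R) : blk1 A * vec4 X = blk1 1 * vec4 (A * X) := by
  simp only [vec4_eq]
  simp [blk1, unitsMap, mul_assoc, mul_sub, sub_mul, mul_add, add_mul, Matrix.mul_apply, Fin.sum_univ_two]
  module
theorem vec4_blk2 (A X : Mat2 R) : vec4 X * blk2 A = blk1 1 * vec4 (X * A) := by
  simp only [vec4_eq]
  simp [blk1, blk2, unitsMap, mul_assoc, mul_sub, sub_mul, mul_add, add_mul, Matrix.mul_apply, Fin.sum_univ_two]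
  module
theorem blk2_vec4 (A X : Mat2 R) : blk2 A * vec4 X = blk2 1 * vec4 (X * A.adjugate) := by
  simp only [vec4_eq]
  simp [blk2, unitsMap, mul_assoc, mul_sub, sub_mul, mul_add, add_mul, Matrix.mul_apply, Fin.sum_univ_two,
    Matrix.adjugate_fin_two]
  module
theorem vec4_blk1 (A X : Mat2 R) : vec4 X * blk1 A = blk2 1 * vec4 (A.adjugate * X) := by
  simp only [vec4_eq]
  simp [blk1, blk2, unitsMap, mul_assoc, mul_sub, sub_mul, mul_add, add_mul, Matrix.mul_apply, Fin.sum_univ_two,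
    Matrix.adjugate_fin_two]
  module

def vol3 : Cl7 R := vh R * (vf R * ve R - ve R * vf R)
theorem vec3_eq_vol (Y : Mat20 R) : vec3 Y = vol3 * blk3 (Y : Mat2 R) := by
  simp only [vec3_eq]
  simp [vol3, blk3, unitsMap, mul_assoc, mul_sub, sub_mul, mul_add, add_mul, Mat20_11]
  module
theorem vol3_comm (A : Mat2 R) : vol3 * blk3 A = blk3 A * vol3 := by
  simp [vol3, blk3, unitsMap, mul_assoc, mul_sub, sub_mul, mul_add, add_mul]
  module

theorem ι_eq (X : Mat2 R) (Y : Mat20 R) : ι (form7 R) (X, Y) = vec4 X + vec3 Y := by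
  rw [vec4, vec3, ← map_add]; simp

theorem unitsMap_commute {C : Type*} [Ring C] [Algebra R C] {x y v : C} (hx : Commute x v)
    (hy : Commute y v) (M : Mat2 R) : Commute (unitsMap x y M) v :=
  ((((hx.mul_left hy).smul_left _).add_left (hx.smul_left _)).add_left
    (hy.smul_left _)).add_left ((hy.mul_left hx).smul_left _)

theorem commute_of_anti {C : Type*} [Ring C] {a b v : C} (ha : v * a = -(a * v))
    (hb : v * b = -(b * v)) : Commute (a * b) v := by
  rw [Commute, SemiconjBy, mul_assoc, ← mul_assoc v, ha, neg_mul, mul_assoc, hb, mul_neg, neg_neg]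

theorem commute_of_anti' {C : Type*} [Ring C] {a b v : C} (ha : a * v = -(v * a))
    (hb : b * v = -(v * b)) : Commute (a * b) v :=
  commute_of_anti (by rw [ha, neg_neg]) (by rw [hb, neg_neg])

theorem blk3_commute_vec4 (A X : Mat2 R) : Commute (blk3 A) (vec4 X) :=
  unitsMap_commute (commute_of_anti' (swap_mixed _ _) (swap_mixed _ _)).neg_left
    (commute_of_anti' (swap_mixed _ _) (swap_mixed _ _)) A
theorem blk1_commute_vec3 (A : Mat2 R) (Y : Mat20 R) : Commute (blk1 A) (vec3 Y) :=
  unitsMap_commute (commute_of_anti (swap_mixed _ _) (swap_mixed _ _)).neg_left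
    (commute_of_anti (swap_mixed _ _) (swap_mixed _ _)).neg_left A
theorem blk2_commute_vec3 (A : Mat2 R) (Y : Mat20 R) : Commute (blk2 A) (vec3 Y) :=
  unitsMap_commute (commute_of_anti (swap_mixed _ _) (swap_mixed _ _))
    (commute_of_anti (swap_mixed _ _) (swap_mixed _ _)) A
theorem blk1_commute_blk3 (A B : Mat2 R) : Commute (blk1 A) (blk3 B) :=
  (unitsMap_commute
    ((blk1_commute_vec3 A _).symm.mul_left (blk1_commute_vec3 A _).symm).neg_left
    ((blk1_commute_vec3 A _).symm.mul_left (blk1_commute_vec3 A _).symm) B).symm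
theorem blk2_commute_blk3 (A B : Mat2 R) : Commute (blk2 A) (blk3 B) :=
  (unitsMap_commute
    ((blk2_commute_vec3 A _).symm.mul_left (blk2_commute_vec3 A _).symm).neg_left
    ((blk2_commute_vec3 A _).symm.mul_left (blk2_commute_vec3 A _).symm) B).symm

/-- The homomorphism `(A₁, A₂, A₃) ↦ ρ₄(A₁, A₂) ⊕ ρ₃(A₃)`, with values in the Clifford algebra. -/
def omegaCl : SL2 R × SL2 R × SL2 R →* Cl7 R where
  toFun A := (blk1 (A.1 : Mat2 R) + blk2 (A.2.1 : Mat2 R)) * blk3 (A.2.2 : Mat2 R)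
  map_one' := by simp [blk12_one, blk3_one]
  map_mul' A B := by
    have h := ((blk1_commute_blk3 (B.1 : Mat2 R) (A.2.2 : Mat2 R)).add_left
      (blk2_commute_blk3 (B.2.1 : Mat2 R) (A.2.2 : Mat2 R))).symm.eq
    have h2 : blk1 ((A.1 : Mat2 R) * (B.1 : Mat2 R)) + blk2 ((A.2.1 : Mat2 R) * (B.2.1 : Mat2 R))
        = (blk1 (A.1 : Mat2 R) + blk2 (A.2.1 : Mat2 R))
          * (blk1 (B.1 : Mat2 R) + blk2 (B.2.1 : Mat2 R)) := by
      simp [add_mul, mul_add, blk1_mul, blk2_mul, blk1_mul_blk2, blk2_mul_blk1]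
    simp only [Prod.fst_mul, Prod.snd_mul, Matrix.SpecialLinearGroup.coe_mul, h2, blk3_mul]
    generalize blk1 (A.1 : Mat2 R) + blk2 (A.2.1 : Mat2 R) = a at *
    generalize blk1 (B.1 : Mat2 R) + blk2 (B.2.1 : Mat2 R) = b at *
    simp only [mul_assoc]
    rw [← mul_assoc (blk3 _) b, h, mul_assoc]

/-- The action of `SL₂(R)` on traceless matrices by conjugation. -/
def conj20 (A : SL2 R) (Y : Mat20 R) : Mat20 R :=
  ⟨(A : Mat2 R) * Y * ((A⁻¹ : SL2 R) : Mat2 R), by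
    rw [LinearMap.mem_ker, Matrix.traceLinearMap_apply, Matrix.trace_mul_comm, ← mul_assoc,
      ← Matrix.SpecialLinearGroup.coe_mul, inv_mul_cancel, Matrix.SpecialLinearGroup.coe_one,
      one_mul]
    exact Y.2⟩

/-- `omegaCl (A₁, A₂, A₃)` acts on `V` as `(X, Y) ↦ (A₁ X A₂⁻¹, A₃ Y A₃⁻¹)`. -/
theorem omegaCl_mul_ι (A₁ A₂ A₃ : SL2 R) (X : Mat2 R) (Y : Mat20 R) :
    omegaCl (A₁, A₂, A₃) * ι (form7 R) (X, Y) =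
      ι (form7 R) ((A₁ : Mat2 R) * X * ((A₂⁻¹ : SL2 R) : Mat2 R), conj20 A₃ Y)
        * omegaCl (A₁, A₂, A₃) := by
  have e1 : (A₁ : Mat2 R).adjugate * A₁ = 1 := by rw [Matrix.adjugate_mul]; simp
  have e2 : (A₂ : Mat2 R).adjugate * A₂ = 1 := by rw [Matrix.adjugate_mul]; simp
  have e3 : (A₃ : Mat2 R).adjugate * A₃ = 1 := by rw [Matrix.adjugate_mul]; simp
  have h4 : (blk1 (A₁ : Mat2 R) + blk2 (A₂ : Mat2 R)) * vec4 X =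
      vec4 ((A₁ : Mat2 R) * X * ((A₂⁻¹ : SL2 R) : Mat2 R)) *
        (blk1 (A₁ : Mat2 R) + blk2 (A₂ : Mat2 R)) := by
    rw [add_mul, mul_add, blk1_vec4, blk2_vec4, vec4_blk1, vec4_blk2, add_comm]
    simp only [Matrix.SpecialLinearGroup.coe_inv, mul_assoc, e2, mul_one]
    simp only [← mul_assoc, e1, one_mul]
  have h3 : blk3 (A₃ : Mat2 R) * vec3 Y = vec3 (conj20 A₃ Y) * blk3 (A₃ : Mat2 R) := by
    rw [vec3_eq_vol, vec3_eq_vol, ← mul_assoc, ← vol3_comm, mul_assoc, mul_assoc, ← blk3_mul,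
      ← blk3_mul]
    simp only [conj20, Matrix.SpecialLinearGroup.coe_inv, mul_assoc, e3, mul_one]
  have c4 := (blk3_commute_vec4 (A₃ : Mat2 R) X).eq
  have c3 := ((blk1_commute_vec3 (A₁ : Mat2 R) (conj20 A₃ Y)).add_left
      (blk2_commute_vec3 (A₂ : Mat2 R) (conj20 A₃ Y))).eq
  simp only [ι_eq, omegaCl, MonoidHom.coe_mk, OneHom.coe_mk]
  generalize blk1 (A₁ : Mat2 R) + blk2 (A₂ : Mat2 R) = m at *
  rw [mul_add, add_mul, mul_assoc m _ (vec4 X), c4, ← mul_assoc m, h4, mul_assoc m _ (vec3 Y), h3,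
    ← mul_assoc m, c3]
  simp only [mul_assoc]

theorem asc_one {C : Type*} [Ring C] {a : C} (h : a * a = -1) (t : C) : a * (a * t) = -t := by
  rw [← mul_assoc, h, neg_one_mul]

theorem ι_mul_ι_mem_spin {v w : V7 R} (hv : form7 R v = -1) (hw : form7 R w = -1) :
    ι (form7 R) v * ι (form7 R) w ∈ spinGroup (form7 R) := by
  have inv : ∀ {u : V7 R}, form7 R u = -1 → ι (form7 R) u * ι (form7 R) u = -1 := fun h => by
    rw [ι_sq_scalar, h]; simp
  let U : ∀ u : V7 R, form7 R u = -1 → (Cl7 R)ˣ := fun u h =>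
    ⟨ι (form7 R) u, -ι (form7 R) u, by rw [mul_neg, inv h, neg_neg], by
      rw [neg_mul, inv h, neg_neg]⟩
  have hv2 := asc_one (inv hv)
  have hw2 := asc_one (inv hw)
  refine ⟨⟨⟨U v hv * U w hw, mul_mem (Subgroup.subset_closure ⟨v, rfl⟩)
    (Subgroup.subset_closure ⟨w, rfl⟩), rfl⟩, ?_⟩, ι_mul_ι_mem_evenOdd_zero _ v w⟩
  rw [SetLike.mem_coe, Unitary.mem_iff, star_mul, star_ι, star_ι]
  simp [mul_assoc, inv hv, inv hw, hv2, hw2]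

theorem one_add_mem_spin {a n : V7 R} (hn : form7 R n = -1)
    (han : form7 R (a - n) = -1) : 1 + ι (form7 R) a * ι (form7 R) n ∈ spinGroup (form7 R) := by
  have := ι_mul_ι_mem_spin han hn
  rwa [map_sub, sub_mul, ι_sq_scalar (form7 R) n, hn, map_neg, map_one, sub_neg_eq_add,
    add_comm] at this

theorem one_add_smul_mem_spin (c : R) {X Y : Mat2 R} (hX : X.det = 0) (hY : Y.det = 0)
    (hXY : ∀ c : R, (c • X - Y).det = 0) :
    1 + c • (vec4 X * vec4 Y) ∈ spinGroup (form7 R) := by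
  let H : Mat20 R := ⟨!![1, 0; 0, -1], by simp⟩
  have hH : (H : Mat2 R).det = -1 := by simp [H, Matrix.det_fin_two]
  have hH' : (-(H : Mat2 R)).det = -1 := by simp [H, Matrix.det_fin_two]
  have e1 := one_add_mem_spin (a := ((c • X, 0) : V7 R)) (n := (Y, H)) (by simp [hY, hH])
    (by simp [hXY, hH'])
  have e2 := one_add_mem_spin (a := ((-(c • X), 0) : V7 R)) (n := (0, H)) (by simp [hH])
    (by simp [Matrix.det_smul, Matrix.det_neg, hX, hH'])
  have hXX : vec4 X * vec4 X = 0 := by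
    rw [vec4, sq_of _ 0 (by simp [hX]), map_zero]
  have hYX : vec4 Y * vec4 X = -(vec4 X * vec4 Y) := by
    have h := hXY (-1)
    rw [vec4, vec4, swap_of _ _ 0, map_zero, zero_sub]
    have : (Y + X).det = 0 := by
      rw [show Y + X = -((-1 : R) • X - Y) by simp, Matrix.det_neg, h, mul_zero]
    simp [this, hX, hY]
  have hHX : vec3 H * vec4 X = -(vec4 X * vec3 H) := swap_mixed _ _
  have s1 : ι (form7 R) (c • X, 0) = c • vec4 X := by rw [vec4, ← map_smul]; simp
  have s2 : ι (form7 R) (-(c • X), 0) = -(c • vec4 X) := by rw [← s1, ← map_neg]; simp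
  have s3 : ι (form7 R) (0, H) = vec3 H := rfl
  rw [s1, ι_eq] at e1
  rw [s2, s3] at e2
  have h := mul_mem e1 e2
  have k1 : vec4 X * (vec4 Y * (vec4 X * vec3 H)) = 0 := by
    rw [← mul_assoc (vec4 Y), hYX, neg_mul, mul_assoc, mul_neg, ← mul_assoc, hXX, zero_mul, neg_zero]
  have k2 : vec4 X * (vec3 H * (vec4 X * vec3 H)) = 0 := by
    rw [← mul_assoc (vec3 H), hHX, neg_mul, mul_assoc, mul_neg, ← mul_assoc, hXX, zero_mul, neg_zero]
  convert! h using 1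
  simp only [add_mul, mul_add, one_mul, mul_one, smul_mul_assoc, mul_smul_comm, smul_add,
    neg_mul, mul_neg, mul_assoc, k1, k2, smul_zero]
  abel

theorem omegaCl_mem_spin {F : Type*} [Field F] (A : SL2 F × SL2 F × SL2 F) :
    omegaCl A ∈ spinGroup (form7 F) := by
  obtain ⟨A₁, A₂, A₃⟩ := A
  have h1 : ∀ A : SL2 F, omegaCl (A, 1, 1) ∈ spinGroup (form7 F) := by
    refine Matrix.SL2.transvection_induction _ (fun i j h c => ?_) fun A B hA hB => ?_
    · fin_cases i <;> fin_cases j <;> first | exact absurd rfl h | skip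
      · have := one_add_smul_mem_spin (-c) (X := (!![1, 0; 0, 0] : Mat2 F)) (Y := !![0, 1; 0, 0])
          (by simp) (by simp) (by simp [Matrix.det_fin_two])
        convert! this using 1
        rw [← blk12_one, omegaCl]
        simp [Matrix.SpecialLinearGroup.transvection_coe, blk1, blk2, blk3_one, unitsMap, vec4, vp, vr]
        abel
      · have := one_add_smul_mem_spin (-c) (X := (!![0, 0; 0, 1] : Mat2 F)) (Y := !![0, 0; 1, 0])
          (by simp) (by simp) (by simp [Matrix.det_fin_two])
        convert! this using 1
        rw [← blk12_one, omegaCl]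
        simp [Matrix.SpecialLinearGroup.transvection_coe, blk1, blk2, blk3_one, unitsMap, vec4, vq, vs]
        abel
    · have := mul_mem hA hB
      rwa [← map_mul, Prod.mk_mul_mk, Prod.mk_mul_mk, one_mul] at this
  have h2 : ∀ A : SL2 F, omegaCl (1, A, 1) ∈ spinGroup (form7 F) := by
    refine Matrix.SL2.transvection_induction _ (fun i j h c => ?_) fun A B hA hB => ?_
    · fin_cases i <;> fin_cases j <;> first | exact absurd rfl h | skip
      · have := one_add_smul_mem_spin c (X := (!![0, 0; 0, 1] : Mat2 F)) (Y := !![0, 1; 0, 0])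
          (by simp) (by simp) (by simp [Matrix.det_fin_two])
        convert! this using 1
        rw [← blk12_one, omegaCl]
        simp [Matrix.SpecialLinearGroup.transvection_coe, blk1, blk2, blk3_one, unitsMap, vec4, vq, vr]
        abel
      · have := one_add_smul_mem_spin c (X := (!![1, 0; 0, 0] : Mat2 F)) (Y := !![0, 0; 1, 0])
          (by simp) (by simp) (by simp [Matrix.det_fin_two])
        convert! this using 1
        rw [← blk12_one, omegaCl]
        simp [Matrix.SpecialLinearGroup.transvection_coe, blk1, blk2, blk3_one, unitsMap, vec4, vp, vs]
        abel
    · have := mul_mem hA hB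
      rwa [← map_mul, Prod.mk_mul_mk, Prod.mk_mul_mk, one_mul] at this
  have h3 : ∀ A : SL2 F, omegaCl (1, 1, A) ∈ spinGroup (form7 F) := by
    let H : Mat20 F := ⟨!![1, 0; 0, -1], by simp⟩
    refine Matrix.SL2.transvection_induction _ (fun i j h c => ?_) fun A B hA hB => ?_
    · fin_cases i <;> fin_cases j <;> first | exact absurd rfl h | skip
      · have := one_add_mem_spin (R := F) (a := (0, c • ⟨!![0, 1; 0, 0], by simp⟩)) (n := (0, H))
          (by simp [H, Matrix.det_fin_two]) (by simp [H, Matrix.det_fin_two])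
        have e : ι (form7 F) (0, c • ⟨!![0, 1; 0, 0], by simp⟩) = c • ve F := by
          rw [ve, ← map_smul]; simp
        have e' : ι (form7 F) (0, H) = vh F := rfl
        rw [e, e', smul_mul_assoc, eh] at this
        convert! this using 1
        rw [← blk3_one, omegaCl]
        simp [Matrix.SpecialLinearGroup.transvection_coe, blk12_one, blk3, unitsMap]
        abel
      · have := one_add_mem_spin (R := F) (a := (0, (-c) • ⟨!![0, 0; 1, 0], by simp⟩)) (n := (0, H))
          (by simp [H, Matrix.det_fin_two]) (by simp [H, Matrix.det_fin_two])
        have e : ι (form7 F) (0, (-c) • ⟨!![0, 0; 1, 0], by simp⟩) = (-c) • vf F := by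
          rw [vf, ← map_smul]; simp
        have e' : ι (form7 F) (0, H) = vh F := rfl
        rw [e, e', smul_mul_assoc, fh] at this
        convert! this using 1
        rw [← blk3_one, omegaCl]
        simp [Matrix.SpecialLinearGroup.transvection_coe, blk12_one, blk3, unitsMap]
        abel
    · have := mul_mem hA hB
      rwa [← map_mul, Prod.mk_mul_mk, Prod.mk_mul_mk, one_mul] at this
  have := mul_mem (mul_mem (h1 A₁) (h2 A₂)) (h3 A₃)
  rw [← map_mul, ← map_mul] at this
  simpa using this

/-- The homomorphism `ω : SL₂(F)³ → Spin₇(F)` that lifts the action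
`(X, Y) ↦ (A₁ X A₂⁻¹, A₃ Y A₃⁻¹)` of `SL₂(F)³` on `V`. -/
def omega (F : Type*) [Field F] : SL2 F × SL2 F × SL2 F →* Spin7 F :=
  omegaCl.codRestrict (spinGroup (form7 F)) omegaCl_mem_spin

theorem omegaCl_one_one_neg_one : omegaCl ((1, 1, -1) : SL2 R × SL2 R × SL2 R) = -1 := by
  have : blk3 (-1 : Mat2 R) = -1 := by
    rw [← blk3_one (R := R)]; simp [blk3, unitsMap]; abel
  simp [omegaCl, blk12_one, this]

theorem omega_neg_one {F : Type*} [Field F] : omega F (-1, -1, -1) = 1 := by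
  apply Subtype.ext
  have h1 : blk3 (-1 : Mat2 F) = -1 := by
    rw [← blk3_one (R := F)]; simp [blk3, unitsMap]; abel
  have h2 : blk1 (-1 : Mat2 F) + blk2 (-1 : Mat2 F) = -1 := by
    rw [← blk12_one (R := F)]; simp [blk1, blk2, unitsMap]; abel
  change omegaCl _ = 1
  simp [omegaCl, h1, h2]

section Kernel
variable {F : Type*} [Field F] [NeZero (2 : F)]

theorem cl7_nontrivial (F : Type*) [Field F] [NeZero (2 : F)] : Nontrivial (Cl7 F) := by
  have : Invertible (2 : F) := invertibleOfNonzero (NeZero.ne _)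
  infer_instance

theorem ι_form7_injective : Function.Injective (ι (form7 F)) := by
  have := cl7_nontrivial F
  rw [injective_iff_map_eq_zero]
  intro v hv
  have key : ∀ w, QuadraticMap.polar (form7 F) v w = 0 := fun w => by
    have h := ι_mul_ι_add_swap (Q := form7 F) v w
    rw [hv, zero_mul, mul_zero, add_zero] at h
    exact (algebraMap F (Cl7 F)).injective (by rw [← h, map_zero])
  have h2 : (2 : F) ≠ 0 := NeZero.ne _
  have a1 := key (!![1, 0; 0, 0], 0)
  have a2 := key (!![0, 1; 0, 0], 0)
  have a3 := key (!![0, 0; 1, 0], 0)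
  have a4 := key (!![0, 0; 0, 1], 0)
  have b1 := key (0, ⟨!![1, 0; 0, -1], by simp⟩)
  have b2 := key (0, ⟨!![0, 1; 0, 0], by simp⟩)
  have b3 := key (0, ⟨!![0, 0; 1, 0], by simp⟩)
  obtain ⟨X, Y⟩ := v
  simp [QuadraticMap.polar, Matrix.det_fin_two, Mat20_11] at a1 a2 a3 a4 b1 b2 b3
  have c1 : (Y : Mat2 F) 0 0 = 0 := by
    have : 2 * (Y : Mat2 F) 0 0 = 0 := by linear_combination -b1
    exact (mul_eq_zero.1 this).resolve_left h2
  refine Prod.ext ?_ (Subtype.ext ?_)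
  · ext i j
    fin_cases i <;> fin_cases j <;> simp
    · linear_combination a4
    · linear_combination -a3
    · linear_combination -a2
    · linear_combination a1
  · ext i j
    fin_cases i <;> fin_cases j <;> simp [Mat20_11, c1]
    · linear_combination -b3
    · linear_combination -b2

theorem eq_one_or_neg_one_of_commute {A : SL2 F}
    (h1 : (A : Mat2 F) * !![0, 1; 0, 0] = !![0, 1; 0, 0] * (A : Mat2 F))
    (h2 : (A : Mat2 F) * !![0, 0; 1, 0] = !![0, 0; 1, 0] * (A : Mat2 F)) : A = 1 ∨ A = -1 := by
  have d := A.2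
  rw [Matrix.det_fin_two] at d
  have a := congrFun (congrFun h1 0) 0
  have b := congrFun (congrFun h1 0) 1
  have c := congrFun (congrFun h2 0) 0
  simp [Matrix.mul_apply, Fin.sum_univ_two] at a b c
  rw [← b, c, zero_mul, sub_zero, mul_self_eq_one_iff] at d
  rcases d with d | d
  · left; ext i j; fin_cases i <;> fin_cases j <;> simp [← a, c, d, ← b]
  · right; ext i j; fin_cases i <;> fin_cases j <;> simp [← a, c, d, ← b]

/-- `ω` has kernel generated by `(-I, -I, -I)`. -/
theorem omega_eq_one_iff (A : SL2 F × SL2 F × SL2 F) :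
    omega F A = 1 ↔ A = 1 ∨ A = (-1, -1, -1) := by
  refine ⟨fun h => ?_, ?_⟩
  · obtain ⟨A₁, A₂, A₃⟩ := A
    have h : omegaCl (A₁, A₂, A₃) = 1 := congrArg Subtype.val h
    have key : ∀ (X : Mat2 F) (Y : Mat20 F), (A₁ : Mat2 F) * X = X * (A₂ : Mat2 F) ∧
        (A₃ : Mat2 F) * Y = Y * (A₃ : Mat2 F) := fun X Y => by
      have k := omegaCl_mul_ι A₁ A₂ A₃ X Y
      rw [h, one_mul, mul_one] at k
      have k := ι_form7_injective k
      have inv : ∀ A : SL2 F, ((A⁻¹ : SL2 F) : Mat2 F) * (A : Mat2 F) = 1 := fun A => by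
        rw [← Matrix.SpecialLinearGroup.coe_mul, inv_mul_cancel, Matrix.SpecialLinearGroup.coe_one]
      constructor
      · have k1 := congrArg Prod.fst k
        simp only at k1
        conv_rhs => rw [k1]
        rw [mul_assoc, inv, mul_one]
      · have k2 := congrArg (fun v : V7 F => (v.2 : Mat2 F)) k
        simp only [conj20] at k2
        conv_rhs => rw [k2]
        rw [mul_assoc, inv, mul_one]
    have e : A₁ = A₂ := Subtype.ext (by simpa using (key 1 0).1)
    subst e
    have f1 := eq_one_or_neg_one_of_commute (key _ 0).1 (key _ 0).1
    have f3 := eq_one_or_neg_one_of_commute (A := A₃) (key 0 ⟨!![0, 1; 0, 0], by simp⟩).2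
      (key 0 ⟨!![0, 0; 1, 0], by simp⟩).2
    have := cl7_nontrivial F
    have h2 : (2 : Cl7 F) ≠ 0 := by
      have := (algebraMap F (Cl7 F)).injective.ne (NeZero.ne (2 : F))
      rwa [map_ofNat, map_zero] at this
    have hne : (-1 : Cl7 F) ≠ 1 := fun h => h2 (by
      rw [← one_add_one_eq_two]; nth_rewrite 1 [← h]; rw [neg_add_cancel])
    have n1 := omegaCl_one_one_neg_one (R := F)
    have n2 : omegaCl ((-1, -1, -1) : SL2 F × SL2 F × SL2 F) = 1 :=
      congrArg Subtype.val (omega_neg_one (F := F))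
    rcases f1 with rfl | rfl <;> rcases f3 with rfl | rfl
    · left; rfl
    · exact absurd (n1.symm.trans h) hne
    · have : ((-1, -1, 1) : SL2 F × SL2 F × SL2 F) = (-1, -1, -1) * (1, 1, -1) := by simp
      rw [this, map_mul, n1, n2, one_mul] at h
      exact absurd h hne
    · right; rfl
  · rintro (rfl | rfl)
    · exact map_one _
    · exact omega_neg_one
end Kernel
end Omega

section PadicPow

/-- The power `X ^ u` with a 2-adic integer exponent, for `X` of 2-power order `2 ^ m`: it is `X ^ a` for any
integer `a ≡ u` modulo `2 ^ m`. -/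
def padicPow {G : Type*} [Group G] (X : G) (u : ℤ_[2]) : G :=
  X ^ (PadicInt.toZModPow (padicValNat 2 (orderOf X)) u).val

theorem padicPow_eq {G : Type*} [Group G] {X : G} {n : ℕ} (h : X ^ 2 ^ n = 1) (u : ℤ_[2]) :
    padicPow X u = X ^ (PadicInt.toZModPow n u).val := by
  obtain ⟨m, hm, ho⟩ := (Nat.dvd_prime_pow Nat.prime_two).1 (orderOf_dvd_of_pow_eq_one h)
  rw [padicPow, pow_eq_pow_iff_modEq, ho, padicValNat.prime_pow, ← ZMod.natCast_eq_natCast_iff,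
    ZMod.natCast_zmod_val]
  rw [← PadicInt.cast_toZModPow m n hm u, ZMod.natCast_val]

theorem padicPow_one {G : Type*} [Group G] {X : G} {n : ℕ} (h : X ^ 2 ^ n = 1) :
    padicPow X 1 = X := by
  have h' : X ^ 2 ^ (n + 1) = 1 := by rw [pow_succ, pow_mul, h, one_pow]
  have : Fact (1 < 2 ^ (n + 1)) := ⟨Nat.one_lt_two_pow (by simp)⟩
  rw [padicPow_eq h', map_one, ZMod.val_one, pow_one]

theorem padicPow_padicPow {G : Type*} [Group G] {X : G} {n : ℕ} (h : X ^ 2 ^ n = 1)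
    (u v : ℤ_[2]) : padicPow (padicPow X u) v = padicPow X (u * v) := by
  have h' : (padicPow X u) ^ 2 ^ n = 1 := by
    rw [padicPow, ← pow_mul, mul_comm, pow_mul, h, one_pow]
  rw [padicPow_eq h', padicPow_eq h, padicPow_eq h, ← pow_mul, map_mul, ZMod.val_mul,
    pow_eq_pow_iff_modEq]
  exact ((Nat.mod_modEq _ _).symm).of_dvd (orderOf_dvd_of_pow_eq_one h)

theorem padicPow_mul {G : Type*} [CommGroup G] {X Y : G} {m n : ℕ} (hX : X ^ 2 ^ m = 1)
    (hY : Y ^ 2 ^ n = 1) (u : ℤ_[2]) : padicPow (X * Y) u = padicPow X u * padicPow Y u := by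
  have hX' : X ^ 2 ^ (m + n) = 1 := by rw [pow_add, pow_mul, hX, one_pow]
  have hY' : Y ^ 2 ^ (m + n) = 1 := by rw [add_comm, pow_add, pow_mul, hY, one_pow]
  have hXY : (X * Y) ^ 2 ^ (m + n) = 1 := by rw [mul_pow, hX', hY', one_mul]
  rw [padicPow_eq hX', padicPow_eq hY', padicPow_eq hXY, mul_pow]

/-- The automorphism `X ↦ X ^ u` of an abelian group all of whose elements have 2-power order. -/
def padicPowAut {G : Type*} [CommGroup G] (hG : ∀ X : G, ∃ n : ℕ, X ^ 2 ^ n = 1) (u : ℤ_[2]ˣ) :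
    MulAut G where
  toFun X := padicPow X u
  invFun X := padicPow X (u⁻¹ : ℤ_[2]ˣ)
  left_inv X := by
    obtain ⟨n, h⟩ := hG X
    simp only
    rw [padicPow_padicPow h, Units.mul_inv, padicPow_one h]
  right_inv X := by
    obtain ⟨n, h⟩ := hG X
    simp only
    rw [padicPow_padicPow h, Units.inv_mul, padicPow_one h]
  map_mul' X Y := by
    obtain ⟨m, h⟩ := hG X
    obtain ⟨n, h'⟩ := hG Y
    exact padicPow_mul h h' u
end PadicPow

section Torus
variable {F : Type*} [Field F]

theorem eq_smul_of_commute {A X : Mat2 F} (hA : ∀ c : F, A ≠ c • 1) (h : X * A = A * X) :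
    ∃ a b : F, X = a • 1 + b • A := by
  have e00 := congrFun (congrFun h 0) 0
  have e01 := congrFun (congrFun h 0) 1
  have e10 := congrFun (congrFun h 1) 0
  simp only [Matrix.mul_apply, Fin.sum_univ_two] at e00 e01 e10
  have sc : A 0 1 ≠ 0 ∨ A 1 0 ≠ 0 ∨ A 0 0 - A 1 1 ≠ 0 := by
    by_contra! hc
    obtain ⟨h1, h2, h3⟩ := hc
    refine hA (A 0 0) ?_
    ext i j
    fin_cases i <;> fin_cases j <;> simp [h1, h2]
    linear_combination -h3
  rcases sc with h0 | h0 | h0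
  · refine ⟨X 0 0 - X 0 1 / A 0 1 * A 0 0, X 0 1 / A 0 1, ?_⟩
    ext i j
    fin_cases i <;> fin_cases j <;> simp <;> field_simp
    · linear_combination -e00
    · linear_combination -e01
  · refine ⟨X 0 0 - X 1 0 / A 1 0 * A 0 0, X 1 0 / A 1 0, ?_⟩
    ext i j
    fin_cases i <;> fin_cases j <;> simp <;> field_simp
    · linear_combination e00
    · linear_combination e10
  · refine ⟨X 0 0 - (X 0 0 - X 1 1) / (A 0 0 - A 1 1) * A 0 0,
      (X 0 0 - X 1 1) / (A 0 0 - A 1 1), ?_⟩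
    ext i j
    fin_cases i <;> fin_cases j <;> simp <;> field_simp
    · linear_combination -e01
    · linear_combination e10
    · ring

theorem commute_of_orderOf {A X Y : SL2 F} (hA : orderOf A = 4) (hX : X * A = A * X)
    (hY : Y * A = A * Y) : X * Y = Y * X := by
  have hs : ∀ c : F, (A : Mat2 F) ≠ c • 1 := fun c hc => by
    have d := A.2
    rw [hc, Matrix.det_smul] at d
    have : A ^ 2 = 1 := Subtype.ext (by
      rw [Matrix.SpecialLinearGroup.coe_pow, hc, smul_pow, one_pow]
      rw [Fintype.card_fin, Matrix.det_one, mul_one] at d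
      simp [d])
    have := orderOf_dvd_of_pow_eq_one this
    rw [hA] at this
    omega
  obtain ⟨a, b, hX'⟩ := eq_smul_of_commute hs (X := X) (congrArg Subtype.val hX)
  obtain ⟨c, d, hY'⟩ := eq_smul_of_commute hs (X := Y) (congrArg Subtype.val hY)
  apply Subtype.ext
  rw [Matrix.SpecialLinearGroup.coe_mul, Matrix.SpecialLinearGroup.coe_mul, hX', hY']
  simp only [add_mul, mul_add, smul_mul_assoc, mul_smul_comm, one_mul, mul_one]
  module

/-- The group `C(q^∞)` of all elements of 2-power order in the centralizer of `A` in `SL₂(F)`. -/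
def Cinf (A : SL2 F) (hA : orderOf A = 4) : Subgroup (SL2 F) where
  carrier := {X | X * A = A * X ∧ ∃ k : ℕ, X ^ 2 ^ k = 1}
  one_mem' := ⟨by simp, 0, by simp⟩
  mul_mem' := by
    rintro X Y ⟨hX, k, hk⟩ ⟨hY, l, hl⟩
    refine ⟨by rw [mul_assoc, hY, ← mul_assoc, hX, mul_assoc], k + l, ?_⟩
    rw [(show Commute X Y from commute_of_orderOf hA hX hY).mul_pow, pow_add, pow_mul, hk, one_pow,
      mul_comm (2 ^ k), pow_mul, hl, one_pow, one_mul]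
  inv_mem' := by
    rintro X ⟨hX, k, hk⟩
    exact ⟨(show Commute X A from hX).inv_left, k, by rw [inv_pow, hk, inv_one]⟩

instance (A : SL2 F) (hA : orderOf A = 4) : CommGroup (Cinf A hA) :=
  { (inferInstance : Group (Cinf A hA)) with
    mul_comm := fun X Y => Subtype.ext (commute_of_orderOf hA X.2.1 Y.2.1) }

variable (A : SL2 F) (hA : orderOf A = 4)

theorem Cinf_pow (X : Cinf A hA) : ∃ k : ℕ, X ^ 2 ^ k = 1 := by
  obtain ⟨k, hk⟩ := X.2.2
  exact ⟨k, Subtype.ext hk⟩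

/-- The restriction of `ω` to `C(q^∞)³`. -/
def omegaC : Cinf A hA × Cinf A hA × Cinf A hA →* Spin7 F :=
  (omega F).comp ((Cinf A hA).subtype.prodMap ((Cinf A hA).subtype.prodMap (Cinf A hA).subtype))

/-- The group `A(q^∞) = ω(C(q^∞)³)`. -/
abbrev Ainf : Subgroup (Spin7 F) := (omegaC A hA).range

/-- The element `-I` of `C(q^∞)`. -/
def negC : Cinf A hA := ⟨-1, by simp, 1, by simp⟩

variable [NeZero (2 : F)]

theorem omegaC_eq_one_iff (X : Cinf A hA × Cinf A hA × Cinf A hA) :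
    omegaC A hA X = 1 ↔ X = 1 ∨ X = (negC A hA, negC A hA, negC A hA) := by
  change omega F (X.1, X.2.1, X.2.2) = 1 ↔ _
  rw [omega_eq_one_iff]
  simp only [Prod.ext_iff, Subtype.ext_iff]
  rfl

/-- The automorphism of `A(q^∞)` induced by an automorphism of `C(q^∞)³` that fixes `(-I, -I, -I)`. -/
def descend (φ : MulAut (Cinf A hA × Cinf A hA × Cinf A hA))
    (hφ : φ (negC A hA, negC A hA, negC A hA) =
      (negC A hA, negC A hA, negC A hA)) : MulAut (Ainf A hA) :=
  (QuotientGroup.quotientKerEquivRange (omegaC A hA)).symm.trans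
    ((QuotientGroup.congr _ _ φ (by
      ext X
      rw [Subgroup.mem_map]
      constructor
      · rintro ⟨Y, hY, rfl⟩
        rw [MonoidHom.mem_ker, omegaC_eq_one_iff] at hY ⊢
        rcases hY with rfl | rfl
        · left; simp
        · right; exact hφ
      · intro hX
        rw [MonoidHom.mem_ker, omegaC_eq_one_iff] at hX
        rcases hX with rfl | rfl
        · exact ⟨1, one_mem _, by simp⟩
        · exact ⟨_, (omegaC_eq_one_iff A hA _).2 (Or.inr rfl), hφ⟩)).trans
      (QuotientGroup.quotientKerEquivRange (omegaC A hA)))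

theorem descend_apply (φ : MulAut (Cinf A hA × Cinf A hA × Cinf A hA)) (hφ)
    (X : Cinf A hA × Cinf A hA × Cinf A hA) :
    descend A hA φ hφ ((omegaC A hA).rangeRestrict X) =
      (omegaC A hA).rangeRestrict (φ X) := by
  have : (QuotientGroup.quotientKerEquivRange (omegaC A hA)).symm
      ((omegaC A hA).rangeRestrict X) = (X : _ ⧸ (omegaC A hA).ker) := by
    rw [MulEquiv.symm_apply_eq]; rfl
  rw [descend, MulEquiv.trans_apply, this]
  rfl

/-- The automorphism `(X₁, X₂, X₃) ↦ (X₃, X₁, X₂)` of `G³`. -/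
def rotate (G : Type*) [Group G] : MulAut (G × G × G) where
  toFun X := (X.2.2, X.1, X.2.1)
  invFun X := (X.2.1, X.2.2, X.1)
  left_inv _ := rfl
  right_inv _ := rfl
  map_mul' _ _ := rfl

/-- The automorphism `γ : [X₁, X₂, X₃] ↦ [X₃, X₁, X₂]` of `A(q^∞)`. -/
def gamma : MulAut (Ainf A hA) := descend A hA (rotate _) rfl

theorem padicPow_neg (u : ℤ_[2]ˣ) : padicPow (negC A hA) u = negC A hA := by
  have h : (negC A hA) ^ 2 ^ 1 = 1 := Subtype.ext (by simp [negC])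
  have : ∀ a : (ZMod (2 ^ 1))ˣ, (a : ZMod (2 ^ 1)).val = 1 := by decide
  have := this (Units.map (PadicInt.toZModPow 1 : ℤ_[2] →+* ZMod (2 ^ 1)).toMonoidHom u)
  rw [padicPow_eq h]
  rw [show (PadicInt.toZModPow 1 (u : ℤ_[2])).val = 1 from this, pow_one]

/-- The automorphism `δ_u : [X₁, X₂, X₃] ↦ [X₁, X₂, X₃ ^ u]` of `A(q^∞)`. -/
def delta (u : ℤ_[2]ˣ) : MulAut (Ainf A hA) :=
  descend A hA ((MulEquiv.refl _).prodCongr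
    ((MulEquiv.refl _).prodCongr (padicPowAut (Cinf_pow A hA) u)))
    (Prod.ext rfl (Prod.ext rfl (padicPow_neg A hA u)))

theorem gamma_apply (X₁ X₂ X₃ : Cinf A hA) :
    (gamma A hA ((omegaC A hA).rangeRestrict (X₁, X₂, X₃)) : Spin7 F) = omega F (X₃, X₁, X₂) :=
  congrArg Subtype.val (descend_apply A hA _ _ (X₁, X₂, X₃))

theorem delta_apply (u : ℤ_[2]ˣ) (X₁ X₂ X₃ : Cinf A hA) :
    (delta A hA u ((omegaC A hA).rangeRestrict (X₁, X₂, X₃)) : Spin7 F) =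
      omega F (X₁, X₂, (padicPow X₃ (u : ℤ_[2]) : Cinf A hA)) :=
  congrArg Subtype.val (descend_apply A hA _ _ (X₁, X₂, X₃))

/-- The automorphism `γ_u = δ_u γ δ_u⁻¹` of `A(q^∞)`. -/
def gammaU (u : ℤ_[2]ˣ) : MulAut (Ainf A hA) := delta A hA u * gamma A hA * (delta A hA u)⁻¹
end Torus

section Aut
/-- The group `Aut_L(H)` of all automorphisms of `H` of the form `x ↦ g x g⁻¹` with `g ∈ L`. -/
def autBy {G : Type*} [Group G] (L H : Subgroup G) : Subgroup (MulAut H) where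
  carrier := {φ | ∃ g ∈ L, ∀ x : H, (φ x : G) = g * x * g⁻¹}
  one_mem' := ⟨1, one_mem _, by simp⟩
  mul_mem' := by
    rintro φ ψ ⟨g, hg, h⟩ ⟨g', hg', h'⟩
    exact ⟨g * g', mul_mem hg hg', fun x => by rw [MulAut.mul_apply, h, h']; group⟩
  inv_mem' := by
    rintro φ ⟨g, hg, h⟩
    refine ⟨g⁻¹, inv_mem hg, fun x => ?_⟩
    have := h (φ⁻¹ x)
    rw [MulAut.apply_inv_self] at this
    rw [this]; group
end Aut

section Finite
variable (L F : Type*) [Field L] [Field F] [Algebra L F]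

/-- The inclusion `V(L) → V(F)`. -/
def mapV : V7 L →ₗ[L] V7 F where
  toFun v := (v.1.map (algebraMap L F), ⟨(v.2 : Mat2 L).map (algebraMap L F), by
    have := v.2.2
    simp only [LinearMap.mem_ker, Matrix.traceLinearMap_apply, Matrix.trace_fin_two] at this ⊢
    simp [← map_add, this]⟩)
  map_add' v w := by ext <;> simp
  map_smul' a v := by ext <;> simp [Algebra.smul_def (A := F)]

theorem form7_mapV (v : V7 L) : form7 F (mapV L F v) = algebraMap L F (form7 L v) := by
  simp [mapV, Matrix.det_fin_two]

/-- The induced homomorphism from the Clifford algebra over `L` to the one over `F`. -/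
def clMap : Cl7 L →ₐ[L] Cl7 F :=
  CliffordAlgebra.lift (form7 L) ⟨((ι (form7 F)).restrictScalars L).comp (mapV L F), fun v => by
    simp only [LinearMap.comp_apply, LinearMap.restrictScalars_apply]
    rw [ι_sq_scalar, form7_mapV, ← IsScalarTower.algebraMap_apply]⟩

/-- The group `Spin₇(L)`, as a subgroup of `Spin₇(F)`. -/
def spin7Over : Subgroup (Spin7 F) where
  carrier := {g | ∃ h : Spin7 L, clMap L F (h : Cl7 L) = (g : Cl7 F)}
  one_mem' := ⟨1, by simp⟩
  mul_mem' := by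
    rintro g g' ⟨h, hh⟩ ⟨h', hh'⟩
    exact ⟨h * h', by simp [hh, hh']⟩
  inv_mem' := by
    rintro g ⟨h, hh⟩
    refine ⟨h⁻¹, ?_⟩
    have e1 : (g : Cl7 F) * clMap L F ((h⁻¹ : Spin7 L) : Cl7 L) = 1 := by
      rw [← hh, ← map_mul, ← Submonoid.coe_mul, mul_inv_cancel, Submonoid.coe_one, map_one]
    have e2 : ((g⁻¹ : Spin7 F) : Cl7 F) * (g : Cl7 F) = 1 := by
      rw [← Submonoid.coe_mul, inv_mul_cancel, Submonoid.coe_one]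
    exact (left_inv_eq_right_inv e2 e1).symm

/-- The subfield `{x | x ^ (q ^ n) = x}` of `F`, where `q = |K|`; it has `q ^ n` elements if `F` is
algebraically closed and `n ≥ 1`. -/
def subfieldQ (K F : Type*) [Field K] [Finite K] [Field F] [Algebra K F] (n : ℕ) :
    IntermediateField K F where
  carrier := {x | x ^ Nat.card K ^ n = x}
  mul_mem' := fun {x y} hx hy => by
    rw [Set.mem_ofPred_eq] at *; rw [mul_pow, hx, hy]
  add_mem' := fun {x y} hx hy => by
    rw [Set.mem_ofPred_eq] at *
    have := Fintype.ofFinite K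
    have h : ∀ z, (FiniteField.frobeniusAlgHom K F ^ n) z = z ^ Nat.card K ^ n := fun z => by
      clear hx hy
      induction n with
      | zero => simp
      | succ n ih => rw [pow_succ', AlgHom.mul_apply, ih, FiniteField.frobeniusAlgHom_apply,
          Nat.card_eq_fintype_card, ← pow_mul, ← pow_succ]
    rw [← h, map_add, h, h, hx, hy]
  algebraMap_mem' := fun x => by
    have := Fintype.ofFinite K
    rw [Set.mem_ofPred_eq, ← map_pow, Nat.card_eq_fintype_card, FiniteField.pow_card_pow]
  inv_mem' := fun x hx => by
    rw [Set.mem_ofPred_eq] at *; rw [inv_pow, hx]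
end Finite

section Omega
variable (K : Type*) {F : Type*} [Field K] [Finite K] [Field F] [Algebra K F]
  (A : SL2 F) (hA : orderOf A = 4)

/-- The group `Ω_u`, generated by `Aut_{Spin₇(F)}(A(q^∞))` and `γ_u`. -/
def OmegaU [NeZero (2 : F)] (u : ℤ_[2]ˣ) : Subgroup (MulAut (Ainf A hA)) :=
  autBy ⊤ (Ainf A hA) ⊔ Subgroup.zpowers (gammaU A hA u)

/-- The subgroup of those elements of a group `Ω` of automorphisms of `H` that fix every `x ∈ H`
with `x ^ 2 = 1`. -/
def fixTwoTorsion {H : Type*} [Group H] (Ω : Subgroup (MulAut H)) : Subgroup (MulAut H) where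
  carrier := {φ | φ ∈ Ω ∧ ∀ x : H, x ^ 2 = 1 → φ x = x}
  one_mem' := ⟨one_mem _, fun _ _ => rfl⟩
  mul_mem' := by
    rintro φ ψ ⟨h, h2⟩ ⟨k, k2⟩
    exact ⟨mul_mem h k, fun x hx => by rw [MulAut.mul_apply, k2 x hx, h2 x hx]⟩
  inv_mem' := by
    rintro φ ⟨h, h2⟩
    refine ⟨inv_mem h, fun x hx => ?_⟩
    have := congrArg (fun y => φ⁻¹ y) (h2 x hx)
    simp only [MulAut.inv_apply_self] at this
    exact this.symm

/-- The group `Spin₇(q ^ n)`, as a subgroup of `Spin₇(F)`, where `q = |K|`. -/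
def spin7Level (F : Type*) [Field F] [Algebra K F] (n : ℕ) : Subgroup (Spin7 F) :=
  spin7Over (subfieldQ K F n) F

/-- The group `A(q ^ n) = A(q^∞) ∩ Spin₇(q ^ n)`. -/
def Alevel (n : ℕ) : Subgroup (Spin7 F) := Ainf A hA ⊓ spin7Level K F n
end Omega

end SolSpin
end

/-! ### The reflection group G₂₄ and its reduction modulo 2 -/

namespace SolSpin

/-! Write C for C(q^∞). It is a divisible abelian 2-group with -I as its only involution, hence a
module over ℤ₂, and A(q^∞) is C³ modulo (-I, -I, -I), a discrete torus of rank 3. The group Spin₇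
induces on it the Weyl group of B₃. The complex reflection group G₂₄ is defined over ℤ[ω] with ω² +
ω + 2 = 0 and contains this Weyl group. The polynomial X² + X + 2 has a unit root v in ℤ₂, so ω ↦ v
lets G₂₄ act on cubes of ℤ₂-modules. The map `rootCoord` from C³ onto C³ has kernel exactly ⟨(-I,
-I, -I)⟩ and so identifies A(q^∞) with C³. Under this identification three generators of G₂₄ become
generators of the Weyl group, and the fourth, `cyclic`, becomes γ_u with u = v⁻¹. Hence Ω_u is the
image of G₂₄.

The structure of G₂₄ comes from the reduction ω ↦ 1 to GL₃(2). It is onto because all elementary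
matrices are hit, and an element of its kernel is 1 or -1 because it permutes 42 roots. The
determinant, which is ±1 on G₂₄, separates 1 from -1, so G₂₄ is {±1} × GL₃(2). Since v is odd, the
action on the 2-torsion of the torus is this reduction. This gives faithfulness and part (a), with
-1 acting as inversion.

That Spin₇ induces no further automorphisms (`exists_weyl_commute`) is seen from the half turns in
the three planes of V on which the torus acts. These are square roots of the central element z = -1.
Conjugation preserves the square roots of z in the torus, and the dimension of the fixed space in V
tells the half turns and their negatives from the remaining roots. After correction by a Weyl
element, a conjugating element commutes with the three half turns. It then centralizes the torus,
because the torus is generated by elements of the form a + b·h in the Clifford algebra, with h a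
half turn.

For a finite level, Frobenius acts on the torus as a power map t ↦ t^m with m ≡ 1 mod 4, and A(q^n)
is the subgroup where t^m = t. So A(q^n) is preserved by all automorphisms of A(q^∞) and contains
all elements of order dividing 4. The argument above uses only 2-torsion and half turns, and the
Weyl elements are defined over the small field, so it applies unchanged. -/

/-- The ring of integers `ℤ[ω]`, `ω² + ω + 2 = 0`, of `ℚ(√-7)`. -/
abbrev IntSqrtNegSeven := QuadraticAlgebra ℤ (-2) (-1)

local notation "𝓞₇" => IntSqrtNegSeven

/-- The sign change of the second coordinate, in a basis of the root lattice. -/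
def signTwo : GL (Fin 3) 𝓞₇ where
  val := !![⟨1, 0⟩, ⟨-1, -1⟩, ⟨1, 0⟩; ⟨0, 0⟩, ⟨-1, 0⟩, ⟨0, -1⟩; ⟨0, 0⟩, ⟨0, 0⟩, ⟨1, 0⟩]
  inv := !![⟨1, 0⟩, ⟨-1, -1⟩, ⟨1, 0⟩; ⟨0, 0⟩, ⟨-1, 0⟩, ⟨0, -1⟩; ⟨0, 0⟩, ⟨0, 0⟩, ⟨1, 0⟩]
  val_inv := by decide +kernel
  inv_val := by decide +kernel

/-- The sign change of the third coordinate, in a basis of the root lattice. -/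
def signThree : GL (Fin 3) 𝓞₇ where
  val := !![⟨1, 0⟩, ⟨0, 0⟩, ⟨-1, 1⟩; ⟨0, 0⟩, ⟨1, 0⟩, ⟨0, 1⟩; ⟨0, 0⟩, ⟨0, 0⟩, ⟨-1, 0⟩]
  inv := !![⟨1, 0⟩, ⟨0, 0⟩, ⟨-1, 1⟩; ⟨0, 0⟩, ⟨1, 0⟩, ⟨0, 1⟩; ⟨0, 0⟩, ⟨0, 0⟩, ⟨-1, 0⟩]
  val_inv := by decide +kernel
  inv_val := by decide +kernel

/-- The interchange of the first and third short roots of `B₃`, in a basis of the root lattice. -/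
def shortSwap : GL (Fin 3) 𝓞₇ where
  val := !![⟨2, 1⟩, ⟨1, -1⟩, ⟨-1, 1⟩; ⟨1, 0⟩, ⟨0, -1⟩, ⟨1, 1⟩; ⟨0, 1⟩, ⟨2, 0⟩, ⟨-1, 0⟩]
  inv := !![⟨2, 1⟩, ⟨1, -1⟩, ⟨-1, 1⟩; ⟨1, 0⟩, ⟨0, -1⟩, ⟨1, 1⟩; ⟨0, 1⟩, ⟨2, 0⟩, ⟨-1, 0⟩]
  val_inv := by decide +kernel
  inv_val := by decide +kernel

/-- The cyclic permutation of the three coordinates, in a basis of the root lattice. -/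
def cyclic : GL (Fin 3) 𝓞₇ where
  val := !![⟨-1, 0⟩, ⟨-1, 0⟩, ⟨1, -1⟩; ⟨0, 1⟩, ⟨0, 0⟩, ⟨-1, -1⟩; ⟨0, 0⟩, ⟨-1, -1⟩, ⟨1, 0⟩]
  inv := !![⟨-1, 0⟩, ⟨-1, 0⟩, ⟨1, -1⟩; ⟨0, 1⟩, ⟨0, 0⟩, ⟨-1, -1⟩; ⟨0, 0⟩, ⟨-1, -1⟩, ⟨1, 0⟩] *
    !![⟨-1, 0⟩, ⟨-1, 0⟩, ⟨1, -1⟩; ⟨0, 1⟩, ⟨0, 0⟩, ⟨-1, -1⟩; ⟨0, 0⟩, ⟨-1, -1⟩, ⟨1, 0⟩]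
  val_inv := by decide +kernel
  inv_val := by decide +kernel

/-- The complex reflection group `G₂₄` of order 336. -/
def G24 : Subgroup (GL (Fin 3) 𝓞₇) :=
  Subgroup.closure {signTwo, signThree, shortSwap, cyclic}

theorem signTwo_mem : signTwo ∈ G24 := Subgroup.subset_closure (by simp)
theorem signThree_mem : signThree ∈ G24 := Subgroup.subset_closure (by simp)
theorem shortSwap_mem : shortSwap ∈ G24 := Subgroup.subset_closure (by simp)
theorem cyclic_mem : cyclic ∈ G24 := Subgroup.subset_closure (by simp)

/-- One root of `G₂₄` from each pair of opposite roots. -/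
def positiveRoots : List (Fin 3 → 𝓞₇) :=
  [![⟨1, 0⟩, ⟨0, 0⟩, ⟨0, 0⟩], ![⟨0, 0⟩, ⟨1, 0⟩, ⟨0, 0⟩], ![⟨0, 0⟩, ⟨0, 0⟩, ⟨1, 0⟩],
   ![⟨1, 0⟩, ⟨0, 0⟩, ⟨1, 1⟩], ![⟨0, -1⟩, ⟨-1, -1⟩, ⟨1, 0⟩], ![⟨-1, 0⟩, ⟨0, 1⟩, ⟨-1, 0⟩],
   ![⟨1, 0⟩, ⟨1, 0⟩, ⟨1, 0⟩], ![⟨0, 0⟩, ⟨1, 0⟩, ⟨1, 0⟩], ![⟨1, 0⟩, ⟨1, 0⟩, ⟨1, 1⟩],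
   ![⟨-1, -1⟩, ⟨-1, -1⟩, ⟨0, -1⟩], ![⟨2, 1⟩, ⟨1, 0⟩, ⟨1, 1⟩], ![⟨-1, 1⟩, ⟨0, 1⟩, ⟨-1, 0⟩],
   ![⟨-1, 1⟩, ⟨0, 1⟩, ⟨-2, 0⟩], ![⟨-2, -1⟩, ⟨-2, 0⟩, ⟨-1, -1⟩], ![⟨-1, 0⟩, ⟨0, 1⟩, ⟨0, 0⟩],
   ![⟨0, 1⟩, ⟨0, 0⟩, ⟨-1, 0⟩], ![⟨-1, -1⟩, ⟨-1, 0⟩, ⟨0, -1⟩], ![⟨-2, -1⟩, ⟨-1, 0⟩, ⟨0, -1⟩],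
   ![⟨1, 1⟩, ⟨1, 0⟩, ⟨0, 0⟩], ![⟨0, 1⟩, ⟨1, 1⟩, ⟨0, 1⟩], ![⟨1, -1⟩, ⟨-1, -1⟩, ⟨1, 0⟩]]

/-- The 42 roots of `G₂₄`. -/
def rootList : List (Fin 3 → 𝓞₇) := positiveRoots ++ positiveRoots.map fun r => -r

/-- A finite invariant set replaces an enumeration of the group. Invariance under g⁻¹ is carried
along so that the induction over the closure passes through inverses. -/
theorem mulVec_mem_rootList {g : GL (Fin 3) 𝓞₇} (hg : g ∈ G24) :
    ∀ r ∈ rootList, g.1.mulVec r ∈ rootList := by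
  suffices h : (∀ r ∈ rootList, g.1.mulVec r ∈ rootList) ∧
      ∀ r ∈ rootList, (g⁻¹).1.mulVec r ∈ rootList from h.1
  induction hg using Subgroup.closure_induction with
  | mem x hx =>
    simp only [Set.mem_insert_iff, Set.mem_singleton_iff] at hx
    rcases hx with rfl | rfl | rfl | rfl <;> constructor <;> decide +kernel
  | one => simp
  | mul x y _ _ hx hy =>
    refine ⟨fun r hr => ?_, fun r hr => ?_⟩
    · rw [Units.val_mul, ← Matrix.mulVec_mulVec]
      exact hx.1 _ (hy.1 _ hr)
    · rw [mul_inv_rev, Units.val_mul, ← Matrix.mulVec_mulVec]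
      exact hy.2 _ (hx.2 _ hr)
  | inv x _ hx => rw [inv_inv]; exact ⟨hx.2, hx.1⟩

/-- The reduction `ℤ[ω] → 𝔽₂`, `ω ↦ 1`. -/
def redTwo : 𝓞₇ →+* ZMod 2 := (QuadraticAlgebra.lift ⟨(1 : ZMod 2), by decide⟩).toRingHom

theorem redTwo_apply (x : 𝓞₇) : redTwo x = x.re + x.im := by
  simp [redTwo]

/-- The reduction `GL₃(ℤ[ω]) → GL₃(𝔽₂)`. -/
def redGL : GL (Fin 3) 𝓞₇ →* GL (Fin 3) (ZMod 2) := Matrix.GeneralLinearGroup.map redTwo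

theorem redGL_apply (g : GL (Fin 3) 𝓞₇) (i j : Fin 3) : (redGL g).1 i j = redTwo (g.1 i j) := rfl

/-- The roots that reduce to a given vector modulo 2. -/
def rootsOver (x : Fin 3 → ZMod 2) : List (Fin 3 → 𝓞₇) :=
  rootList.filter fun r => ∀ i, ((r i).re + (r i).im : ZMod 2) = x i

/-- Six roots lie over each nonzero vector of 𝔽₂³, so 6³ triples of columns have to be examined. The
coefficients 2 + ω, 1, 1 + ω are the coordinates of one more root; requiring its image to be a root
leaves only the standard basis and its negative. -/
theorem columns_of_roots : ∀ a ∈ rootsOver ![1, 0, 0], ∀ b ∈ rootsOver ![0, 1, 0],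
    ∀ c ∈ rootsOver ![0, 0, 1],
      (fun i => a i * ⟨2, 1⟩ + b i + c i * ⟨1, 1⟩) ∈ rootList →
      (a = ![1, 0, 0] ∧ b = ![0, 1, 0] ∧ c = ![0, 0, 1]) ∨
      (a = ![-1, 0, 0] ∧ b = ![0, -1, 0] ∧ c = ![0, 0, -1]) := by
  decide +kernel

/-- The standard basis vectors are roots, so the columns of g are roots, and each reduces to the
corresponding basis vector. This puts them within reach of `columns_of_roots`. -/
theorem eq_one_or_neg_one_of_redGL {g : GL (Fin 3) 𝓞₇} (hg : g ∈ G24) (h : redGL g = 1) :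
    g = 1 ∨ g = -1 := by
  have hr := mulVec_mem_rootList hg
  have hred : ∀ i j, redTwo (g.1 i j) = (1 : Matrix (Fin 3) (Fin 3) (ZMod 2)) i j := fun i j => by
    rw [← redGL_apply, h]; rfl
  have hcol : ∀ j, (fun i => g.1 i j) ∈ rootsOver fun i => (1 : Matrix _ _ (ZMod 2)) i j := by
    intro j
    rw [rootsOver, List.mem_filter]
    constructor
    · have := hr (Pi.single j 1) (by fin_cases j <;> decide +kernel)
      rw [Matrix.mulVec_single_one] at this
      exact this
    · simp only [← redTwo_apply, hred, decide_true, implies_true]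
  have e0 : (fun i => (1 : Matrix (Fin 3) (Fin 3) (ZMod 2)) i 0) = ![1, 0, 0] := by decide
  have e1 : (fun i => (1 : Matrix (Fin 3) (Fin 3) (ZMod 2)) i 1) = ![0, 1, 0] := by decide
  have e2 : (fun i => (1 : Matrix (Fin 3) (Fin 3) (ZMod 2)) i 2) = ![0, 0, 1] := by decide
  have key := columns_of_roots _ (e0 ▸ hcol 0) _ (e1 ▸ hcol 1) _ (e2 ▸ hcol 2) (by
    have := hr ![⟨2, 1⟩, 1, ⟨1, 1⟩] (by decide +kernel)
    convert this using 1
    ext1 i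
    simp [Matrix.mulVec, dotProduct, Fin.sum_univ_three])
  have hdiag : ∀ d : 𝓞₇, (fun i => g.1 i 0) = ![d, 0, 0] → (fun i => g.1 i 1) = ![0, d, 0] →
      (fun i => g.1 i 2) = ![0, 0, d] → g.1 = d • 1 := fun d h0 h1 h2 => Matrix.ext fun i j => by
    fin_cases j
    · exact (congrFun h0 i).trans (by fin_cases i <;> simp)
    · exact (congrFun h1 i).trans (by fin_cases i <;> simp)
    · exact (congrFun h2 i).trans (by fin_cases i <;> simp)
  rcases key with ⟨h0, h1, h2⟩ | ⟨h0, h1, h2⟩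
  · left
    exact Units.ext ((hdiag 1 h0 h1 h2).trans (one_smul _ _))
  · right
    exact Units.ext ((hdiag (-1) h0 h1 h2).trans (neg_one_smul _ _))

theorem neg_one_mem_G24 : (-1 : GL (Fin 3) 𝓞₇) ∈ G24 := by
  -- Conjugation by the cyclic permutation turns the sign change of the third coordinate into that
  -- of the first, so this is the product of all three sign changes.
  have : (-1 : GL (Fin 3) 𝓞₇) = cyclic * signThree * cyclic⁻¹ * signTwo * signThree :=
    Units.ext (by decide +kernel)
  rw [this]
  exact mul_mem (mul_mem (mul_mem (mul_mem cyclic_mem signThree_mem) (inv_mem cyclic_mem))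
    signTwo_mem) signThree_mem

/-- Surjectivity of the reduction rests on these explicit words, one for each of the six elementary
matrices over 𝔽₂. -/
theorem exists_transvection (t : Matrix.TransvectionStruct (Fin 3) (ZMod 2)) :
    ∃ g ∈ G24, (redGL g).1 = t.toMatrix := by
  have of_words : ∀ l : List (GL (Fin 3) 𝓞₇), (∀ g ∈ l, g ∈ ({signTwo, signThree, shortSwap, cyclic} : Set _)) →
      l.prod ∈ G24 := fun l hl => Subgroup.list_prod_mem _ fun g hg => Subgroup.subset_closure (hl g hg)
  obtain ⟨i, j, hij, c⟩ := t
  change ∃ g ∈ G24, (redGL g).1 = Matrix.transvection i j c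
  have hc : c = 0 ∨ c = 1 := by revert c; decide
  rcases hc with rfl | rfl
  · exact ⟨1, one_mem _, by simp⟩
  fin_cases i <;> fin_cases j <;> (try exact absurd rfl hij) <;> clear hij
  · exact ⟨[shortSwap, signThree, shortSwap, cyclic, signTwo].prod, of_words _ (by simp),
      by decide +kernel⟩
  · exact ⟨[signThree, signTwo].prod, of_words _ (by simp), by decide +kernel⟩
  · exact ⟨[shortSwap, signThree, shortSwap, signThree].prod, of_words _ (by simp),
      by decide +kernel⟩
  · exact ⟨[signThree].prod, of_words _ (by simp), by decide +kernel⟩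
  · exact ⟨[signThree, shortSwap, signThree].prod, of_words _ (by simp), by decide +kernel⟩
  · exact ⟨[shortSwap, cyclic, shortSwap, cyclic].prod, of_words _ (by simp), by decide +kernel⟩

theorem exists_redGL_eq (M : GL (Fin 3) (ZMod 2)) : ∃ g ∈ G24, redGL g = M := by
  suffices h : ∃ g ∈ G24, (redGL g).1 = M.1 from
    h.imp fun g hg => ⟨hg.1, Units.ext hg.2⟩
  refine Matrix.diagonal_transvection_induction_of_det_ne_zero
    (fun M : Matrix (Fin 3) (Fin 3) (ZMod 2) => ∃ g ∈ G24, (redGL g).1 = M) M.1 ?_ ?_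
    exists_transvection ?_
  · exact ((Matrix.isUnit_iff_isUnit_det _).1 M.isUnit).ne_zero
  -- Over 𝔽₂ the only invertible diagonal matrix is the identity, so transvections suffice.
  · intro D hD
    refine ⟨1, one_mem _, ?_⟩
    have : D = 1 := by
      ext1 i
      rw [Matrix.det_diagonal, Finset.prod_ne_zero_iff] at hD
      exact (by decide : ∀ a : ZMod 2, a ≠ 0 → a = 1) _ (hD i (Finset.mem_univ i))
    rw [this, map_one, Units.val_one]
    exact Matrix.diagonal_one.symm
  · rintro A B - - ⟨g, hg, rfl⟩ ⟨h, hh, rfl⟩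
    exact ⟨g * h, mul_mem hg hh, by rw [map_mul, Units.val_mul]⟩

theorem det_mem_of_mem_G24 {g : GL (Fin 3) 𝓞₇} (hg : g ∈ G24) :
    Matrix.GeneralLinearGroup.det g ∈ Subgroup.zpowers (-1 : 𝓞₇ˣ) := by
  have h1 : (-1 : 𝓞₇ˣ) ∈ Subgroup.zpowers (-1 : 𝓞₇ˣ) := Subgroup.mem_zpowers _
  suffices G24 ≤ (Subgroup.zpowers (-1 : 𝓞₇ˣ)).comap Matrix.GeneralLinearGroup.det from this hg
  rw [G24, Subgroup.closure_le]
  intro x hx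
  simp only [Set.mem_insert_iff, Set.mem_singleton_iff] at hx
  rw [SetLike.mem_coe, Subgroup.mem_comap]
  rcases hx with rfl | rfl | rfl | rfl
  · rwa [show Matrix.GeneralLinearGroup.det signTwo = -1 from Units.ext (by decide +kernel)]
  · rwa [show Matrix.GeneralLinearGroup.det signThree = -1 from Units.ext (by decide +kernel)]
  · rwa [show Matrix.GeneralLinearGroup.det shortSwap = -1 from Units.ext (by decide +kernel)]
  · rw [show Matrix.GeneralLinearGroup.det cyclic = 1 from Units.ext (by decide +kernel)]
    exact one_mem _

/-- The rank is odd, so the determinant tells -1 from 1, which the reduction modulo 2 cannot do. -/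
theorem det_neg_one : Matrix.GeneralLinearGroup.det (-1 : GL (Fin 3) 𝓞₇) = -1 :=
  Units.ext (by decide +kernel)

/-- The isomorphism `G₂₄ ≅ {±1} × GL₃(2)`, given by the determinant and the reduction modulo 2. -/
noncomputable def G24Equiv : G24 ≃* Subgroup.zpowers (-1 : 𝓞₇ˣ) × GL (Fin 3) (ZMod 2) :=
  MulEquiv.ofBijective
    (((Matrix.GeneralLinearGroup.det.comp G24.subtype).codRestrict _
      fun g => det_mem_of_mem_G24 g.2).prod (redGL.comp G24.subtype)) (by
    have hne : (-1 : 𝓞₇ˣ) ≠ 1 := by decide +kernel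
    constructor
    · rw [injective_iff_map_eq_one]
      rintro ⟨g, hg⟩ h
      have h1 : Matrix.GeneralLinearGroup.det g = 1 := congrArg (fun x => (x.1 : 𝓞₇ˣ)) h
      have h2 : redGL g = 1 := congrArg Prod.snd h
      rcases eq_one_or_neg_one_of_redGL hg h2 with rfl | rfl
      · rfl
      · exact absurd (det_neg_one.symm.trans h1) hne
    · rintro ⟨⟨d, hd⟩, M⟩
      obtain ⟨g, hg, rfl⟩ := exists_redGL_eq M
      have pm : ∀ x ∈ Subgroup.zpowers (-1 : 𝓞₇ˣ), x = 1 ∨ x = -1 := by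
        rintro _ ⟨n, rfl⟩
        rcases Int.even_or_odd n with h | h
        · exact .inl h.neg_one_zpow
        · exact .inr h.neg_one_zpow
      have hr : redGL (-1) = 1 := Units.ext (by decide +kernel)
      by_cases hgd : Matrix.GeneralLinearGroup.det g = d
      · exact ⟨⟨g, hg⟩, Prod.ext (Subtype.ext hgd) rfl⟩
      -- Both g and -g have the same reduction, and their determinants are opposite.
      · refine ⟨⟨-1 * g, mul_mem neg_one_mem_G24 hg⟩, Prod.ext (Subtype.ext ?_) ?_⟩
        · change Matrix.GeneralLinearGroup.det (-1 * g) = d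
          rw [map_mul, det_neg_one]
          rcases pm _ (det_mem_of_mem_G24 hg) with h | h <;> rcases pm _ hd with h' | h' <;>
            rw [h, h'] at hgd ⊢ <;> simp at hgd ⊢
        · change redGL (-1 * g) = redGL g
          rw [map_mul, hr, one_mul])

theorem nonempty_G24_mulEquiv :
    Nonempty (G24 ≃* Multiplicative (ZMod 2) × GL (Fin 3) (ZMod 2)) := by
  have hc : Nat.card (Subgroup.zpowers (-1 : 𝓞₇ˣ)) = 2 := by
    rw [Nat.card_zpowers]
    exact orderOf_eq_prime (by simp) (by decide +kernel)
  have e := zmodCyclicMulEquiv (inferInstance : IsCyclic (Subgroup.zpowers (-1 : 𝓞₇ˣ)))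
  rw [hc] at e
  exact ⟨G24Equiv.trans (e.symm.prodCongr (MulEquiv.refl _))⟩

end SolSpin

/-! ### The root of X² + X + 2 in ℤ₂ and the action of G₂₄ on cubes of ℤ₂-modules -/

open CliffordAlgebra
noncomputable section
namespace SolSpin

/-- Hensel's lemma applies at 1, where the value is 4 and the derivative 3. It gives a root 1 + 2c,
and the equation itself then reads 2c = -4(c² + c + 1), which improves the congruence from modulo 2
to modulo 4. -/
theorem exists_padic_root : ∃ v : ℤ_[2]ˣ, (v : ℤ_[2]) ^ 2 + v + 2 = 0 ∧ (4 : ℤ_[2]) ∣ v - 1 := by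
  have h2 : ∀ {x : ℤ_[2]}, ‖x‖ < 1 → (2 : ℤ_[2]) ∣ x := fun h => by
    simpa using (PadicInt.norm_lt_one_iff_dvd _).1 h
  have n2 : ‖(2 : ℤ_[2])‖ < 1 := (PadicInt.norm_lt_one_iff_dvd _).2 (by simp)
  obtain ⟨z, hz, hz1, -⟩ := hensels_lemma (p := 2) (R := ℤ_[2])
    (F := Polynomial.X ^ 2 + Polynomial.X + 2) (a := 1) (by
    have h3 : ‖(2 + 1 : ℤ_[2])‖ = 1 := by
      rw [← PadicInt.isUnit_iff]
      by_contra h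
      have := h2 (PadicInt.not_isUnit_iff.1 h)
      have := (dvd_add_right (dvd_refl (2 : ℤ_[2]))).1 this
      exact (PadicInt.norm_lt_one_iff_dvd _).2 (by exact_mod_cast this) |>.ne (by simp)
    simp only [map_add, map_pow, Polynomial.aeval_X, Polynomial.derivative_add,
      Polynomial.derivative_X_pow, Polynomial.derivative_X, map_ofNat, Polynomial.derivative_ofNat,
      map_mul, map_one, map_zero, Polynomial.map_natCast]
    norm_num
    rw [show (4 : ℤ_[2]) = 2 * 2 by norm_num, norm_mul]
    rw [show (2 + 1 : ℤ_[2]) = 3 by norm_num] at h3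
    rw [h3]
    nlinarith [norm_nonneg (2 : ℤ_[2])])
  simp only [map_add, map_pow, Polynomial.aeval_X, map_ofNat] at hz
  have hd : ‖z - 1‖ < 1 := hz1.trans_le (PadicInt.norm_le_one _)
  obtain ⟨c, hc⟩ := h2 hd
  have hu : IsUnit z := by
    by_contra h
    obtain ⟨d, hd⟩ := h2 (PadicInt.not_isUnit_iff.1 h)
    exact (PadicInt.norm_lt_one_iff_dvd _).2 (⟨d - c, by push_cast; linear_combination hd - hc⟩ :
      ((2 : ℕ) : ℤ_[2]) ∣ 1) |>.ne (by simp)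
  refine ⟨hu.unit, hz, ?_⟩
  exact ⟨-(c ^ 2 + c + 1), by
    simp only [IsUnit.unit_spec]
    have : z = 1 + 2 * c := by linear_combination hc
    subst this
    linear_combination hz⟩

section Lattice
variable {M : Type*} [AddCommGroup M] [Module ℤ_[2] M] (v : ℤ_[2]ˣ) (hv : (v : ℤ_[2]) ^ 2 + v + 2 = 0)

/-- The embedding `ℤ[ω] → ℤ₂` given by a root `v` of `X² + X + 2`. -/
def intEmb : IntSqrtNegSeven →+* ℤ_[2] :=
  (QuadraticAlgebra.lift ⟨(v : ℤ_[2]), by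
    simp only [zsmul_eq_mul, mul_one]; push_cast; linear_combination hv⟩).toRingHom

theorem intEmb_apply (x : IntSqrtNegSeven) : intEmb v hv x = x.re + x.im * v := by
  simp [intEmb]

/-- The action of a matrix over `ℤ[ω]` on the cube of a `ℤ₂`-module. -/
def cubeAct (g : GL (Fin 3) IntSqrtNegSeven) (y : Fin 3 → M) : Fin 3 → M :=
  fun i => ∑ j, intEmb v hv (g.1 i j) • y j

open Matrix.Module in
/-- The action of `GL₃(ℤ[ω])` on the cube of a `ℤ₂`-module, written multiplicatively. -/
def cubeAut (M : Type*) [AddCommGroup M] [Module ℤ_[2] M] :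
    GL (Fin 3) IntSqrtNegSeven →* MulAut (Multiplicative (Fin 3 → M)) :=
  (MulAutMultiplicative (G := Fin 3 → M)).symm.toMonoidHom.comp
    ((DistribMulAction.toAddAut (GL (Fin 3) ℤ_[2]) (Fin 3 → M)).comp
      (Matrix.GeneralLinearGroup.map (intEmb v hv)))

theorem cubeAut_apply (g : GL (Fin 3) IntSqrtNegSeven) (y : Multiplicative (Fin 3 → M)) :
    cubeAut v hv M g y = Multiplicative.ofAdd (cubeAct v hv g y.toAdd) := rfl

/-- The coordinates of `(x₁, x₂, x₃)` in the root lattice of `G₂₄`. -/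
def rootCoord (x : M × M × M) : Fin 3 → M :=
  ![x.1 - x.2.1 + (2 * v + 2 : ℤ_[2]) • x.2.2, (v : ℤ_[2]) • x.2.1 - (v ^ 2 : ℤ_[2]) • x.2.2,
    (2 * v : ℤ_[2]) • x.2.2]

theorem rootCoord_add (x y : M × M × M) :
    rootCoord v (x + y) = rootCoord v x + rootCoord v y := by
  ext i; fin_cases i <;> simp [rootCoord] <;> module

/-- This and the next three identities are what determine the entries of the generators of G₂₄: each
matrix is a simple map of (x₁, x₂, x₃) rewritten in the coordinates `rootCoord`, with v a root of X²
+ X + 2. -/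
theorem cubeAct_signTwo (x₁ x₂ x₃ : M) : cubeAct v hv signTwo (rootCoord v (x₁, x₂, x₃)) =
    rootCoord v (x₁, -x₂, x₃) := by
  ext i
  rw [cubeAct, Fin.sum_univ_three]
  fin_cases i <;> simp [rootCoord, intEmb_apply, signTwo] <;> match_scalars <;> grind

theorem cubeAct_signThree (x₁ x₂ x₃ : M) : cubeAct v hv signThree (rootCoord v (x₁, x₂, x₃)) =
    rootCoord v (x₁, x₂, -x₃) := by
  ext i
  rw [cubeAct, Fin.sum_univ_three]
  fin_cases i <;> simp [rootCoord, intEmb_apply, signThree] <;> match_scalars <;> grind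

/-- The torus has the nonzero weights ±(x₁ + x₂), ±(x₁ - x₂), ±2x₃ on V, and this map exchanges x₁ +
x₂ with 2x₃. Solving for the new coordinates requires halves, so the argument is written as a
double; divisibility makes this no restriction on C. -/
theorem cubeAct_shortSwap (y₁ y₂ y₃ : M) :
    cubeAct v hv shortSwap (rootCoord v (y₁ + y₁, y₂ + y₂, y₃ + y₃)) =
      rootCoord v (y₁ - y₂ + (y₃ + y₃), y₂ - y₁ + (y₃ + y₃), y₁ + y₂) := by
  ext i
  rw [cubeAct, Fin.sum_univ_three]
  fin_cases i <;> simp [rootCoord, intEmb_apply, shortSwap] <;> match_scalars <;> grind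

/-- This is the rotation of coordinates conjugated by the scaling of the third one by v⁻¹. Writing
the second entry as a multiple of v avoids inverses. -/
theorem cubeAct_cyclic (x₁ y x₃ : M) :
    cubeAct v hv cyclic (rootCoord v (x₁, (v : ℤ_[2]) • y, x₃)) =
      rootCoord v ((v : ℤ_[2]) • x₃, x₁, y) := by
  ext i
  rw [cubeAct, Fin.sum_univ_three]
  fin_cases i <;> simp [rootCoord, intEmb_apply, cyclic] <;> match_scalars <;> grind

theorem cubeAct_neg_one (y : Fin 3 → M) : cubeAct v hv (-1) y = -y := by
  ext i
  rw [cubeAct, Fin.sum_univ_three]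
  fin_cases i <;> simp [Units.val_neg]

-- The equation reads v(v + 1) = -2 with v a unit, so v + 1 = -2v⁻¹ is even.
include hv in
theorem two_dvd_sub_one : (2 : ℤ_[2]) ∣ v - 1 := by
  have h : (v : ℤ_[2]) * (v + 1) = 2 * (-1) := by linear_combination hv
  have h' : (v : ℤ_[2]) + 1 = 2 * -(v⁻¹ : ℤ_[2]ˣ) := by
    rw [← Units.mul_right_inj v, h]
    linear_combination 2 * v.mul_inv
  exact ⟨-(v⁻¹ : ℤ_[2]ˣ) - 1, by linear_combination h'⟩

/-- Since v is odd it fixes every n with 2n = 0, so ℤ[ω] acts on such elements through ω ↦ 1. -/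
theorem intEmb_smul_of_torsion (x : IntSqrtNegSeven) {n : M} (hn : n + n = 0) :
    intEmb v hv x • n = (redTwo x).val • n := by
  have h2 : (2 : ℤ_[2]) • n = 0 := by rw [two_smul, hn]
  obtain ⟨c, hc⟩ := two_dvd_sub_one v hv
  obtain ⟨d, hd⟩ : (2 : ℤ) ∣ x.re + x.im - (redTwo x).val := by
    rw [← Int.cast_natCast (R := ℤ), Int.cast_id]
    have := (ZMod.intCast_zmod_eq_zero_iff_dvd (x.re + x.im - (redTwo x).val) 2).1 (by
      push_cast; rw [ZMod.natCast_zmod_val, redTwo_apply]; simp)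
    simpa using this
  have hd' : ((x.re : ℤ_[2]) + x.im - (redTwo x).val) = 2 * d := by exact_mod_cast congrArg (Int.cast (R := ℤ_[2])) hd
  have : intEmb v hv x = (x.im * c + d) * 2 + (redTwo x).val := by
    rw [intEmb_apply]; linear_combination x.im * hc + hd'
  rw [this, add_smul, mul_smul, h2, smul_zero, zero_add, Nat.cast_smul_eq_nsmul]

/-- Vectors with the single nonzero entry n are 2-torsion, and their images display the reduced
matrix entry by entry. -/
theorem redGL_eq_one_of_cubeAct {n : M} (hn : n + n = 0) (hn0 : n ≠ 0)
    {g : GL (Fin 3) IntSqrtNegSeven}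
    (h : ∀ y : Fin 3 → M, y + y = 0 → cubeAct v hv g y = y) : redGL g = 1 := by
  ext i j
  have hy := congrFun (h (Pi.single j n) (by rw [← Pi.single_add, hn, Pi.single_zero])) i
  rw [cubeAct, Finset.sum_eq_single j, Pi.single_eq_same, intEmb_smul_of_torsion v hv _ hn] at hy
  · rw [redGL_apply, Units.val_one]
    have h01 : ∀ a : ZMod 2, a = 0 ∨ a = 1 := by decide
    by_cases hij : i = j
    · subst hij
      rw [Pi.single_eq_same] at hy
      rw [Matrix.one_apply_eq]
      rcases h01 (redTwo (g.1 i i)) with h | h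
      · rw [h] at hy; exact absurd hy.symm (by simpa using hn0)
      · exact h
    · rw [Pi.single_eq_of_ne hij] at hy
      rw [Matrix.one_apply_ne hij]
      rcases h01 (redTwo (g.1 i j)) with h | h
      · exact h
      · rw [h] at hy; exact absurd hy (by simpa [ZMod.val_one] using hn0)
  · intro k _ hk
    rw [Pi.single_eq_of_ne hk, smul_zero]
  · simp

-- The coordinate matrix is triangular with diagonal 1, v, 2v. The last entry leaves 2x₃ = 0; on
-- such elements v acts trivially and 2v + 2 acts as 0, so the other two rows force x₂ = x₃ and x₁ =
-- x₃.
include hv in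
theorem rootCoord_eq_zero_iff {n : M} (hn : ∀ x : M, x + x = 0 ↔ x = 0 ∨ x = n) (x : M × M × M) :
    rootCoord v x = 0 ↔ x = 0 ∨ x = (n, n, n) := by
  obtain ⟨x₁, x₂, x₃⟩ := x
  obtain ⟨c, hc⟩ := two_dvd_sub_one v hv
  have hv1 : ∀ {x : M}, x + x = 0 → (v : ℤ_[2]) • x = x := fun {x} h => by
    rw [show (v : ℤ_[2]) = 1 + c * 2 by linear_combination hc, add_smul, mul_smul, two_smul, h,
      smul_zero, add_zero, one_smul]
  constructor
  · intro h
    have h0 : x₁ - x₂ + (2 * v + 2 : ℤ_[2]) • x₃ = 0 := congrFun h 0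
    have h1 : (v : ℤ_[2]) • x₂ - (v ^ 2 : ℤ_[2]) • x₃ = 0 := congrFun h 1
    have h2 : (2 * v : ℤ_[2]) • x₃ = 0 := congrFun h 2
    have h3 : x₃ + x₃ = 0 := by
      rw [mul_comm, mul_smul, two_smul] at h2
      rwa [← Units.smul_def, smul_eq_zero_iff_eq] at h2
    have h4 : x₂ = x₃ := by
      rw [pow_two, mul_smul, hv1 h3, hv1 h3] at h1
      have := sub_eq_zero.1 h1
      rw [← hv1 h3] at this
      exact smul_left_cancel v this
    have h5 : x₁ = x₃ := by
      have : (2 * v + 2 : ℤ_[2]) • x₃ = 0 := by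
        rw [show (2 * v + 2 : ℤ_[2]) = (v + 1) * 2 by ring, mul_smul, two_smul, h3, smul_zero]
      rw [this, add_zero, h4] at h0
      exact sub_eq_zero.1 h0
    subst h4 h5
    rcases (hn _).1 h3 with rfl | rfl
    · exact .inl rfl
    · exact .inr rfl
  · rintro (h | h)
    · rw [h]; ext i; fin_cases i <;> simp [rootCoord]
    · have h3 : n + n = 0 := (hn n).2 (.inr rfl)
      rw [h]
      ext i
      fin_cases i
      · simp [rootCoord]
        rw [show (2 * v + 2 : ℤ_[2]) = (v + 1) * 2 by ring, mul_smul, two_smul, h3, smul_zero]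
      · simp [rootCoord, pow_two, mul_smul, hv1 h3]
      · simp [rootCoord, mul_smul, hv1 h3, two_smul, h3]

/-- Back substitution: the diagonal entries 1 and v are units, and only 2v calls for a division by
2. -/
theorem rootCoord_surjective (hd : ∀ x : M, ∃ y, y + y = x) :
    Function.Surjective (rootCoord v : M × M × M → Fin 3 → M) := fun m => by
  obtain ⟨y, hy⟩ := hd (m 2)
  have hvv : ∀ x : M, (v : ℤ_[2]) • v⁻¹ • x = x := fun x => by
    rw [← Units.smul_def, smul_inv_smul]
  refine ⟨(m 0 + v⁻¹ • (m 1 + (v ^ 2 : ℤ_[2]) • v⁻¹ • y) - (2 * v + 2 : ℤ_[2]) • v⁻¹ • y,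
    v⁻¹ • (m 1 + (v ^ 2 : ℤ_[2]) • v⁻¹ • y), v⁻¹ • y), ?_⟩
  ext i
  fin_cases i
  · simp [rootCoord]; abel
  · simp [rootCoord, hvv]
  · simp only [rootCoord, mul_smul, hvv, two_smul, ← hy]
    simp [hvv, hy]
end Lattice

/-! ### Abelian 2-groups as ℤ₂-modules -/

section PadicModule
variable {G : Type*} [CommGroup G]

theorem padicPow_add {X : G} {n : ℕ} (h : X ^ 2 ^ n = 1) (u v : ℤ_[2]) :
    padicPow X (u + v) = padicPow X u * padicPow X v := by
  rw [padicPow_eq h, padicPow_eq h, padicPow_eq h, ← pow_add, map_add, ZMod.val_add,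
    pow_eq_pow_iff_modEq]
  exact (Nat.mod_modEq _ _).of_dvd (orderOf_dvd_of_pow_eq_one h)

theorem padicPow_zero (X : G) : padicPow X 0 = 1 := by
  rw [padicPow, map_zero, ZMod.val_zero, pow_zero]

theorem one_padicPow (u : ℤ_[2]) : padicPow (1 : G) u = 1 := by
  rw [padicPow, one_pow]

/-- The `ℤ₂`-module structure of an abelian group all of whose elements have 2-power order. -/
abbrev padicModule (hG : ∀ X : G, ∃ n : ℕ, X ^ 2 ^ n = 1) : Module ℤ_[2] (Additive G) where
  smul u X := Additive.ofMul (padicPow X.toMul u)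
  one_smul X := by
    obtain ⟨n, h⟩ := hG X.toMul
    exact congrArg Additive.ofMul (padicPow_one h)
  mul_smul u w X := by
    obtain ⟨n, h⟩ := hG X.toMul
    exact congrArg Additive.ofMul ((mul_comm u w ▸ padicPow_padicPow h w u).symm)
  smul_zero u := congrArg Additive.ofMul (one_padicPow u)
  smul_add u X Y := by
    obtain ⟨m, h⟩ := hG X.toMul
    obtain ⟨n, h'⟩ := hG Y.toMul
    exact congrArg Additive.ofMul (padicPow_mul h h' u)
  add_smul u w X := by
    obtain ⟨n, h⟩ := hG X.toMul
    exact congrArg Additive.ofMul (padicPow_add h u w)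
  zero_smul X := congrArg Additive.ofMul (padicPow_zero X.toMul)
end PadicModule
end SolSpin
end

/-! ### The group C(q^∞), the coordinates on A(q^∞), and γ_u as an element of G₂₄ -/

open CliffordAlgebra
noncomputable section
namespace SolSpin
variable {F : Type*} [Field F]

theorem SL2_coe_add_coe_inv (X : SL2 F) :
    (X : Mat2 F) + ((X⁻¹ : SL2 F) : Mat2 F) = (X : Mat2 F).trace • (1 : Mat2 F) := by
  rw [Matrix.SpecialLinearGroup.coe_inv, Matrix.adjugate_fin_two, Matrix.trace_fin_two]
  ext i j
  fin_cases i <;> fin_cases j <;> simp [add_comm]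

section CharNeTwo
variable [NeZero (2 : F)]

theorem SL2_eq_one_or_neg_one {X : SL2 F} (h : X * X = 1) : X = 1 ∨ X = -1 := by
  have h2 : (2 : F) ≠ 0 := NeZero.ne _
  have e := SL2_coe_add_coe_inv X
  rw [← eq_inv_of_mul_eq_one_left h, ← two_smul F] at e
  have hX : (X : Mat2 F) = ((2 : F)⁻¹ * (X : Mat2 F).trace) • (1 : Mat2 F) := by
    rw [mul_smul, ← e, smul_smul, inv_mul_cancel₀ h2, one_smul]
  set c := (2 : F)⁻¹ * (X : Mat2 F).trace
  have d := X.2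
  rw [hX, Matrix.det_smul, Fintype.card_fin, Matrix.det_one, mul_one, pow_two, mul_self_eq_one_iff] at d
  rcases d with d | d
  · left; exact Subtype.ext (by rw [hX, d, one_smul]; rfl)
  · right; exact Subtype.ext (by rw [hX, d, neg_one_smul]; rfl)

theorem sq_eq_neg_one_of_orderOf {A : SL2 F} (hA : orderOf A = 4) : A * A = -1 := by
  have h4 : (A * A) * (A * A) = 1 := by
    have := pow_orderOf_eq_one A
    rw [hA] at this
    simpa only [pow_succ, pow_zero, one_mul, mul_assoc] using this
  refine (SL2_eq_one_or_neg_one h4).resolve_left fun h => ?_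
  have := orderOf_dvd_of_pow_eq_one (x := A) (n := 2) (by rw [pow_two, h])
  rw [hA] at this
  omega

theorem SL2_neg_one_ne_one : (-1 : SL2 F) ≠ 1 := fun h => by
  have h := congrFun (congrFun (congrArg Subtype.val h) 0) 0
  have h : (-1 : F) = 1 := by simpa using h
  exact NeZero.ne (2 : F) (by linear_combination -h)
end CharNeTwo

theorem SL2_inv_of_sq {A : SL2 F} (h : A * A = -1) : A⁻¹ = -A :=
  inv_eq_of_mul_eq_one_right (by rw [mul_neg, h, neg_neg])

theorem trace_of_sq {A : SL2 F} (h : A * A = -1) : (A : Mat2 F) 1 1 = -(A : Mat2 F) 0 0 := by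
  have := SL2_coe_add_coe_inv A
  rw [SL2_inv_of_sq h] at this
  have := congrFun (congrFun this 0) 0
  simp [Matrix.trace_fin_two] at this
  linear_combination -this

theorem ne_smul_one_of_orderOf {A : SL2 F} (hA : orderOf A = 4) (c : F) :
    (A : Mat2 F) ≠ c • 1 := fun hc => by
  have d := A.2
  rw [hc, Matrix.det_smul] at d
  have : A ^ 2 = 1 := Subtype.ext (by
    rw [Matrix.SpecialLinearGroup.coe_pow, hc, smul_pow, one_pow]
    rw [Fintype.card_fin, Matrix.det_one, mul_one] at d
    simp [d])
  have := orderOf_dvd_of_pow_eq_one this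
  rw [hA] at this
  omega

theorem exists_eq_smul_add_smul [NeZero (2 : F)] {A X : SL2 F} (hA : orderOf A = 4)
    (h : X * A = A * X) :
    ∃ a b : F, (X : Mat2 F) = a • (1 : Mat2 F) + b • (A : Mat2 F) ∧ a ^ 2 + b ^ 2 = 1 := by
  obtain ⟨a, b, hX⟩ := eq_smul_of_commute (ne_smul_one_of_orderOf hA) (X := (X : Mat2 F))
    (congrArg Subtype.val h)
  refine ⟨a, b, hX, ?_⟩
  have t := trace_of_sq (sq_eq_neg_one_of_orderOf hA)
  have d := X.2
  have d' := A.2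
  rw [hX, Matrix.det_fin_two] at d
  rw [Matrix.det_fin_two] at d'
  simp [t] at d d'
  linear_combination d - b ^ 2 * d'

/-- By Cayley–Hamilton (X + 1)² = (tr X + 2)X, so dividing X + 1 by a square root of tr X + 2 gives
a root of X. Its form as a multiple of X + 1 ensures that it commutes with whatever commutes with X.
-/
theorem exists_sqrt_SL2 [NeZero (2 : F)] [IsAlgClosed F] {X : SL2 F}
    (h : (X : Mat2 F).trace ≠ -2) : ∃ Y : SL2 F, Y * Y = X ∧ ∃ s : F, (Y : Mat2 F) = s • ((X : Mat2 F) + 1) := by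
  obtain ⟨s, hs⟩ := IsAlgClosed.exists_pow_nat_eq ((X : Mat2 F).trace + 2) (n := 2) (by norm_num)
  have hs0 : s ≠ 0 := by
    rintro rfl
    exact h (by linear_combination -hs)
  have d := X.2
  rw [Matrix.det_fin_two] at d
  rw [Matrix.trace_fin_two] at hs
  have hs' : s⁻¹ ^ 2 * (s ^ 2) = 1 := by field_simp
  refine ⟨⟨s⁻¹ • ((X : Mat2 F) + 1), ?_⟩, ?_, s⁻¹, rfl⟩
  · rw [Matrix.det_smul, Matrix.det_fin_two, Fintype.card_fin]
    simp
    rw [← inv_pow]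
    linear_combination (s⁻¹ ^ 2) * d - s⁻¹ ^ 2 * hs + hs'
  · have e : (X : Mat2 F) * X = (X : Mat2 F).trace • (X : Mat2 F) - 1 := by
      have := congrArg (fun M => (X : Mat2 F) * M) (SL2_coe_add_coe_inv X)
      simp only [mul_add, ← Matrix.SpecialLinearGroup.coe_mul, mul_inv_cancel, mul_smul_comm, mul_one] at this
      rw [← this]
      simp
    apply Subtype.ext
    change (s⁻¹ • ((X : Mat2 F) + 1)) * (s⁻¹ • ((X : Mat2 F) + 1)) = (X : Mat2 F)
    rw [smul_mul_smul_comm, ← pow_two, add_mul, mul_add, e, mul_one, one_mul]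
    rw [show (X : Mat2 F).trace • (X : Mat2 F) - 1 + (X : Mat2 F) + ((X : Mat2 F) + 1) = ((X : Mat2 F).trace + 2) • (X : Mat2 F) by
      rw [add_smul, two_smul]; abel, Matrix.trace_fin_two, ← hs, smul_smul, hs', one_smul]

section Torus
variable [NeZero (2 : F)] (A : SL2 F) (hA : orderOf A = 4)

/-- The element `A` of `C(q^∞)`. -/
def genC : Cinf A hA := ⟨A, rfl, 2, by have := pow_orderOf_eq_one A; rwa [hA] at this⟩

theorem genC_mul_self : genC A hA * genC A hA = negC A hA :=
  Subtype.ext (sq_eq_neg_one_of_orderOf hA)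

theorem negC_mul_self : negC A hA * negC A hA = 1 := Subtype.ext (by simp [negC])

theorem negC_ne_one : negC A hA ≠ 1 := fun h => SL2_neg_one_ne_one (congrArg Subtype.val h)

theorem Cinf_mul_self_eq_one_iff (X : Cinf A hA) : X * X = 1 ↔ X = 1 ∨ X = negC A hA := by
  constructor
  · intro h
    exact (SL2_eq_one_or_neg_one (congrArg Subtype.val h)).imp (fun h => Subtype.ext h)
      fun h => Subtype.ext h
  · rintro (rfl | rfl)
    · exact mul_one _
    · exact negC_mul_self A hA

theorem Cinf_mul_self_eq_negC {X : Cinf A hA} (h : X * X = negC A hA) :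
    X = genC A hA ∨ X = (genC A hA)⁻¹ := by
  have h1 : (X * (genC A hA)⁻¹) * (X * (genC A hA)⁻¹) = 1 := by
    rw [mul_mul_mul_comm, h, ← mul_inv, genC_mul_self, mul_inv_cancel]
  rcases (Cinf_mul_self_eq_one_iff A hA _).1 h1 with h2 | h2
  · left; exact mul_inv_eq_one.1 h2
  · right
    rw [mul_inv_eq_iff_eq_mul] at h2
    rw [h2, ← genC_mul_self, mul_assoc]
    rw [eq_inv_iff_mul_eq_one, mul_assoc, mul_assoc, ← mul_assoc, genC_mul_self, negC_mul_self]

theorem Cinf_exists_mul_self_eq [IsAlgClosed F] (X : Cinf A hA) : ∃ Y : Cinf A hA, Y * Y = X := by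
  by_cases ht : ((X : SL2 F) : Mat2 F).trace = -2
  -- Here X = a + bA with 2a = -2 and a² + b² = 1, which forces X = -1 = A².
  · refine ⟨genC A hA, ?_⟩
    obtain ⟨a, b, hX, hab⟩ := exists_eq_smul_add_smul hA X.2.1
    have t := trace_of_sq (sq_eq_neg_one_of_orderOf hA)
    rw [hX, Matrix.trace_fin_two] at ht
    simp [t] at ht
    have h2 : (2 : F) ≠ 0 := NeZero.ne _
    have ha : a = -1 := mul_left_cancel₀ h2 (by linear_combination ht)
    have hb : b = 0 := by
      rw [ha] at hab
      exact pow_eq_zero_iff (two_ne_zero) |>.1 (by linear_combination hab)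
    rw [genC_mul_self]
    refine Subtype.ext (Subtype.ext ?_)
    rw [hX, ha, hb]
    simp [negC]
  · obtain ⟨Y, hY, s, hs⟩ := exists_sqrt_SL2 ht
    refine ⟨⟨Y, ?_, ?_⟩, Subtype.ext hY⟩
    · apply Subtype.ext
      have := congrArg Subtype.val X.2.1
      simp only [Matrix.SpecialLinearGroup.coe_mul] at this ⊢
      rw [hs, smul_mul_assoc, mul_smul_comm, add_mul, mul_add, this, one_mul, mul_one]
    · obtain ⟨k, hk⟩ := X.2.2
      exact ⟨k + 1, by rw [pow_succ', pow_mul, pow_two, hY, hk]⟩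

instance : Module ℤ_[2] (Additive (Cinf A hA)) := padicModule (Cinf_pow A hA)

/-- The element `[X₁, X₂, X₃]` of `A(q^∞)`, in additive notation. -/
def torusMk : Additive (Cinf A hA) × Additive (Cinf A hA) × Additive (Cinf A hA) → Ainf A hA :=
  fun x => (omegaC A hA).rangeRestrict (x.1.toMul, x.2.1.toMul, x.2.2.toMul)

theorem torusMk_surjective : Function.Surjective (torusMk A hA) := fun t => by
  obtain ⟨x, hx⟩ := (omegaC A hA).rangeRestrict_surjective t
  exact ⟨(Additive.ofMul x.1, Additive.ofMul x.2.1, Additive.ofMul x.2.2), hx⟩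

variable (v : ℤ_[2]ˣ) (hv : (v : ℤ_[2]) ^ 2 + v + 2 = 0)

/-- The coordinates of an element of `C(q^∞)³` in the root lattice of `G₂₄`. -/
def rootCoordHom : Cinf A hA × Cinf A hA × Cinf A hA →*
    Multiplicative (Fin 3 → Additive (Cinf A hA)) where
  toFun X := Multiplicative.ofAdd
    (rootCoord v (Additive.ofMul X.1, Additive.ofMul X.2.1, Additive.ofMul X.2.2))
  map_one' := by
    refine congrArg Multiplicative.ofAdd (a₂ := 0) ?_
    ext1 i; fin_cases i <;> simp [rootCoord]
  map_mul' X Y := congrArg Multiplicative.ofAdd (rootCoord_add v (M := Additive (Cinf A hA))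
    (Additive.ofMul X.1, Additive.ofMul X.2.1, Additive.ofMul X.2.2)
    (Additive.ofMul Y.1, Additive.ofMul Y.2.1, Additive.ofMul Y.2.2))

-- Equality of the two kernels is what lets the coordinates descend from C³ to A(q^∞).
include hv in
theorem ker_rootCoordHom : (rootCoordHom A hA v).ker = (omegaC A hA).ker := by
  ext X
  rw [MonoidHom.mem_ker, MonoidHom.mem_ker, omegaC_eq_one_iff]
  exact rootCoord_eq_zero_iff v hv (M := Additive (Cinf A hA)) (n := Additive.ofMul (negC A hA))
    (Cinf_mul_self_eq_one_iff A hA) (Additive.ofMul X.1, Additive.ofMul X.2.1, Additive.ofMul X.2.2)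

variable [IsAlgClosed F]

/-- The isomorphism of `A(q^∞)` with `C(q^∞)³` given by the coordinates in the root lattice. -/
def torusEquiv : Ainf A hA ≃* Multiplicative (Fin 3 → Additive (Cinf A hA)) :=
  (QuotientGroup.quotientKerEquivRange (omegaC A hA)).symm.trans
    ((QuotientGroup.quotientMulEquivOfEq (ker_rootCoordHom A hA v hv).symm).trans
      (QuotientGroup.quotientKerEquivOfSurjective (rootCoordHom A hA v) fun m => by
        obtain ⟨x, hx⟩ := rootCoord_surjective v (Cinf_exists_mul_self_eq A hA) m.toAdd
        exact ⟨(x.1.toMul, x.2.1.toMul, x.2.2.toMul), congrArg Multiplicative.ofAdd hx⟩))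

theorem torusEquiv_torusMk (x) :
    torusEquiv A hA v hv (torusMk A hA x) = Multiplicative.ofAdd (rootCoord v x) := by
  have : (QuotientGroup.quotientKerEquivRange (omegaC A hA)).symm (torusMk A hA x) =
      ((x.1.toMul, x.2.1.toMul, x.2.2.toMul) : _ ⧸ (omegaC A hA).ker) := by
    rw [MulEquiv.symm_apply_eq]; rfl
  rw [torusEquiv, MulEquiv.trans_apply, this]
  rfl

/-- The action of `GL₃(ℤ[ω])` on `A(q^∞)`. -/
def torusAct : GL (Fin 3) IntSqrtNegSeven →* MulAut (Ainf A hA) :=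
  (MulAut.congr (torusEquiv A hA v hv).symm).toMonoidHom.comp (cubeAut v hv _)

theorem torusEquiv_torusAct (g : GL (Fin 3) IntSqrtNegSeven) (t : Ainf A hA) :
    torusEquiv A hA v hv (torusAct A hA v hv g t) =
      cubeAut v hv _ g (torusEquiv A hA v hv t) :=
  (torusEquiv A hA v hv).apply_symm_apply _

theorem torusAct_torusMk {g : GL (Fin 3) IntSqrtNegSeven} {x y}
    (h : cubeAct v hv g (rootCoord v x) = rootCoord v y) :
    torusAct A hA v hv g (torusMk A hA x) = torusMk A hA y := by
  apply (torusEquiv A hA v hv).injective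
  rw [torusEquiv_torusAct, torusEquiv_torusMk, torusEquiv_torusMk, cubeAut_apply, toAdd_ofAdd, h]

theorem torusAct_neg_one (t : Ainf A hA) : torusAct A hA v hv (-1) t = t⁻¹ := by
  apply (torusEquiv A hA v hv).injective
  rw [torusEquiv_torusAct, cubeAut_apply, cubeAct_neg_one, map_inv]
  rfl

theorem redGL_eq_one_of_torusAct {g : GL (Fin 3) IntSqrtNegSeven}
    (h : ∀ t : Ainf A hA, t * t = 1 → torusAct A hA v hv g t = t) : redGL g = 1 := by
  refine redGL_eq_one_of_cubeAct v hv (M := Additive (Cinf A hA))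
    (n := Additive.ofMul (negC A hA)) (negC_mul_self A hA) (negC_ne_one A hA) fun y hy => ?_
  have := h ((torusEquiv A hA v hv).symm (Multiplicative.ofAdd y)) (by
    rw [← map_mul, ← ofAdd_add, hy, ofAdd_zero, map_one])
  have := congrArg (torusEquiv A hA v hv) this
  rw [torusEquiv_torusAct, MulEquiv.apply_symm_apply] at this
  exact congrArg Multiplicative.toAdd this

theorem delta_torusMk (u : ℤ_[2]ˣ) (x₁ x₂ x₃ : Additive (Cinf A hA)) :
    delta A hA u (torusMk A hA (x₁, x₂, x₃)) = torusMk A hA (x₁, x₂, (u : ℤ_[2]) • x₃) := by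
  unfold delta torusMk
  exact descend_apply A hA _ _ (x₁.toMul, x₂.toMul, x₃.toMul)

theorem gamma_torusMk (x₁ x₂ x₃ : Additive (Cinf A hA)) :
    gamma A hA (torusMk A hA (x₁, x₂, x₃)) = torusMk A hA (x₃, x₁, x₂) :=
  Subtype.ext (gamma_apply A hA x₁.toMul x₂.toMul x₃.toMul)

theorem torusAct_cyclic_torusMk (x₁ x₂ x₃ : Additive (Cinf A hA)) :
    torusAct A hA v hv cyclic (torusMk A hA (x₁, x₂, ((v⁻¹ : ℤ_[2]ˣ) : ℤ_[2]) • x₃)) =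
      torusMk A hA (x₃, x₁, ((v⁻¹ : ℤ_[2]ˣ) : ℤ_[2]) • x₂) := by
  apply torusAct_torusMk
  have h := cubeAct_cyclic v hv (M := Additive (Cinf A hA)) x₁
    (((v⁻¹ : ℤ_[2]ˣ) : ℤ_[2]) • x₂) (((v⁻¹ : ℤ_[2]ˣ) : ℤ_[2]) • x₃)
  rwa [smul_smul, smul_smul, Units.mul_inv, one_smul, one_smul] at h

/-- Multiplying through by δ avoids evaluating its inverse on elements of the torus. -/
theorem torusAct_cyclic_mul_delta :
    torusAct A hA v hv cyclic * delta A hA v⁻¹ = delta A hA v⁻¹ * gamma A hA := by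
  refine MulEquiv.ext fun t => ?_
  obtain ⟨⟨x₁, x₂, x₃⟩, rfl⟩ := torusMk_surjective A hA t
  rw [MulAut.mul_apply, MulAut.mul_apply, delta_torusMk, gamma_torusMk, delta_torusMk,
    torusAct_cyclic_torusMk]

/-- This is the origin of u = v⁻¹: the rotation becomes defined over ℤ[ω], in the same coordinates
as the Weyl group, only after the third coordinate is rescaled by v⁻¹. -/
theorem torusAct_cyclic : torusAct A hA v hv cyclic = gammaU A hA v⁻¹ := by
  rw [gammaU, ← torusAct_cyclic_mul_delta A hA v hv, mul_inv_cancel_right]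

end Torus
end SolSpin
end

/-! ### Half turns, and elements of Spin₇ realizing the Weyl group -/

open CliffordAlgebra
noncomputable section
namespace SolSpin

section Swap
variable {C : Type*} [Ring C] {a b c d : C}

/-- For orthogonal unit vectors, (a - c)(b - d) is up to a scalar the composite of the reflections
that exchange a with c and b with d. Conjugation by it therefore carries ba to dc. -/
theorem swap_planes (ha : a * a = 1) (hb : b * b = 1) (hc : c * c = 1) (hd : d * d = 1)
    (hba : b * a = -(a * b)) (hca : c * a = -(a * c)) (hda : d * a = -(a * d))
    (hcb : c * b = -(b * c)) (hdb : d * b = -(b * d)) (hdc : d * c = -(c * d)) :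
    (a - c) * (b - d) * (b * a) = d * c * ((a - c) * (b - d)) := by
  have aa : ∀ t, a * (a * t) = t := fun t => by rw [← mul_assoc, ha, one_mul]
  have bb : ∀ t, b * (b * t) = t := fun t => by rw [← mul_assoc, hb, one_mul]
  have cc : ∀ t, c * (c * t) = t := fun t => by rw [← mul_assoc, hc, one_mul]
  have dd : ∀ t, d * (d * t) = t := fun t => by rw [← mul_assoc, hd, one_mul]
  have ba : ∀ t, b * (a * t) = -(a * (b * t)) := fun t => by
    rw [← mul_assoc, hba, neg_mul, mul_assoc]
  have ca : ∀ t, c * (a * t) = -(a * (c * t)) := fun t => by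
    rw [← mul_assoc, hca, neg_mul, mul_assoc]
  have da : ∀ t, d * (a * t) = -(a * (d * t)) := fun t => by
    rw [← mul_assoc, hda, neg_mul, mul_assoc]
  have cb : ∀ t, c * (b * t) = -(b * (c * t)) := fun t => by
    rw [← mul_assoc, hcb, neg_mul, mul_assoc]
  have db : ∀ t, d * (b * t) = -(b * (d * t)) := fun t => by
    rw [← mul_assoc, hdb, neg_mul, mul_assoc]
  have dc : ∀ t, d * (c * t) = -(c * (d * t)) := fun t => by
    rw [← mul_assoc, hdc, neg_mul, mul_assoc]
  simp only [sub_mul, mul_sub, mul_assoc, ha, hb, hc, hd, hba, hca, hda, hcb, hdb, hdc, aa, bb, cc,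
    dd, ba, ca, da, cb, db, dc, mul_neg, neg_mul, neg_neg, mul_one, one_mul]
  abel

theorem swap_planes_symm (ha : a * a = 1) (hb : b * b = 1) (hc : c * c = 1) (hd : d * d = 1)
    (hba : b * a = -(a * b)) (hca : c * a = -(a * c)) (hda : d * a = -(a * d))
    (hcb : c * b = -(b * c)) (hdb : d * b = -(b * d)) (hdc : d * c = -(c * d)) :
    (a - c) * (b - d) * (d * c) = b * a * ((a - c) * (b - d)) := by
  have := swap_planes hc hd ha hb hdc (by rw [hca, neg_neg]) (by rw [hcb, neg_neg])
    (by rw [hda, neg_neg]) (by rw [hdb, neg_neg]) hba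
  rwa [← neg_sub a c, ← neg_sub b d, neg_mul_neg] at this
end Swap

variable {F : Type*} [Field F]

theorem blk1_combo (a b : F) (M N : Mat2 F) :
    blk1 (a • M + b • N) = a • blk1 M + b • blk1 N := by
  simp [blk1, unitsMap]; module
theorem blk2_combo (a b : F) (M N : Mat2 F) :
    blk2 (a • M + b • N) = a • blk2 M + b • blk2 N := by
  simp [blk2, unitsMap]; module
theorem blk3_combo (a b : F) (M N : Mat2 F) :
    blk3 (a • M + b • N) = a • blk3 M + b • blk3 N := by
  simp [blk3, unitsMap]; module

theorem coe_omega (X : SL2 F × SL2 F × SL2 F) : (omega F X : Cl7 F) = omegaCl X := rfl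

theorem omegaCl_apply (X : SL2 F × SL2 F × SL2 F) :
    omegaCl X = (blk1 (X.1 : Mat2 F) + blk2 (X.2.1 : Mat2 F)) * blk3 (X.2.2 : Mat2 F) := rfl

theorem omega_neg_three (X₁ X₂ X₃ : SL2 F) : omega F (-X₁, -X₂, -X₃) = omega F (X₁, X₂, X₃) := by
  have : ((-X₁, -X₂, -X₃) : SL2 F × SL2 F × SL2 F) = (-1, -1, -1) * (X₁, X₂, X₃) := by simp
  rw [this, map_mul, omega_neg_one, one_mul]

variable (F) in
/-- The central involution `-1` of `Spin₇(F)`. -/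
def zSpin : Spin7 F := omega F (1, 1, -1)

theorem coe_zSpin : (zSpin F : Cl7 F) = -1 := omegaCl_one_one_neg_one

theorem zSpin_comm (g : Spin7 F) : zSpin F * g = g * zSpin F :=
  Subtype.ext (by simp [coe_zSpin])

theorem zSpin_mul_self : zSpin F * zSpin F = 1 := Subtype.ext (by simp [coe_zSpin])

theorem omega_neg_right (X₁ X₂ X₃ : SL2 F) :
    omega F (X₁, X₂, -X₃) = zSpin F * omega F (X₁, X₂, X₃) := by
  rw [zSpin, ← map_mul]; simp

/-- Only the product of the two norms has to be 1. This avoids normalizing the vectors by square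
roots, which would destroy rationality over the small fields. -/
theorem ι_mul_ι_mem_spin_of_mul_eq_one {v w : V7 F} (h : form7 F v * form7 F w = 1) :
    ι (form7 F) v * ι (form7 F) w ∈ spinGroup (form7 F) := by
  have hv : form7 F v ≠ 0 := left_ne_zero_of_mul_eq_one h
  have hw : form7 F w ≠ 0 := right_ne_zero_of_mul_eq_one h
  let U : ∀ u : V7 F, form7 F u ≠ 0 → (Cl7 F)ˣ := fun u h =>
    ⟨ι (form7 F) u, (form7 F u)⁻¹ • ι (form7 F) u, by
      rw [mul_smul_comm, ι_sq_scalar, Algebra.algebraMap_eq_smul_one, smul_smul,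
        inv_mul_cancel₀ h, one_smul], by
      rw [smul_mul_assoc, ι_sq_scalar, Algebra.algebraMap_eq_smul_one, smul_smul,
        inv_mul_cancel₀ h, one_smul]⟩
  refine ⟨⟨⟨U v hv * U w hw, mul_mem (Subgroup.subset_closure ⟨v, rfl⟩)
    (Subgroup.subset_closure ⟨w, rfl⟩), rfl⟩, ?_⟩, ι_mul_ι_mem_evenOdd_zero _ v w⟩
  have key : ∀ {a b : V7 F}, form7 F a * form7 F b = 1 →
      ι (form7 F) a * (ι (form7 F) b * (ι (form7 F) b * ι (form7 F) a)) = 1 := fun {a b} h => by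
    rw [← mul_assoc (ι (form7 F) b), ι_sq_scalar, Algebra.algebraMap_eq_smul_one, smul_mul_assoc,
      one_mul, mul_smul_comm, ι_sq_scalar, Algebra.algebraMap_eq_smul_one, smul_smul, mul_comm, h,
      one_smul]
  rw [SetLike.mem_coe, Unitary.mem_iff, star_mul, star_ι, star_ι]
  simp only [neg_mul, mul_neg, neg_neg, mul_assoc]
  exact ⟨key (by rw [mul_comm, h]), key h⟩

/-- A matrix in `SL₂` with square `-1`, as a traceless matrix. -/
def toMat20 {X : SL2 F} (h : X * X = -1) : Mat20 F :=
  ⟨X, by simp [Matrix.trace_fin_two, trace_of_sq h]⟩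

section Quaternion
variable {A B : SL2 F} (hA : A * A = -1) (hB : B * B = -1) (hBA : B * A = -(A * B))

include hA hB hBA in
theorem mul_mul_self_of_anti : (A * B) * (A * B) = -1 := by
  rw [mul_assoc, ← mul_assoc B, hBA, neg_mul, mul_neg, mul_assoc, hB, mul_neg, mul_one, mul_neg,
    neg_neg, hA]

include hA hBA in
theorem mul_adjugate_of_anti : (B : Mat2 F) * (A : Mat2 F).adjugate = ((A * B : SL2 F) : Mat2 F) := by
  rw [← Matrix.SpecialLinearGroup.coe_inv, ← Matrix.SpecialLinearGroup.coe_mul, SL2_inv_of_sq hA,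
    mul_neg, hBA, neg_neg]

include hA hBA in
theorem omegaCl_mul_vec4 : omegaCl (A, A, 1) * vec4 (B : Mat2 F) =
    vec4 ((A * B : SL2 F) : Mat2 F) := by
  rw [omegaCl_apply]
  simp only [Matrix.SpecialLinearGroup.coe_one, blk3_one, mul_one]
  rw [add_mul, blk1_vec4, blk2_vec4, mul_adjugate_of_anti hA hBA,
    ← Matrix.SpecialLinearGroup.coe_mul, ← add_mul, blk12_one, one_mul]

theorem omegaCl_mul_vec3 (Y Z : Mat20 F) (h : (Z : Mat2 F) = (A : Mat2 F) * Y) :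
    omegaCl (1, 1, A) * vec3 Y = vec3 Z := by
  rw [omegaCl_apply]
  simp only [Matrix.SpecialLinearGroup.coe_one, blk12_one, one_mul]
  rw [vec3_eq_vol, ← mul_assoc, ← vol3_comm, mul_assoc, ← blk3_mul, vec3_eq_vol, h]

theorem ι_anti {v w : V7 F} (h : QuadraticMap.polar (form7 F) w v = 0) :
    ι (form7 F) w * ι (form7 F) v = -(ι (form7 F) v * ι (form7 F) w) := by
  rw [eq_neg_iff_add_eq_zero, ι_mul_ι_add_swap, h, map_zero]

theorem ι_sq_one {v : V7 F} (h : form7 F v = 1) : ι (form7 F) v * ι (form7 F) v = 1 := by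
  rw [ι_sq_scalar, h, map_one]

include hA in
theorem det_add_mul : ((B : Mat2 F) + ((A * B : SL2 F) : Mat2 F)).det = 2 := by
  have : (B : Mat2 F) + ((A * B : SL2 F) : Mat2 F) = (1 + (A : Mat2 F)) * B := by
    rw [Matrix.SpecialLinearGroup.coe_mul, add_mul, one_mul]
  have d := A.2
  rw [Matrix.det_fin_two, trace_of_sq hA] at d
  rw [this, Matrix.det_mul, Matrix.SpecialLinearGroup.det_coe, Matrix.det_fin_two]
  simp [trace_of_sq hA]
  linear_combination d

variable [NeZero (2 : F)]

/-- The difference of the two copies of a unit vector has norm 2. Halving one of the two factors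
gives norms ½ and 2. -/
theorem form7_swap_mul : form7 F ((2 : F)⁻¹ • ((B : Mat2 F), -toMat20 hB)) *
    form7 F (((A * B : SL2 F) : Mat2 F), -toMat20 (mul_mul_self_of_anti hA hB hBA)) = 1 := by
  have h2 : (2 : F) ≠ 0 := NeZero.ne _
  rw [QuadraticMap.map_smul, form7_apply, form7_apply]
  simp only [Submodule.coe_neg, toMat20, Matrix.det_neg, Matrix.SpecialLinearGroup.det_coe,
    Fintype.card_fin]
  rw [smul_eq_mul]
  field_simp
  norm_num

omit [NeZero (2 : F)] in
theorem ι_swap_mul : ι (form7 F) ((2 : F)⁻¹ • ((B : Mat2 F), -toMat20 hB)) *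
    ι (form7 F) (((A * B : SL2 F) : Mat2 F), -toMat20 (mul_mul_self_of_anti hA hB hBA)) =
      (2 : F)⁻¹ • ((vec4 (B : Mat2 F) - vec3 (toMat20 hB)) *
        (vec4 ((A * B : SL2 F) : Mat2 F) - vec3 (toMat20 (mul_mul_self_of_anti hA hB hBA)))) := by
  have e : ∀ Y : Mat20 F, vec3 (-Y) = -vec3 Y := fun Y => by
    rw [vec3, vec3, ← map_neg]; simp
  rw [map_smul, ι_eq, ι_eq, smul_mul_assoc, e, e, ← sub_eq_add_neg, ← sub_eq_add_neg]

theorem swapSpin_mem : (2 : F)⁻¹ • ((vec4 (B : Mat2 F) - vec3 (toMat20 hB)) *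
    (vec4 ((A * B : SL2 F) : Mat2 F) - vec3 (toMat20 (mul_mul_self_of_anti hA hB hBA)))) ∈
      spinGroup (form7 F) := by
  rw [← ι_swap_mul hA hB hBA]
  exact ι_mul_ι_mem_spin_of_mul_eq_one (form7_swap_mul hA hB hBA)

/-- The element of `Spin₇(F)` that interchanges the planes of `B, AB` in `M₂(F)` and in `M₂⁰(F)`. -/
def swapSpin : Spin7 F := ⟨_, swapSpin_mem hA hB hBA⟩

theorem coe_swapSpin : (swapSpin hA hB hBA : Cl7 F) = (2 : F)⁻¹ •
    ((vec4 (B : Mat2 F) - vec3 (toMat20 hB)) *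
      (vec4 ((A * B : SL2 F) : Mat2 F) - vec3 (toMat20 (mul_mul_self_of_anti hA hB hBA)))) := rfl

theorem vec4_mul_self (X : SL2 F) : vec4 (X : Mat2 F) * vec4 (X : Mat2 F) = 1 :=
  ι_sq_one (by simp)

theorem vec3_mul_self {X : SL2 F} (h : X * X = -1) : vec3 (toMat20 h) * vec3 (toMat20 h) = 1 :=
  ι_sq_one (by simp [toMat20])

/-- `[A, A, 1]`, `[A, A⁻¹, 1]` and `[1, 1, A]`: the half turns in the three planes spanned by
opposite short roots. -/
def halfTurn (A : SL2 F) : Fin 3 → Spin7 F :=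
  ![omega F (A, A, 1), omega F (A, A⁻¹, 1), omega F (1, 1, A)]

-- Conjugation by A on M₂(F) fixes 1 and A and negates B and AB: it is the half turn in the plane of
-- B and AB, and it lifts to the product of these two orthogonal unit vectors.
include hA hBA in
theorem halfTurn_zero_eq : omegaCl (A, A, 1) =
    vec4 ((A * B : SL2 F) : Mat2 F) * vec4 (B : Mat2 F) := by
  rw [← omegaCl_mul_vec4 hA hBA, mul_assoc, vec4_mul_self, mul_one]

theorem halfTurn_two_eq : omegaCl (1, 1, A) =
    vec3 (toMat20 (mul_mul_self_of_anti hA hB hBA)) * vec3 (toMat20 hB) := by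
  rw [← omegaCl_mul_vec3 (A := A) (toMat20 hB) (toMat20 (mul_mul_self_of_anti hA hB hBA))
    (Matrix.SpecialLinearGroup.coe_mul A B), mul_assoc, vec3_mul_self, mul_one]

include hA in
theorem vec4_anti : vec4 ((A * B : SL2 F) : Mat2 F) * vec4 (B : Mat2 F) =
    -(vec4 (B : Mat2 F) * vec4 ((A * B : SL2 F) : Mat2 F)) := by
  refine ι_anti ?_
  rw [QuadraticMap.polar, form7_apply, form7_apply, form7_apply]
  rw [Prod.fst_add, Prod.snd_add, add_comm, add_comm _ (B : Mat2 F), det_add_mul (B := B) hA]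
  simp
  ring

theorem vec3_anti : vec3 (toMat20 (mul_mul_self_of_anti hA hB hBA)) * vec3 (toMat20 hB) =
    -(vec3 (toMat20 hB) * vec3 (toMat20 (mul_mul_self_of_anti hA hB hBA))) := by
  refine ι_anti ?_
  rw [QuadraticMap.polar, form7_apply, form7_apply, form7_apply]
  rw [Prod.fst_add, Prod.snd_add, Submodule.coe_add, toMat20, toMat20, add_comm,
    add_comm _ (B : Mat2 F), det_add_mul (B := B) hA]
  simp
  ring

theorem swapSpin_mul_zero :
    swapSpin hA hB hBA * halfTurn A 0 = halfTurn A 2 * swapSpin hA hB hBA := by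
  apply Subtype.ext
  rw [Submonoid.coe_mul, Submonoid.coe_mul]
  change _ * omegaCl (A, A, 1) = omegaCl (1, 1, A) * _
  rw [halfTurn_zero_eq hA hBA, halfTurn_two_eq hA hB hBA, coe_swapSpin, smul_mul_assoc,
    mul_smul_comm]
  congr 1
  exact swap_planes (vec4_mul_self _) (vec4_mul_self _) (vec3_mul_self _) (vec3_mul_self _)
    (vec4_anti hA) (swap_mixed _ _) (swap_mixed _ _) (swap_mixed _ _) (swap_mixed _ _)
    (vec3_anti hA hB hBA)

theorem swapSpin_mul_two :
    swapSpin hA hB hBA * halfTurn A 2 = halfTurn A 0 * swapSpin hA hB hBA := by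
  apply Subtype.ext
  rw [Submonoid.coe_mul, Submonoid.coe_mul]
  change _ * omegaCl (1, 1, A) = omegaCl (A, A, 1) * _
  rw [halfTurn_zero_eq hA hBA, halfTurn_two_eq hA hB hBA, coe_swapSpin, smul_mul_assoc,
    mul_smul_comm]
  congr 1
  exact swap_planes_symm (vec4_mul_self _) (vec4_mul_self _) (vec3_mul_self _) (vec3_mul_self _)
    (vec4_anti hA) (swap_mixed _ _) (swap_mixed _ _) (swap_mixed _ _) (swap_mixed _ _)
    (vec3_anti hA hB hBA)

include hA hBA in
theorem mul_mul_of_anti : A * B * A = B := by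
  rw [mul_assoc, hBA, mul_neg, ← mul_assoc, hA, neg_mul, neg_neg, one_mul]

/-- The element [A, A⁻¹, 1] acts on M₂(F) as X ↦ AXA, which fixes B and AB, and it is trivial on
M₂⁰(F). So it commutes with all the vectors from which `swapSpin` is built. -/
theorem swapSpin_mul_one :
    swapSpin hA hB hBA * halfTurn A 1 = halfTurn A 1 * swapSpin hA hB hBA := by
  apply Subtype.ext
  rw [Submonoid.coe_mul, Submonoid.coe_mul]
  change _ * omegaCl (A, A⁻¹, 1) = omegaCl (A, A⁻¹, 1) * _
  have h1 : A * B * A = B := mul_mul_of_anti hA hBA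
  have h2 : A * (A * B) * A = A * B := by rw [mul_assoc A (A * B), h1]
  have c4 : ∀ X : SL2 F, A * X * A = X → omegaCl (A, A⁻¹, 1) * vec4 (X : Mat2 F) =
      vec4 (X : Mat2 F) * omegaCl (A, A⁻¹, 1) := fun X hX => by
    rw [vec4, omegaCl_mul_ι, inv_inv, ← Matrix.SpecialLinearGroup.coe_mul,
      ← Matrix.SpecialLinearGroup.coe_mul, hX]
    congr 2
    refine Prod.ext rfl (Subtype.ext ?_)
    simp [conj20]
  have c3 : ∀ Y : Mat20 F, omegaCl (A, A⁻¹, 1) * vec3 Y = vec3 Y * omegaCl (A, A⁻¹, 1) := fun Y => by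
    rw [vec3, omegaCl_mul_ι]
    congr 2
    refine Prod.ext (by simp) (Subtype.ext ?_)
    simp [conj20]
  rw [coe_swapSpin, smul_mul_assoc, mul_smul_comm]
  congr 1
  simp only [sub_mul, mul_sub, mul_assoc]
  simp only [← mul_assoc, c4 _ h1, c4 _ h2, c3]
  simp only [mul_assoc, c4 _ h1, c4 _ h2, c3]

end Quaternion
end SolSpin
end

/-! ### Square roots of the central involution in A(q^∞) -/

open CliffordAlgebra
noncomputable section
namespace SolSpin
variable {F : Type*} [Field F] [NeZero (2 : F)]

theorem Spin7_conj_ι (g : Spin7 F) (v : V7 F) :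
    ∃ w : V7 F, (g : Cl7 F) * ι (form7 F) v = ι (form7 F) w * (g : Cl7 F) := by
  have : Invertible (2 : F) := invertibleOfNonzero (NeZero.ne _)
  obtain ⟨w, hw⟩ := spinGroup.conjAct_smul_ι_mem_range_ι (Q := form7 F)
    (x := spinGroup.toUnits g) g.2 v
  refine ⟨w, ?_⟩
  rw [ConjAct.units_smul_def, ConjAct.ofConjAct_toConjAct] at hw
  rw [hw]
  change _ = (g : Cl7 F) * _ * ((g⁻¹ : Spin7 F) : Cl7 F) * (g : Cl7 F)
  rw [mul_assoc _ ((g⁻¹ : Spin7 F) : Cl7 F), ← Submonoid.coe_mul, inv_mul_cancel,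
    Submonoid.coe_one, mul_one]

section Classification
variable {A : SL2 F} (hA : orderOf A = 4)

/-- The commutant in `V` of the element `[-1, 1, ±A]` is a line. -/
theorem eq_smul_of_commute_omegaCl {D : SL2 F} (hD : D = A ∨ D = -A) {v : V7 F}
    (h : omegaCl (-1, 1, D) * ι (form7 F) v = ι (form7 F) v * omegaCl (-1, 1, D)) :
    ∃ c : F, v = c • (0, toMat20 (sq_eq_neg_one_of_orderOf hA)) := by
  obtain ⟨X, Y⟩ := v
  have hu : omegaCl ((-1, 1, D) : SL2 F × SL2 F × SL2 F) * omegaCl (-1, 1, D)⁻¹ = 1 := by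
    rw [← map_mul, mul_inv_cancel, map_one]
  rw [omegaCl_mul_ι] at h
  have h := congrArg (· * omegaCl ((-1, 1, D) : SL2 F × SL2 F × SL2 F)⁻¹) h
  simp only [mul_assoc, hu, mul_one] at h
  have h := ι_form7_injective h
  have h1 := congrArg Prod.fst h
  have h2 := congrArg (fun v => (v.2 : Mat2 F)) h
  simp [conj20] at h1
  have hX : X = 0 := by
    have h2 : (2 : F) ≠ 0 := NeZero.ne _
    have : (2 : F) • X = 0 := by rw [two_smul]; nth_rewrite 1 [← h1]; simp
    exact (smul_eq_zero.1 this).resolve_left h2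
  have hY : (Y : Mat2 F) * A = A * Y := by
    have h3 : (D : Mat2 F) * Y * ((D⁻¹ : SL2 F) : Mat2 F) = Y := h2
    have h4 : (Y : Mat2 F) * D = D * Y := by
      conv_lhs => rw [← h3]
      rw [mul_assoc _ ((D⁻¹ : SL2 F) : Mat2 F), ← Matrix.SpecialLinearGroup.coe_mul,
        inv_mul_cancel, Matrix.SpecialLinearGroup.coe_one, mul_one]
    rcases hD with rfl | rfl
    · exact h4
    · simpa using h4
  obtain ⟨a, b, hab⟩ := eq_smul_of_commute (ne_smul_one_of_orderOf hA) hY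
  refine ⟨b, Prod.ext (by simp [hX]) (Subtype.ext ?_)⟩
  have t := Mat20_11 Y
  rw [hab] at t
  have ht := trace_of_sq (sq_eq_neg_one_of_orderOf hA)
  simp [ht] at t
  have h2 : (2 : F) ≠ 0 := NeZero.ne _
  have ha : a = 0 := mul_left_cancel₀ h2 (by linear_combination t)
  rw [hab, ha]
  simp [toMat20]

-- A half turn fixes a space of dimension 5; two independent fixed vectors are enough to distinguish
-- it from [-1, 1, ±A], which fixes only a line.
include hA in
theorem exists_commuting_vectors {B : SL2 F} (hB : B * B = -1) (hBA : B * A = -(A * B)) (j : Fin 3) :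
    ∃ v w : V7 F, v ≠ 0 ∧ (∀ c d : F, c • v = d • w → d = 0) ∧
      (halfTurn A j : Cl7 F) * ι (form7 F) v = ι (form7 F) v * (halfTurn A j : Cl7 F) ∧
      (halfTurn A j : Cl7 F) * ι (form7 F) w = ι (form7 F) w * (halfTurn A j : Cl7 F) := by
  have hA2 := sq_eq_neg_one_of_orderOf hA
  have hneA := ne_smul_one_of_orderOf hA 0
  have hv : ((0, toMat20 hA2) : V7 F) ≠ 0 := fun h => by
    have := congrArg (fun v => (v.2 : Mat2 F)) h
    exact hneA (by rw [zero_smul]; exact this)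
  have key : ∀ (c d : F), c • (A : Mat2 F) = d • (B : Mat2 F) → d = 0 := fun c d h => by
    have h1 := congrArg (· * (A : Mat2 F)) h
    have h2 := congrArg ((A : Mat2 F) * ·) h
    have e := congrArg Subtype.val hBA
    simp only [Matrix.SpecialLinearGroup.coe_neg, Matrix.SpecialLinearGroup.coe_mul] at e
    simp only [smul_mul_assoc, mul_smul_comm, e, smul_neg] at h1 h2
    rw [h1] at h2
    have h3 : (2 * d) • ((A : Mat2 F) * B) = 0 := by
      rw [mul_smul, two_smul]; nth_rewrite 1 [← h2]; simp
    rw [smul_eq_zero] at h3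
    rcases h3 with h3 | h3
    · exact (mul_eq_zero.1 h3).resolve_left (NeZero.ne _)
    · have := congrArg Matrix.det h3
      rw [Matrix.det_mul, A.2, B.2] at this
      simp at this
  have c3 : ∀ (Y : Mat20 F) (A₁ A₂ : SL2 F), omegaCl (A₁, A₂, 1) * ι (form7 F) (0, Y) =
      ι (form7 F) (0, Y) * omegaCl (A₁, A₂, 1) := fun Y A₁ A₂ => by
    rw [omegaCl_mul_ι]
    congr 2
    exact Prod.ext (by simp) (Subtype.ext (by simp [conj20]))
  fin_cases j
  · refine ⟨(0, toMat20 hA2), (0, toMat20 hB), hv, fun c d h => ?_, c3 _ _ _, c3 _ _ _⟩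
    exact key c d (congrArg (fun v => (v.2 : Mat2 F)) h)
  · refine ⟨(0, toMat20 hA2), (0, toMat20 hB), hv, fun c d h => ?_, c3 _ _ _, c3 _ _ _⟩
    exact key c d (congrArg (fun v => (v.2 : Mat2 F)) h)
  · refine ⟨(0, toMat20 hA2), (1, 0), hv, fun c d h => ?_, ?_, ?_⟩
    · have := congrFun (congrFun (congrArg Prod.fst h) 0) 0
      simpa using this.symm
    · change omegaCl (1, 1, A) * _ = _ * omegaCl (1, 1, A)
      rw [omegaCl_mul_ι]
      congr 2
      refine Prod.ext (by simp) (Subtype.ext ?_)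
      simp only [conj20, toMat20]
      rw [← Matrix.SpecialLinearGroup.coe_mul, ← Matrix.SpecialLinearGroup.coe_mul, mul_inv_cancel_right]
    · change omegaCl (1, 1, A) * _ = _ * omegaCl (1, 1, A)
      rw [omegaCl_mul_ι]
      congr 2
      exact Prod.ext (by simp) (Subtype.ext (by simp [conj20]))

-- Otherwise g would carry two independent vectors fixed by the half turn into the line fixed by
-- [-1, 1, D].
include hA in
theorem conj_halfTurn_ne {B : SL2 F} (hB : B * B = -1) (hBA : B * A = -(A * B)) (j : Fin 3)
    (g : Spin7 F) {D : SL2 F} (hD : D = A ∨ D = -A) :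
    g * halfTurn A j * g⁻¹ ≠ omega F (-1, 1, D) := by
  intro h
  rw [mul_inv_eq_iff_eq_mul] at h
  have h : (g : Cl7 F) * (halfTurn A j : Cl7 F) = omegaCl (-1, 1, D) * (g : Cl7 F) :=
    congrArg Subtype.val h
  have hgu : (g : Cl7 F) * ((g⁻¹ : Spin7 F) : Cl7 F) = 1 := by
    rw [← Submonoid.coe_mul, mul_inv_cancel, Submonoid.coe_one]
  have hug : ((g⁻¹ : Spin7 F) : Cl7 F) * (g : Cl7 F) = 1 := by
    rw [← Submonoid.coe_mul, inv_mul_cancel, Submonoid.coe_one]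
  have hc : ∀ {x y : Cl7 F}, x * (g : Cl7 F) = y * (g : Cl7 F) → x = y := fun {x y} e => by
    have := congrArg (· * ((g⁻¹ : Spin7 F) : Cl7 F)) e
    simpa only [mul_assoc, hgu, mul_one] using this
  have hc' : ∀ {x y : Cl7 F}, (g : Cl7 F) * x = (g : Cl7 F) * y → x = y := fun {x y} e => by
    have := congrArg (((g⁻¹ : Spin7 F) : Cl7 F) * ·) e
    simpa only [← mul_assoc, hug, one_mul] using this
  obtain ⟨v, w, hv, hvw, cv, cw⟩ := exists_commuting_vectors hA hB hBA j
  have key : ∀ x : V7 F, (halfTurn A j : Cl7 F) * ι (form7 F) x = ι (form7 F) x * (halfTurn A j : Cl7 F) →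
      ∃ c : F, (g : Cl7 F) * ι (form7 F) x =
        c • (ι (form7 F) (0, toMat20 (sq_eq_neg_one_of_orderOf hA)) * (g : Cl7 F)) := fun x hx => by
    obtain ⟨x', hx'⟩ := Spin7_conj_ι g x
    have : omegaCl (-1, 1, D) * ι (form7 F) x' = ι (form7 F) x' * omegaCl (-1, 1, D) := hc (by
      rw [mul_assoc, ← hx', ← mul_assoc, ← h, mul_assoc, hx, ← mul_assoc, hx', mul_assoc, h,
        mul_assoc])
    obtain ⟨c, rfl⟩ := eq_smul_of_commute_omegaCl hA hD this
    exact ⟨c, by rw [hx', map_smul, smul_mul_assoc]⟩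
  obtain ⟨c, hc1⟩ := key v cv
  obtain ⟨d, hd1⟩ := key w cw
  have e : d • v = c • w := ι_form7_injective (hc' (by
    rw [map_smul, map_smul, mul_smul_comm, mul_smul_comm, hc1, hd1, smul_comm]))
  rw [hvw d c e, zero_smul] at hc1
  have : ι (form7 F) v = 0 := hc' (by rw [hc1, mul_zero])
  exact hv (ι_form7_injective (by rw [this, map_zero]))

/-- The elements `±[A, A, 1]`, `±[A, A⁻¹, 1]`, `±[1, 1, A]`. -/
def halfTurns (A : SL2 F) : Set (Spin7 F) :=
  {x | ∃ j, x = halfTurn A j ∨ x = zSpin F * halfTurn A j}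

/-- The condition says that (X₁², X₂², -X₃²) is (1, 1, 1) or (-1, -1, -1). So either X₁, X₂ are ±1
and X₃ is ±A, or the other way round. Changing all three signs at once does not affect the class,
which reduces the sixteen triples to the elements listed. -/
theorem Ainf_mul_self_eq_zSpin {t : Spin7 F} (ht : t ∈ Ainf A hA) (h : t * t = zSpin F) :
    t ∈ halfTurns A ∨ ∃ D, (D = A ∨ D = -A) ∧ t = omega F (-1, 1, D) := by
  have hA2 := sq_eq_neg_one_of_orderOf hA
  obtain ⟨⟨X₁, X₂, X₃⟩, rfl⟩ := ht
  have i1 : ((genC A hA)⁻¹ : Cinf A hA).1 = -A := SL2_inv_of_sq hA2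
  have h' : omegaC A hA ((X₁, X₂, X₃) * (X₁, X₂, X₃) * (1, 1, negC A hA)) = 1 := by
    rw [map_mul, map_mul, h]
    exact zSpin_mul_self
  rw [omegaC_eq_one_iff] at h'
  simp only [Prod.ext_iff, Prod.mk_mul_mk, Prod.fst_one, Prod.snd_one, mul_one] at h'
  have one_or : ∀ {X : Cinf A hA}, X * X = 1 → X.1 = 1 ∨ X.1 = -1 := fun h =>
    ((Cinf_mul_self_eq_one_iff A hA _).1 h).imp (congrArg Subtype.val) (congrArg Subtype.val)
  have A_or : ∀ {X : Cinf A hA}, X * X = negC A hA → X.1 = A ∨ X.1 = -A := fun h =>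
    (Cinf_mul_self_eq_negC A hA h).imp (congrArg Subtype.val) fun h => (congrArg Subtype.val h).trans i1
  have e2 : halfTurn A 1 = omega F (A, -A, 1) := by rw [← SL2_inv_of_sq hA2]; rfl
  have flip : ∀ a b c : SL2 F, omega F (a, b, c) = omega F (-a, -b, -c) := fun a b c =>
    (omega_neg_three a b c).symm
  change omega F (X₁.1, X₂.1, X₃.1) ∈ _ ∨ ∃ D, _ ∧ omega F (X₁.1, X₂.1, X₃.1) = _
  rcases h' with ⟨h1, h2, h3⟩ | ⟨h1, h2, h3⟩
  · have h3' : X₃ * X₃ = negC A hA := by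
      rw [eq_inv_of_mul_eq_one_left h3]
      exact inv_eq_of_mul_eq_one_right (negC_mul_self A hA)
    rcases one_or h1 with h1 | h1 <;> rcases one_or h2 with h2 | h2 <;>
      rcases A_or h3' with h3 | h3 <;> rw [h1, h2, h3]
    · exact .inl ⟨2, .inl rfl⟩
    · exact .inl ⟨2, .inr (omega_neg_right _ _ _)⟩
    · exact .inr ⟨-A, .inr rfl, by rw [flip]; simp⟩
    · exact .inr ⟨A, .inl rfl, by rw [flip]; simp⟩
    · exact .inr ⟨A, .inl rfl, rfl⟩
    · exact .inr ⟨-A, .inr rfl, rfl⟩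
    · exact .inl ⟨2, .inr (by rw [flip, neg_neg, omega_neg_right]; rfl)⟩
    · exact .inl ⟨2, .inl (by rw [flip, neg_neg, neg_neg]; rfl)⟩
  · have h3' : X₃ * X₃ = 1 := mul_eq_right.1 h3
    rcases A_or h1 with h1 | h1 <;> rcases A_or h2 with h2 | h2 <;>
      rcases one_or h3' with h3 | h3 <;> rw [h1, h2, h3]
    · exact .inl ⟨0, .inl rfl⟩
    · exact .inl ⟨0, .inr (omega_neg_right _ _ _)⟩
    · exact .inl ⟨1, .inl e2.symm⟩
    · exact .inl ⟨1, .inr (by rw [omega_neg_right, e2])⟩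
    · exact .inl ⟨1, .inr (by rw [flip, neg_neg, omega_neg_right, e2])⟩
    · exact .inl ⟨1, .inl (by rw [flip, neg_neg, neg_neg, e2])⟩
    · exact .inl ⟨0, .inr (by rw [flip, neg_neg, omega_neg_right]; rfl)⟩
    · exact .inl ⟨0, .inl (by rw [flip, neg_neg, neg_neg]; rfl)⟩

include hA in
theorem halfTurn_mul_self (j : Fin 3) : halfTurn A j * halfTurn A j = zSpin F := by
  have hA2 := sq_eq_neg_one_of_orderOf hA
  fin_cases j
  · change omega F (A, A, 1) * omega F (A, A, 1) = _
    rw [← map_mul, Prod.mk_mul_mk, Prod.mk_mul_mk, hA2, mul_one, ← omega_neg_three]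
    simp [zSpin]
  · change omega F (A, A⁻¹, 1) * omega F (A, A⁻¹, 1) = _
    rw [← map_mul, Prod.mk_mul_mk, Prod.mk_mul_mk, SL2_inv_of_sq hA2, neg_mul_neg, hA2, mul_one,
      ← omega_neg_three]
    simp [zSpin]
  · change omega F (1, 1, A) * omega F (1, 1, A) = _
    rw [← map_mul, Prod.mk_mul_mk, Prod.mk_mul_mk, hA2, mul_one]
    rfl

theorem halfTurn_mem (j : Fin 3) : halfTurn A j ∈ Ainf A hA := by
  fin_cases j
  · exact ⟨(genC A hA, genC A hA, 1), rfl⟩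
  · exact ⟨(genC A hA, (genC A hA)⁻¹, 1), rfl⟩
  · exact ⟨(1, 1, genC A hA), rfl⟩

/-- The element z is central, so a conjugate of a half turn is again a square root of z, and the
fixed spaces exclude [-1, 1, D]. -/
theorem conj_halfTurn_mem {B : SL2 F} (hB : B * B = -1) (hBA : B * A = -(A * B)) {j : Fin 3}
    {g : Spin7 F} (hg : g * halfTurn A j * g⁻¹ ∈ Ainf A hA) :
    g * halfTurn A j * g⁻¹ ∈ halfTurns A := by
  refine (Ainf_mul_self_eq_zSpin hA hg ?_).resolve_right ?_
  · rw [conj_mul, halfTurn_mul_self hA, ← zSpin_comm, mul_inv_cancel_right]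
  · rintro ⟨D, hD, h⟩
    exact conj_halfTurn_ne hA hB hBA j g hD h

end Classification
end SolSpin
end

/-! ### The Weyl group as signed permutations of the half turns -/

open CliffordAlgebra
noncomputable section
namespace SolSpin
variable {F : Type*} [Field F] [NeZero (2 : F)] {A B : SL2 F} (hA : orderOf A = 4)
  (hB : B * B = -1) (hBA : B * A = -(A * B))

/-- The element `[1, B, 1]`, which inverts the second coordinate of `[X₁, X₂, X₃]`. -/
def flipTwo (B : SL2 F) : Spin7 F := omega F (1, B, 1)

/-- The element `[1, 1, B]`, which inverts the third coordinate of `[X₁, X₂, X₃]`. -/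
def flipThree (B : SL2 F) : Spin7 F := omega F (1, 1, B)

theorem zSpin_semiconj {n x y : Spin7 F} (h : SemiconjBy n x y) :
    SemiconjBy n (zSpin F * x) (zSpin F * y) :=
  .mul_right (zSpin_comm n).symm h

-- With X = a + bA, of determinant 1, the inverse is a - bA, and moving B past A changes the sign of
-- A.
include hA hBA in
theorem mul_Cinf_of_anti (X : Cinf A hA) : B * X.1 = (X⁻¹ : Cinf A hA).1 * B := by
  obtain ⟨a, b, hX, -⟩ := exists_eq_smul_add_smul hA X.2.1
  have ht := trace_of_sq (sq_eq_neg_one_of_orderOf hA)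
  have hX' : ((X⁻¹ : Cinf A hA).1 : Mat2 F) = a • (1 : Mat2 F) - b • (A : Mat2 F) := by
    have := SL2_coe_add_coe_inv X.1
    rw [← eq_sub_iff_add_eq'] at this
    change (((X.1)⁻¹ : SL2 F) : Mat2 F) = _
    rw [this, hX, Matrix.trace_fin_two]
    simp [ht]
    module
  have e := congrArg Subtype.val hBA
  simp only [Matrix.SpecialLinearGroup.coe_neg, Matrix.SpecialLinearGroup.coe_mul] at e
  apply Subtype.ext
  simp only [Matrix.SpecialLinearGroup.coe_mul]
  rw [hX, hX', mul_add, sub_mul, smul_mul_assoc, mul_smul_comm, mul_smul_comm, smul_mul_assoc, e,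
    mul_one, one_mul, smul_neg, sub_eq_add_neg]

theorem flipTwo_semiconj (hA2 : A * A = -1) (hBA : B * A = -(A * B)) :
    SemiconjBy (flipTwo B) (halfTurn A 0) (halfTurn A 1) ∧
    SemiconjBy (flipTwo B) (halfTurn A 1) (halfTurn A 0) ∧
    SemiconjBy (flipTwo B) (halfTurn A 2) (halfTurn A 2) := by
  have i := SL2_inv_of_sq hA2
  refine ⟨?_, ?_, ?_⟩
  · change omega F (1, B, 1) * omega F (A, A, 1) = omega F (A, A⁻¹, 1) * omega F (1, B, 1)
    rw [← map_mul, ← map_mul]; simp [hBA, i]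
  · change omega F (1, B, 1) * omega F (A, A⁻¹, 1) = omega F (A, A, 1) * omega F (1, B, 1)
    rw [← map_mul, ← map_mul]; simp [hBA, i]
  · change omega F (1, B, 1) * omega F (1, 1, A) = omega F (1, 1, A) * omega F (1, B, 1)
    rw [← map_mul, ← map_mul]; simp

theorem flipThree_semiconj (hBA : B * A = -(A * B)) :
    SemiconjBy (flipThree B) (halfTurn A 0) (halfTurn A 0) ∧
    SemiconjBy (flipThree B) (halfTurn A 1) (halfTurn A 1) ∧
    SemiconjBy (flipThree B) (halfTurn A 2) (zSpin F * halfTurn A 2) := by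
  refine ⟨?_, ?_, ?_⟩
  · change omega F (1, 1, B) * omega F (A, A, 1) = omega F (A, A, 1) * omega F (1, 1, B)
    rw [← map_mul, ← map_mul]; simp
  · change omega F (1, 1, B) * omega F (A, A⁻¹, 1) = omega F (A, A⁻¹, 1) * omega F (1, 1, B)
    rw [← map_mul, ← map_mul]; simp
  · change omega F (1, 1, B) * omega F (1, 1, A) = zSpin F * omega F (1, 1, A) * omega F (1, 1, B)
    rw [← omega_neg_right, ← map_mul, ← map_mul]; simp [hBA]

/-- The monoid generated by three elements of `Spin₇(F)` that induce the Weyl group on `A(q^∞)`. -/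
def weylMonoid (hA2 : A * A = -1) : Submonoid (Spin7 F) :=
  Submonoid.closure {flipTwo B, flipThree B, swapSpin hA2 hB hBA}

section Weyl
variable (hA2 : A * A = -1)

theorem flipTwo_mem : flipTwo B ∈ weylMonoid hB hBA hA2 := Submonoid.subset_closure (by simp)
theorem flipThree_mem : flipThree B ∈ weylMonoid hB hBA hA2 := Submonoid.subset_closure (by simp)
theorem swapSpin_mem_weyl : swapSpin hA2 hB hBA ∈ weylMonoid hB hBA hA2 :=
  Submonoid.subset_closure (by simp)

theorem weyl_halfTurns {n : Spin7 F} (hn : n ∈ weylMonoid hB hBA hA2) :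
    ∀ x ∈ halfTurns A, ∃ y ∈ halfTurns A, SemiconjBy n x y := by
  have of_gen : ∀ n : Spin7 F, (∀ j, ∃ y ∈ halfTurns A, SemiconjBy n (halfTurn A j) y) →
      ∀ x ∈ halfTurns A, ∃ y ∈ halfTurns A, SemiconjBy n x y := by
    rintro n h x ⟨j, rfl | rfl⟩
    · exact h j
    · obtain ⟨y, ⟨k, rfl | rfl⟩, hy⟩ := h j
      · exact ⟨_, ⟨k, .inr rfl⟩, zSpin_semiconj hy⟩
      · refine ⟨_, ⟨k, .inl rfl⟩, ?_⟩
        have := zSpin_semiconj hy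
        rwa [← mul_assoc, zSpin_mul_self, one_mul] at this
  induction hn using Submonoid.closure_induction with
  | mem n hn =>
    obtain ⟨a0, a1, a2⟩ := flipTwo_semiconj hA2 hBA
    obtain ⟨b0, b1, b2⟩ := flipThree_semiconj hBA
    simp only [Set.mem_insert_iff, Set.mem_singleton_iff] at hn
    rcases hn with rfl | rfl | rfl <;> refine of_gen _ fun j => ?_ <;> fin_cases j
    · exact ⟨_, ⟨1, .inl rfl⟩, a0⟩
    · exact ⟨_, ⟨0, .inl rfl⟩, a1⟩
    · exact ⟨_, ⟨2, .inl rfl⟩, a2⟩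
    · exact ⟨_, ⟨0, .inl rfl⟩, b0⟩
    · exact ⟨_, ⟨1, .inl rfl⟩, b1⟩
    · exact ⟨_, ⟨2, .inr rfl⟩, b2⟩
    · exact ⟨_, ⟨2, .inl rfl⟩, swapSpin_mul_zero hA2 hB hBA⟩
    · exact ⟨_, ⟨1, .inl rfl⟩, swapSpin_mul_one hA2 hB hBA⟩
    · exact ⟨_, ⟨0, .inl rfl⟩, swapSpin_mul_two hA2 hB hBA⟩
  | one => exact fun x hx => ⟨x, hx, SemiconjBy.one_left x⟩
  | mul m n _ _ hm hn =>
    intro x hx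
    obtain ⟨y, hy, h⟩ := hn x hx
    obtain ⟨w, hw, h'⟩ := hm y hy
    exact ⟨w, hw, h'.mul_left h⟩

/-- This lemma and the next two follow a stabilizer chain: bring the first half turn to its place,
then the second without moving the first, then the third without moving either. -/
theorem exists_weyl_zero {x : Spin7 F} (hx : x ∈ halfTurns A) :
    ∃ n ∈ weylMonoid hB hBA hA2, SemiconjBy n x (halfTurn A 0) := by
  obtain ⟨a0, a1, a2⟩ := flipTwo_semiconj hA2 hBA
  obtain ⟨b0, b1, b2⟩ := flipThree_semiconj hBA
  have c0 : SemiconjBy (swapSpin hA2 hB hBA) _ _ := swapSpin_mul_zero hA2 hB hBA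
  have c2 : SemiconjBy (swapSpin hA2 hB hBA) _ _ := swapSpin_mul_two hA2 hB hBA
  have m1 := flipTwo_mem hB hBA hA2
  have m2 := flipThree_mem hB hBA hA2
  have m3 := swapSpin_mem_weyl hB hBA hA2
  have z : SemiconjBy (flipThree B) (zSpin F * halfTurn A 2) (halfTurn A 2) := by
    have := zSpin_semiconj b2
    rwa [← mul_assoc, zSpin_mul_self, one_mul] at this
  obtain ⟨j, rfl | rfl⟩ := hx <;> fin_cases j
  · exact ⟨1, one_mem _, SemiconjBy.one_left _⟩
  · exact ⟨_, m1, a1⟩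
  · exact ⟨_, m3, c2⟩
  · exact ⟨_, mul_mem (mul_mem m3 m2) m3, (c2.mul_left z).mul_left (zSpin_semiconj c0)⟩
  · exact ⟨_, mul_mem (mul_mem (mul_mem m3 m2) m3) m1,
      ((c2.mul_left z).mul_left (zSpin_semiconj c0)).mul_left (zSpin_semiconj a1)⟩
  · exact ⟨_, mul_mem m3 m2, c2.mul_left z⟩

theorem exists_weyl_one {x : Spin7 F} (hx : x ∈ halfTurns A) (h0 : x ≠ halfTurn A 0)
    (h0' : x ≠ zSpin F * halfTurn A 0) :
    ∃ n ∈ weylMonoid hB hBA hA2, SemiconjBy n (halfTurn A 0) (halfTurn A 0) ∧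
      SemiconjBy n x (halfTurn A 1) := by
  obtain ⟨a0, a1, a2⟩ := flipTwo_semiconj hA2 hBA
  obtain ⟨b0, b1, b2⟩ := flipThree_semiconj hBA
  have c0 : SemiconjBy (swapSpin hA2 hB hBA) _ _ := swapSpin_mul_zero hA2 hB hBA
  have c1 : SemiconjBy (swapSpin hA2 hB hBA) _ _ := swapSpin_mul_one hA2 hB hBA
  have c2 : SemiconjBy (swapSpin hA2 hB hBA) _ _ := swapSpin_mul_two hA2 hB hBA
  have m1 := flipTwo_mem hB hBA hA2
  have m2 := flipThree_mem hB hBA hA2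
  have m3 := swapSpin_mem_weyl hB hBA hA2
  have z : SemiconjBy (flipThree B) (zSpin F * halfTurn A 2) (halfTurn A 2) := by
    have := zSpin_semiconj b2
    rwa [← mul_assoc, zSpin_mul_self, one_mul] at this
  -- The exchange of the half turns 0 and 2, conjugated by the exchange of 0 and 1, becomes the
  -- exchange of 1 and 2 and fixes 0.
  have s0 := (a1.mul_left c1).mul_left a0
  have s2 := (a0.mul_left c2).mul_left a2
  have s1 := (a2.mul_left c0).mul_left a1
  have ms := mul_mem (mul_mem m1 m3) m1
  obtain ⟨j, rfl | rfl⟩ := hx <;> fin_cases j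
  · exact absurd rfl h0
  · exact ⟨1, one_mem _, SemiconjBy.one_left _, SemiconjBy.one_left _⟩
  · exact ⟨_, ms, s0, s2⟩
  · exact absurd rfl h0'
  · exact ⟨_, mul_mem (mul_mem ms m2) ms, (s0.mul_left b0).mul_left s0,
      (s2.mul_left z).mul_left (zSpin_semiconj s1)⟩
  · exact ⟨_, mul_mem ms m2, s0.mul_left b0, s2.mul_left z⟩

theorem exists_weyl_two {x : Spin7 F} (hx : x ∈ halfTurns A) (h0 : x ≠ halfTurn A 0)
    (h0' : x ≠ zSpin F * halfTurn A 0) (h1 : x ≠ halfTurn A 1) (h1' : x ≠ zSpin F * halfTurn A 1) :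
    ∃ n ∈ weylMonoid hB hBA hA2, SemiconjBy n (halfTurn A 0) (halfTurn A 0) ∧
      SemiconjBy n (halfTurn A 1) (halfTurn A 1) ∧ SemiconjBy n x (halfTurn A 2) := by
  obtain ⟨b0, b1, b2⟩ := flipThree_semiconj hBA
  have z : SemiconjBy (flipThree B) (zSpin F * halfTurn A 2) (halfTurn A 2) := by
    have := zSpin_semiconj b2
    rwa [← mul_assoc, zSpin_mul_self, one_mul] at this
  obtain ⟨j, rfl | rfl⟩ := hx <;> fin_cases j
  · exact absurd rfl h0
  · exact absurd rfl h1
  · exact ⟨1, one_mem _, SemiconjBy.one_left _, SemiconjBy.one_left _, SemiconjBy.one_left _⟩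
  · exact absurd rfl h0'
  · exact absurd rfl h1'
  · exact ⟨_, flipThree_mem hB hBA hA2, b0, b1, z⟩
end Weyl

include hA in
theorem halfTurn_ne (j k : Fin 3) (hjk : k < j) :
    halfTurn A j ≠ halfTurn A k ∧ halfTurn A j ≠ zSpin F * halfTurn A k := by
  have hA2 := sq_eq_neg_one_of_orderOf hA
  have i := SL2_inv_of_sq hA2
  have n1 : (-1 : SL2 F) ≠ 1 := SL2_neg_one_ne_one
  have hA1 : A ≠ 1 := by rintro rfl; rw [mul_one] at hA2; exact n1 hA2.symm
  have hA1' : A ≠ -1 := by rintro rfl; rw [neg_mul_neg, mul_one] at hA2; exact n1 hA2.symm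
  have hAi : A⁻¹ ≠ 1 := by rwa [Ne, inv_eq_one]
  have key : ∀ X Y : SL2 F × SL2 F × SL2 F, Y * X⁻¹ ≠ 1 → Y * X⁻¹ ≠ (-1, -1, -1) →
      omega F Y ≠ omega F X := fun X Y h1 h2 h => by
    rw [← mul_inv_eq_one, ← map_inv, ← map_mul, omega_eq_one_iff] at h
    exact h.elim h1 h2
  have kz : ∀ X, zSpin F * omega F X = omega F ((1, 1, -1) * X) := fun X => (map_mul _ _ _).symm
  fin_cases j <;> fin_cases k <;> first | exact absurd hjk (by decide) | skip
  · change omega F (A, A⁻¹, 1) ≠ omega F (A, A, 1) ∧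
      omega F (A, A⁻¹, 1) ≠ zSpin F * omega F (A, A, 1)
    rw [kz]
    constructor <;> apply key <;> simp [Prod.ext_iff, i, hA2, n1, n1.symm]
  · change omega F (1, 1, A) ≠ omega F (A, A, 1) ∧
      omega F (1, 1, A) ≠ zSpin F * omega F (A, A, 1)
    rw [kz]
    constructor <;> apply key <;> simp [Prod.ext_iff, i, hA1, hA1', hAi, neg_eq_iff_eq_neg, n1, n1.symm]
  · change omega F (1, 1, A) ≠ omega F (A, A⁻¹, 1) ∧
      omega F (1, 1, A) ≠ zSpin F * omega F (A, A⁻¹, 1)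
    rw [kz]
    constructor <;> apply key <;> simp [Prod.ext_iff, i, hA1, hA1', hAi, neg_eq_iff_eq_neg, n1, n1.symm]

theorem semiconj_left_cancel {g x x' y : Spin7 F} (h : SemiconjBy g x y) (h' : SemiconjBy g x' y) :
    x = x' := mul_left_cancel (h.eq.trans h'.eq.symm)

-- Conjugation by g maps half turns to half turns up to the factor z, and the stabilizer chain
-- undoes this signed permutation.
include hA in
theorem exists_weyl_commute {g : Spin7 F} (hg : ∀ j, g * halfTurn A j * g⁻¹ ∈ Ainf A hA) :
    ∃ n ∈ weylMonoid hB hBA (sq_eq_neg_one_of_orderOf hA),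
      ∀ j, Commute (n * g) (halfTurn A j) := by
  have hA2 := sq_eq_neg_one_of_orderOf hA
  -- Half turns that differ up to the factor z keep doing so under conjugation, which supplies the
  -- hypotheses of the later stages of the chain.
  have key : ∀ {g : Spin7 F} {j}, (∃ y ∈ halfTurns A, SemiconjBy g (halfTurn A j) y) →
      ∀ {k}, k < j → SemiconjBy g (halfTurn A k) (halfTurn A k) →
      ∀ {y}, SemiconjBy g (halfTurn A j) y → y ≠ halfTurn A k ∧ y ≠ zSpin F * halfTurn A k := by
    intro g j _ k hk hgk y hy
    refine ⟨?_, ?_⟩ <;> rintro rfl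
    · exact (halfTurn_ne hA j k hk).1 (semiconj_left_cancel hy hgk)
    · exact (halfTurn_ne hA j k hk).2 (semiconj_left_cancel hy (zSpin_semiconj hgk))
  have h : ∀ j, ∃ y ∈ halfTurns A, SemiconjBy g (halfTurn A j) y := fun j =>
    ⟨_, conj_halfTurn_mem hA hB hBA (hg j), by
      rw [SemiconjBy, inv_mul_cancel_right]⟩
  have step : ∀ {n g : Spin7 F}, n ∈ weylMonoid hB hBA hA2 →
      (∀ j, ∃ y ∈ halfTurns A, SemiconjBy g (halfTurn A j) y) →
      ∀ j, ∃ y ∈ halfTurns A, SemiconjBy (n * g) (halfTurn A j) y := by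
    intro n g hn hg j
    obtain ⟨y, hy, e⟩ := hg j
    obtain ⟨w, hw, e'⟩ := weyl_halfTurns hB hBA hA2 hn y hy
    exact ⟨w, hw, e'.mul_left e⟩
  obtain ⟨x0, hx0, e0⟩ := h 0
  obtain ⟨n0, hn0, f0⟩ := exists_weyl_zero hB hBA hA2 hx0
  have h := step hn0 h
  have s0 := f0.mul_left e0
  obtain ⟨x1, hx1, e1⟩ := h 1
  obtain ⟨n1, hn1, f10, f11⟩ := exists_weyl_one hB hBA hA2 hx1
    (key (h 1) (by decide) s0 e1).1 (key (h 1) (by decide) s0 e1).2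
  have h := step hn1 h
  have s0 := f10.mul_left s0
  have s1 := f11.mul_left e1
  obtain ⟨x2, hx2, e2⟩ := h 2
  obtain ⟨n2, hn2, f20, f21, f22⟩ := exists_weyl_two hB hBA hA2 hx2
    (key (h 2) (by decide) s0 e2).1 (key (h 2) (by decide) s0 e2).2
    (key (h 2) (by decide) s1 e2).1 (key (h 2) (by decide) s1 e2).2
  have s0 := f20.mul_left s0
  have s1 := f21.mul_left s1
  have s2 := f22.mul_left e2
  refine ⟨n2 * (n1 * n0), mul_mem hn2 (mul_mem hn1 hn0), fun j => ?_⟩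
  rw [mul_assoc, mul_assoc]
  fin_cases j
  exacts [s0, s1, s2]

theorem omegaCl_combo_left {X Y C : SL2 F} {a b : F}
    (h : (X : Mat2 F) = a • (1 : Mat2 F) + b • (A : Mat2 F))
    (h' : (Y : Mat2 F) = a • (1 : Mat2 F) + b • (C : Mat2 F)) :
    omegaCl (X, Y, 1) = a • 1 + b • omegaCl (A, C, 1) := by
  simp only [omegaCl_apply, h, h', blk1_combo, blk2_combo, Matrix.SpecialLinearGroup.coe_one,
    blk3_one, mul_one]
  rw [← blk12_one]; module

theorem omegaCl_combo_right {X : SL2 F} {a b : F}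
    (h : (X : Mat2 F) = a • (1 : Mat2 F) + b • (A : Mat2 F)) :
    omegaCl (1, 1, X) = a • 1 + b • omegaCl (1, 1, A) := by
  simp only [omegaCl_apply, h, blk3_combo, Matrix.SpecialLinearGroup.coe_one, blk3_one,
    blk12_one, one_mul]

end SolSpin
end

/-! ### Spin₇ acts on the torus through G₂₄, and Ω_u is the image of G₂₄ -/

open CliffordAlgebra
noncomputable section
namespace SolSpin
variable {F : Type*} [Field F] [NeZero (2 : F)] {A B : SL2 F} (hA : orderOf A = 4)
  (hB : B * B = -1) (hBA : B * A = -(A * B))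

theorem Cinf_inv_combo {X : Cinf A hA} {a b : F}
    (hX : (X.1 : Mat2 F) = a • (1 : Mat2 F) + b • (A : Mat2 F)) :
    ((X⁻¹ : Cinf A hA).1 : Mat2 F) = a • (1 : Mat2 F) + b • ((A⁻¹ : SL2 F) : Mat2 F) := by
  have ht := trace_of_sq (sq_eq_neg_one_of_orderOf hA)
  have := SL2_coe_add_coe_inv X.1
  rw [← eq_sub_iff_add_eq'] at this
  change (((X.1)⁻¹ : SL2 F) : Mat2 F) = _
  rw [this, hX, Matrix.trace_fin_two, SL2_inv_of_sq (sq_eq_neg_one_of_orderOf hA)]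
  simp [ht]
  module

/-- Each of the three subtori lies in the span of 1 and its half turn, with the same coefficients a,
b for the same X. So conjugation on the subtori is known once it is known on the half turns. -/
theorem omega_diag_combo (X : Cinf A hA) : ∃ a b : F,
    ((omega F (X.1, X.1, 1) : Spin7 F) : Cl7 F) = a • 1 + b • (halfTurn A 0 : Cl7 F) ∧
    ((omega F (X.1, (X⁻¹ : Cinf A hA).1, 1) : Spin7 F) : Cl7 F) =
      a • 1 + b • (halfTurn A 1 : Cl7 F) ∧
    ((omega F (1, 1, X.1) : Spin7 F) : Cl7 F) = a • 1 + b • (halfTurn A 2 : Cl7 F) := by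
  obtain ⟨a, b, hX, -⟩ := exists_eq_smul_add_smul hA X.2.1
  exact ⟨a, b, omegaCl_combo_left hX hX, omegaCl_combo_left hX (Cinf_inv_combo hA hX),
    omegaCl_combo_right hX⟩

theorem semiconj_combo {g x y u w : Spin7 F} (h : SemiconjBy g x y) {a b : F}
    (hu : (u : Cl7 F) = a • 1 + b • (x : Cl7 F)) (hw : (w : Cl7 F) = a • 1 + b • (y : Cl7 F)) :
    SemiconjBy g u w := by
  apply Subtype.ext
  have e : (g : Cl7 F) * (x : Cl7 F) = y * g := congrArg Subtype.val h.eq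
  rw [Submonoid.coe_mul, Submonoid.coe_mul, hu, hw, mul_add, add_mul, mul_smul_comm, mul_smul_comm,
    smul_mul_assoc, smul_mul_assoc, e, mul_one, one_mul]

/-- The torus element is split into one factor from each of the three subtori. The splitting halves
the first two coordinates, hence the squares. -/
theorem omega_sq_eq (Y₁ Y₂ X₃ : Cinf A hA) : omegaC A hA (Y₁ * Y₁, Y₂ * Y₂, X₃) =
    omega F ((Y₁ * Y₂).1, (Y₁ * Y₂).1, 1) *
      omega F ((Y₁ * Y₂⁻¹).1, ((Y₁ * Y₂⁻¹)⁻¹ : Cinf A hA).1, 1) * omega F (1, 1, X₃.1) := by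
  change omegaC A hA _ = omegaC A hA (Y₁ * Y₂, Y₁ * Y₂, 1) *
    omegaC A hA (Y₁ * Y₂⁻¹, (Y₁ * Y₂⁻¹)⁻¹, 1) * omegaC A hA (1, 1, X₃)
  rw [← map_mul, ← map_mul]
  congr 1
  simp only [Prod.mk_mul_mk, mul_one, one_mul, mul_inv_rev, inv_inv]
  refine Prod.ext ?_ (Prod.ext ?_ rfl)
  · change Y₁ * Y₁ = Y₁ * Y₂ * (Y₁ * Y₂⁻¹)
    rw [mul_mul_mul_comm, mul_inv_cancel, mul_one]
  · change Y₂ * Y₂ = Y₁ * Y₂ * (Y₂ * Y₁⁻¹)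
    rw [mul_comm Y₂ Y₁⁻¹, mul_mul_mul_comm, mul_inv_cancel, one_mul]

variable [IsAlgClosed F]

theorem commute_of_commute_halfTurn {g : Spin7 F} (h : ∀ j, Commute g (halfTurn A j)) {t : Spin7 F}
    (ht : t ∈ Ainf A hA) : Commute g t := by
  obtain ⟨⟨X₁, X₂, X₃⟩, rfl⟩ := ht
  obtain ⟨Y₁, rfl⟩ := Cinf_exists_mul_self_eq A hA X₁
  obtain ⟨Y₂, rfl⟩ := Cinf_exists_mul_self_eq A hA X₂
  rw [omega_sq_eq]
  obtain ⟨a, b, h0, -, -⟩ := omega_diag_combo hA (Y₁ * Y₂)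
  obtain ⟨c, d, -, h1, -⟩ := omega_diag_combo hA (Y₁ * Y₂⁻¹)
  obtain ⟨k, l, -, -, h2⟩ := omega_diag_combo hA X₃
  exact ((semiconj_combo (h 0) h0 h0 : Commute g _).mul_right (semiconj_combo (h 1) h1 h1)).mul_right
    (semiconj_combo (h 2) h2 h2)

variable (v : ℤ_[2]ˣ) (hv : (v : ℤ_[2]) ^ 2 + v + 2 = 0)

include hBA in
theorem flipTwo_semiconj_torus (t : Ainf A hA) :
    SemiconjBy (flipTwo B) (t : Spin7 F) (torusAct A hA v hv signTwo t : Spin7 F) := by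
  obtain ⟨⟨x₁, x₂, x₃⟩, rfl⟩ := torusMk_surjective A hA t
  rw [torusAct_torusMk A hA v hv (cubeAct_signTwo v hv x₁ x₂ x₃)]
  change omega F (1, B, 1) * omega F (x₁.toMul.1, x₂.toMul.1, x₃.toMul.1) =
    omega F (x₁.toMul.1, (x₂.toMul⁻¹ : Cinf A hA).1, x₃.toMul.1) * omega F (1, B, 1)
  rw [← map_mul, ← map_mul]
  simp only [Prod.mk_mul_mk, one_mul, mul_one, mul_Cinf_of_anti hA hBA]

include hBA in
theorem flipThree_semiconj_torus (t : Ainf A hA) :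
    SemiconjBy (flipThree B) (t : Spin7 F) (torusAct A hA v hv signThree t : Spin7 F) := by
  obtain ⟨⟨x₁, x₂, x₃⟩, rfl⟩ := torusMk_surjective A hA t
  rw [torusAct_torusMk A hA v hv (cubeAct_signThree v hv x₁ x₂ x₃)]
  change omega F (1, 1, B) * omega F (x₁.toMul.1, x₂.toMul.1, x₃.toMul.1) =
    omega F (x₁.toMul.1, x₂.toMul.1, (x₃.toMul⁻¹ : Cinf A hA).1) * omega F (1, 1, B)
  rw [← map_mul, ← map_mul]
  simp only [Prod.mk_mul_mk, one_mul, mul_one, mul_Cinf_of_anti hA hBA]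

/-- In the splitting `omega_sq_eq`, conjugation exchanges the first and third subtori and fixes the
middle one; regrouping the factors gives the formula of `cubeAct_shortSwap`. -/
theorem swapSpin_semiconj_torus (hA2 : A * A = -1) (t : Ainf A hA) :
    SemiconjBy (swapSpin hA2 hB hBA) (t : Spin7 F) (torusAct A hA v hv shortSwap t : Spin7 F) := by
  obtain ⟨⟨x₁, x₂, x₃⟩, rfl⟩ := torusMk_surjective A hA t
  obtain ⟨y₁, rfl⟩ := Cinf_exists_mul_self_eq A hA x₁
  obtain ⟨y₂, rfl⟩ := Cinf_exists_mul_self_eq A hA x₂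
  obtain ⟨y₃, rfl⟩ := Cinf_exists_mul_self_eq A hA x₃
  have e := torusAct_torusMk A hA v hv (cubeAct_shortSwap v hv (M := Additive (Cinf A hA))
    (Additive.ofMul y₁) (Additive.ofMul y₂) (Additive.ofMul y₃))
  have c0 : SemiconjBy (swapSpin hA2 hB hBA) _ _ := swapSpin_mul_zero hA2 hB hBA
  have c1 : SemiconjBy (swapSpin hA2 hB hBA) _ _ := swapSpin_mul_one hA2 hB hBA
  have c2 : SemiconjBy (swapSpin hA2 hB hBA) _ _ := swapSpin_mul_two hA2 hB hBA
  obtain ⟨a, b, h0, -, h0'⟩ := omega_diag_combo hA (y₁ * y₂)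
  obtain ⟨c, d, -, h1, -⟩ := omega_diag_combo hA (y₁ * y₂⁻¹)
  obtain ⟨k, l, h2, -, h2'⟩ := omega_diag_combo hA (y₃ * y₃)
  have key := ((semiconj_combo c0 h0 h0').mul_right (semiconj_combo c1 h1 h1)).mul_right
    (semiconj_combo c2 h2' h2)
  rw [← omega_sq_eq] at key
  refine (congrArg₂ (SemiconjBy (swapSpin hA2 hB hBA)) rfl ?_).mpr key
  refine (congrArg Subtype.val e).trans ?_
  change omegaC A hA (y₁ / y₂ * (y₃ * y₃), y₂ / y₁ * (y₃ * y₃), y₁ * y₂) =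
    omegaC A hA (1, 1, y₁ * y₂) * omegaC A hA (y₁ * y₂⁻¹, (y₁ * y₂⁻¹)⁻¹, 1) *
      omegaC A hA (y₃ * y₃, y₃ * y₃, 1)
  rw [← map_mul, ← map_mul]
  simp only [Prod.mk_mul_mk, one_mul, mul_one, div_eq_mul_inv, mul_inv_rev, inv_inv]

theorem weyl_semiconj_torus (hA2 : A * A = -1) {n : Spin7 F} (hn : n ∈ weylMonoid hB hBA hA2) :
    ∃ s ∈ G24, ∀ t : Ainf A hA, SemiconjBy n (t : Spin7 F) (torusAct A hA v hv s t : Spin7 F) := by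
  induction hn using Submonoid.closure_induction with
  | mem n hn =>
    simp only [Set.mem_insert_iff, Set.mem_singleton_iff] at hn
    rcases hn with rfl | rfl | rfl
    · exact ⟨_, signTwo_mem, flipTwo_semiconj_torus hA hBA v hv⟩
    · exact ⟨_, signThree_mem, flipThree_semiconj_torus hA hBA v hv⟩
    · exact ⟨_, shortSwap_mem, swapSpin_semiconj_torus hA hB hBA v hv hA2⟩
  | one => exact ⟨1, one_mem _, fun t => by rw [map_one]; exact SemiconjBy.one_left _⟩
  | mul m n _ _ hm hn =>
    obtain ⟨r, hr, h⟩ := hm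
    obtain ⟨s, hs, h'⟩ := hn
    refine ⟨r * s, mul_mem hr hs, fun t => ?_⟩
    rw [map_mul, MulAut.mul_apply]
    exact (h _).mul_left (h' t)

theorem weyl_semiconj_torus_inv {n : Spin7 F} {s : GL (Fin 3) IntSqrtNegSeven}
    (h : ∀ t : Ainf A hA, SemiconjBy n (t : Spin7 F) (torusAct A hA v hv s t : Spin7 F))
    (t : Ainf A hA) : SemiconjBy n (torusAct A hA v hv s⁻¹ t : Spin7 F) (t : Spin7 F) := by
  have e := h ((torusAct A hA v hv s)⁻¹ t)
  rw [MulAut.apply_inv_self] at e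
  rw [map_inv]
  exact e

theorem eq_conj_of_semiconjBy {G : Type*} [Group G] {n g x y : G} (h : SemiconjBy n y x)
    (c : Commute (n * g) x) : y = g * x * g⁻¹ := by
  rw [eq_mul_inv_iff_mul_eq]
  apply mul_left_cancel (a := n)
  rw [← mul_assoc, h.eq, ← mul_assoc, c.eq, mul_assoc]

section Restriction
variable (H : Subgroup (Spin7 F)) (hH : H ≤ Ainf A hA)
  (hchar : ∀ (φ : MulAut (Ainf A hA)) (t : Ainf A hA), (t : Spin7 F) ∈ H → (φ t : Spin7 F) ∈ H)

/-- The restriction of the automorphisms of `A(q^∞)` to a subgroup that all of them preserve. -/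
def restrictAut : MulAut (Ainf A hA) →* MulAut H where
  toFun φ :=
    { toFun := fun x => ⟨φ ⟨x, hH x.2⟩, hchar φ _ x.2⟩
      invFun := fun x => ⟨φ⁻¹ ⟨x, hH x.2⟩, hchar φ⁻¹ _ x.2⟩
      left_inv := fun x => Subtype.ext (by
        change ((φ⁻¹ (φ ⟨x, hH x.2⟩) : Ainf A hA) : Spin7 F) = x
        rw [MulAut.inv_apply_self])
      right_inv := fun x => Subtype.ext (by
        change ((φ (φ⁻¹ ⟨x, hH x.2⟩) : Ainf A hA) : Spin7 F) = x
        rw [MulAut.apply_inv_self])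
      map_mul' := fun x y => Subtype.ext (by
        change ((φ (⟨x, hH x.2⟩ * ⟨y, hH y.2⟩) : Ainf A hA) : Spin7 F) =
          φ ⟨x, hH x.2⟩ * φ ⟨y, hH y.2⟩
        rw [map_mul]
        rfl) }
  map_one' := rfl
  map_mul' _ _ := rfl

theorem coe_restrictAut (φ : MulAut (Ainf A hA)) (x : H) :
    (restrictAut hA H hH hchar φ x : Spin7 F) = φ ⟨x, hH x.2⟩ := rfl

variable (two : ∀ t : Ainf A hA, t * t = 1 → (t : Spin7 F) ∈ H)
  (half : ∀ j, halfTurn A j ∈ H)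

-- Triviality on the 2-torsion leaves only 1 and -1, and -1 acts as inversion, which moves a half
-- turn since its square is z ≠ 1.
include two half in
theorem injective_restrict_torusAct :
    Function.Injective
      ((restrictAut hA H hH hchar).comp ((torusAct A hA v hv).comp G24.subtype)) := by
  rw [injective_iff_map_eq_one]
  rintro ⟨g, hg⟩ h
  have key : ∀ t : Ainf A hA, (t : Spin7 F) ∈ H → torusAct A hA v hv g t = t := fun t ht =>
    Subtype.ext (congrArg (fun φ : MulAut H => (φ ⟨t, ht⟩ : Spin7 F)) h)
  rcases eq_one_or_neg_one_of_redGL hg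
    (redGL_eq_one_of_torusAct A hA v hv fun t ht => key t (two t ht)) with rfl | rfl
  · rfl
  · exfalso
    have h2 := key ⟨_, halfTurn_mem hA 2⟩ (half 2)
    rw [torusAct_neg_one, inv_eq_iff_mul_eq_one] at h2
    have h3 : halfTurn A 2 * halfTurn A 2 = 1 := congrArg Subtype.val h2
    rw [halfTurn_mul_self hA, zSpin, omega_eq_one_iff] at h3
    simp [Prod.ext_iff, SL2_neg_one_ne_one, SL2_neg_one_ne_one.symm] at h3

variable (L : Subgroup (Spin7 F))
  (weyl : weylMonoid hB hBA (sq_eq_neg_one_of_orderOf hA) ≤ L.toSubmonoid)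

-- Three generators of G₂₄ are conjugations by Weyl elements, and the fourth is γ_u; this gives one
-- inclusion. For the other, an element that normalizes H keeps the half turns inside A(q^∞), so a
-- Weyl element corrects it to one centralizing the torus. Stating this for H and L covers the
-- infinite group and all finite levels together.
include half weyl in
theorem autBy_sup_zpowers_eq_range :
    autBy L H ⊔ Subgroup.zpowers (restrictAut hA H hH hchar (gammaU A hA v⁻¹)) =
      ((restrictAut hA H hH hchar).comp ((torusAct A hA v hv).comp G24.subtype)).range := by
  have hA2 := sq_eq_neg_one_of_orderOf hA
  rw [← torusAct_cyclic A hA v hv]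
  apply le_antisymm
  · rw [sup_le_iff, Subgroup.zpowers_le]
    refine ⟨?_, ⟨⟨cyclic, cyclic_mem⟩, rfl⟩⟩
    rintro φ ⟨g, -, hg⟩
    obtain ⟨n, hn, hc⟩ := exists_weyl_commute hA hB hBA (g := g) fun j => by
      rw [← hg ⟨_, half j⟩]
      exact hH (φ _).2
    obtain ⟨s, hs, hns⟩ := weyl_semiconj_torus hA hB hBA v hv hA2 hn
    refine ⟨⟨s⁻¹, inv_mem hs⟩, MulEquiv.ext fun x => Subtype.ext ?_⟩
    change (torusAct A hA v hv s⁻¹ ⟨x, hH x.2⟩ : Spin7 F) = φ x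
    have e := weyl_semiconj_torus_inv hA v hv hns ⟨x, hH x.2⟩
    have c := commute_of_commute_halfTurn hA hc (hH x.2)
    exact (eq_conj_of_semiconjBy e c).trans (hg x).symm
  · have of_semiconj : ∀ n ∈ L, ∀ s, (∀ t : Ainf A hA,
        SemiconjBy n (t : Spin7 F) (torusAct A hA v hv s t : Spin7 F)) →
        restrictAut hA H hH hchar (torusAct A hA v hv s) ∈ autBy L H := fun n hn s h =>
      ⟨n, hn, fun x => by rw [coe_restrictAut, eq_mul_inv_iff_mul_eq]; exact (h ⟨x, hH x.2⟩).eq.symm⟩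
    have le_comap : G24 ≤ Subgroup.comap ((restrictAut hA H hH hchar).comp (torusAct A hA v hv))
        (autBy L H ⊔ Subgroup.zpowers (restrictAut hA H hH hchar (torusAct A hA v hv cyclic))) := by
      refine (Subgroup.closure_le _).2 ?_
      intro s hs
      simp only [Set.mem_insert_iff, Set.mem_singleton_iff] at hs
      rcases hs with rfl | rfl | rfl | rfl
      · exact Subgroup.mem_sup_left (of_semiconj _ (weyl (flipTwo_mem hB hBA hA2)) _
          (flipTwo_semiconj_torus hA hBA v hv))
      · exact Subgroup.mem_sup_left (of_semiconj _ (weyl (flipThree_mem hB hBA hA2)) _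
          (flipThree_semiconj_torus hA hBA v hv))
      · exact Subgroup.mem_sup_left (of_semiconj _ (weyl (swapSpin_mem_weyl hB hBA hA2)) _
          (swapSpin_semiconj_torus hA hB hBA v hv hA2))
      · exact Subgroup.mem_sup_right (Subgroup.mem_zpowers _)
    rintro _ ⟨s, rfl⟩
    exact le_comap s.2

include hB hBA hv two half weyl in
theorem nonempty_autBy_sup_zpowers_mulEquiv :
    Nonempty (↥(autBy L H ⊔ Subgroup.zpowers (restrictAut hA H hH hchar (gammaU A hA v⁻¹))) ≃*
      Multiplicative (ZMod 2) × GL (Fin 3) (ZMod 2)) := by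
  rw [autBy_sup_zpowers_eq_range hA hB hBA v hv H hH hchar half L weyl]
  obtain ⟨e⟩ := nonempty_G24_mulEquiv
  exact ⟨(MonoidHom.ofInjective
    (injective_restrict_torusAct hA v hv H hH hchar two half)).symm.trans e⟩
end Restriction

end SolSpin
end

/-! ### Rationality: base change of Clifford algebras, Frobenius, and the groups A(q^n) -/

open CliffordAlgebra
noncomputable section
namespace SolSpin
section BaseChange
variable (M N : Type*) [Field M] [Field N] [Algebra M N]

theorem clMap_ι (v : V7 M) : clMap M N (ι (form7 M) v) = ι (form7 N) (mapV M N v) := by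
  rw [clMap, CliffordAlgebra.lift_ι_apply]
  rfl

theorem clMap_algebraMap (r : M) :
    clMap M N (algebraMap M (Cl7 M) r) = algebraMap N (Cl7 N) (algebraMap M N r) := by
  rw [AlgHom.commutes, ← IsScalarTower.algebraMap_apply]

theorem clMap_unitsMap (x y : Cl7 M) (X : Mat2 M) :
    clMap M N (unitsMap x y X) =
      unitsMap (clMap M N x) (clMap M N y) (X.map (algebraMap M N)) := by
  simp [unitsMap]

theorem clMap_vp : clMap M N (vp M) = vp N := by
  rw [vp, vp, clMap_ι]; congr 1; ext i j <;> fin_cases i <;> fin_cases j <;> simp [mapV]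
theorem clMap_vq : clMap M N (vq M) = vq N := by
  rw [vq, vq, clMap_ι]; congr 1; ext i j <;> fin_cases i <;> fin_cases j <;> simp [mapV]
theorem clMap_vr : clMap M N (vr M) = vr N := by
  rw [vr, vr, clMap_ι]; congr 1; ext i j <;> fin_cases i <;> fin_cases j <;> simp [mapV]
theorem clMap_vs : clMap M N (vs M) = vs N := by
  rw [vs, vs, clMap_ι]; congr 1; ext i j <;> fin_cases i <;> fin_cases j <;> simp [mapV]
theorem clMap_vh : clMap M N (vh M) = vh N := by
  rw [vh, vh, clMap_ι]; congr 1; ext i j <;> fin_cases i <;> fin_cases j <;> simp [mapV]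
theorem clMap_ve : clMap M N (ve M) = ve N := by
  rw [ve, ve, clMap_ι]; congr 1; ext i j <;> fin_cases i <;> fin_cases j <;> simp [mapV]
theorem clMap_vf : clMap M N (vf M) = vf N := by
  rw [vf, vf, clMap_ι]; congr 1; ext i j <;> fin_cases i <;> fin_cases j <;> simp [mapV]

theorem clMap_omegaCl (X₁ X₂ X₃ : SL2 M) :
    clMap M N (omegaCl (X₁, X₂, X₃)) =
      omegaCl (X₁.map (algebraMap M N), X₂.map (algebraMap M N), X₃.map (algebraMap M N)) := by
  simp only [omegaCl_apply, blk1, blk2, blk3, map_mul, map_add, clMap_unitsMap, map_neg, clMap_vp,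
    clMap_vq, clMap_vr, clMap_vs, clMap_vh, clMap_ve, clMap_vf]
  rfl

theorem omega_map_mem_spin7Over (X₁ X₂ X₃ : SL2 M) :
    omega N (X₁.map (algebraMap M N), X₂.map (algebraMap M N), X₃.map (algebraMap M N)) ∈
      spin7Over M N :=
  ⟨omega M (X₁, X₂, X₃), clMap_omegaCl M N X₁ X₂ X₃⟩

variable {M N}
theorem mem_range_mapV {v : V7 N} (h1 : ∀ i j, v.1 i j ∈ (algebraMap M N).range)
    (h2 : ∀ i j, (v.2 : Mat2 N) i j ∈ (algebraMap M N).range) : ∃ w, mapV M N w = v := by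
  choose X hX using h1
  choose Y hY using h2
  refine ⟨(X, ⟨Y, ?_⟩), ?_⟩
  · change Matrix.trace (Matrix.of Y) = 0
    rw [Matrix.trace_fin_two, Matrix.of_apply, Matrix.of_apply]
    apply (algebraMap M N).injective
    rw [map_add, map_zero, hY, hY, Mat20_11]
    ring
  · ext i j
    · exact hX i j
    · exact hY i j

theorem mem_spin7Over_of_ι_mul_ι {g : Spin7 N} {v w : V7 N} (hg : (g : Cl7 N) =
    ι (form7 N) v * ι (form7 N) w) (h : form7 N v * form7 N w = 1)
    (hv : ∃ v', mapV M N v' = v) (hw : ∃ w', mapV M N w' = w) : g ∈ spin7Over M N := by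
  obtain ⟨v, rfl⟩ := hv
  obtain ⟨w, rfl⟩ := hw
  rw [form7_mapV, form7_mapV, ← map_mul, ← map_one (algebraMap M N)] at h
  exact ⟨⟨_, ι_mul_ι_mem_spin_of_mul_eq_one ((algebraMap M N).injective h)⟩, by
    rw [hg, map_mul, clMap_ι, clMap_ι]⟩

variable (M N) in
/-- The map of Clifford algebras `clMap`, as a ring homomorphism. -/
def clRingMap : Cl7 M →+* Cl7 N := (clMap M N).toRingHom

variable (M N) in
theorem clRingMap_omegaCl (X₁ X₂ X₃ : SL2 M) :
    clRingMap M N (omegaCl (X₁, X₂, X₃)) =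
      omegaCl (X₁.map (algebraMap M N), X₂.map (algebraMap M N), X₃.map (algebraMap M N)) :=
  clMap_omegaCl M N X₁ X₂ X₃

variable (M N) in
theorem clRingMap_ι (v : V7 M) :
    clRingMap M N (ι (form7 M) v) = ι (form7 N) (mapV M N v) := clMap_ι M N v

variable (M N) in
theorem clRingMap_algebraMap (r : M) :
    clRingMap M N (algebraMap M (Cl7 M) r) = algebraMap N (Cl7 N) (algebraMap M N r) :=
  clMap_algebraMap M N r

/-- The homomorphism of Clifford algebras induced by a field endomorphism. -/
def clTwist (σ : N →+* N) : Cl7 N →+* Cl7 N := @clRingMap N N _ _ σ.toAlgebra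

theorem clTwist_omegaCl (σ : N →+* N) (X₁ X₂ X₃ : SL2 N) :
    clTwist σ (omegaCl (X₁, X₂, X₃)) = omegaCl (X₁.map σ, X₂.map σ, X₃.map σ) :=
  @clRingMap_omegaCl N N _ _ σ.toAlgebra X₁ X₂ X₃

theorem clTwist_clMap (σ : N →+* N) (h : ∀ r, σ (algebraMap M N r) = algebraMap M N r)
    (x : Cl7 M) : clTwist σ (clMap M N x) = clMap M N x := by
  induction x using CliffordAlgebra.induction with
  | algebraMap r =>
    rw [clMap_algebraMap]
    refine (@clRingMap_algebraMap N N _ _ σ.toAlgebra _).trans ?_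
    exact congrArg _ (h r)
  | ι v =>
    rw [clMap_ι]
    refine (@clRingMap_ι N N _ _ σ.toAlgebra _).trans ?_
    congr 1
    ext i j
    · exact h _
    · exact h _
  | mul a b ha hb => rw [map_mul, map_mul, ha, hb]
  | add a b ha hb => rw [map_add, map_add, ha, hb]

/-- The endomorphism of the Clifford algebra induced by σ fixes everything that comes from M, and on
the image of ω it applies σ to the matrix entries. -/
theorem omega_map_eq_of_mem_spin7Over (σ : N →+* N)
    (h : ∀ r, σ (algebraMap M N r) = algebraMap M N r) {X₁ X₂ X₃ : SL2 N}
    (hX : omega N (X₁, X₂, X₃) ∈ spin7Over M N) :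
    omega N (X₁.map σ, X₂.map σ, X₃.map σ) = omega N (X₁, X₂, X₃) := by
  obtain ⟨x, hx⟩ := hX
  apply Subtype.ext
  rw [← hx, ← clTwist_clMap σ h, hx]
  exact (clTwist_omegaCl σ X₁ X₂ X₃).symm
end BaseChange
-- Such a B is a traceless matrix with entries x, y, z, -x. The two conditions are x² + yz = -1 and
-- one linear equation, orthogonality to A; they are solvable because -1 is a sum of two squares in
-- a finite field.
theorem exists_anticommute_SL2 {K : Type*} [Field K] [Finite K] (h2 : (2 : K) ≠ 0) {A : SL2 K}
    (hA : A * A = -1) : ∃ B : SL2 K, B * B = -1 ∧ B * A = -(A * B) := by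
  have tr : (A : Mat2 K) 1 1 = -(A : Mat2 K) 0 0 := by
    have : NeZero (2 : K) := ⟨h2⟩
    exact trace_of_sq hA
  have d := A.2
  rw [Matrix.det_fin_two, tr] at d
  suffices h : ∃ x y z : K, x ^ 2 + y * z = -1 ∧
      2 * (A : Mat2 K) 0 0 * x + (A : Mat2 K) 0 1 * z + (A : Mat2 K) 1 0 * y = 0 by
    obtain ⟨x, y, z, h, h'⟩ := h
    refine ⟨⟨!![x, y; z, -x], by rw [Matrix.det_fin_two_of]; linear_combination -h⟩, ?_, ?_⟩
    · apply Subtype.ext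
      change !![x, y; z, -x] * !![x, y; z, -x] = (-1 : Mat2 K)
      ext i j
      fin_cases i <;> fin_cases j <;> simp [Matrix.mul_apply, Fin.sum_univ_two]
      · linear_combination h
      · ring
      · ring
      · linear_combination h
    · apply Subtype.ext
      change !![x, y; z, -x] * (A : Mat2 K) = -((A : Mat2 K) * !![x, y; z, -x])
      ext i j
      fin_cases i <;> fin_cases j <;> simp [Matrix.mul_apply, Fin.sum_univ_two, tr]
      · linear_combination h'
      · ring
      · ring
      · linear_combination h'
  generalize (A : Mat2 K) 0 0 = a at *
  generalize (A : Mat2 K) 0 1 = b at *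
  generalize (A : Mat2 K) 1 0 = c at *
  by_cases hb : b = 0
  · have ha : a ≠ 0 := fun h => by simp [h, hb] at d
    refine ⟨-c, 2 * a, (-1 - c ^ 2) / (2 * a), ?_, ?_⟩
    · field_simp; ring
    · rw [hb]; ring
  · obtain ⟨p, hp⟩ := CharP.exists K
    have : NeZero p := ⟨(CharP.char_is_prime K p).ne_zero⟩
    obtain ⟨s, t, hst⟩ := CharP.sq_add_sq K p (-1)
    generalize (s : K) = s at *
    generalize (t : K) = t at *
    push_cast at hst
    -- With this substitution the quadratic form x² + yz becomes s² + t², and the linear equation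
    -- follows from det A = 1.
    refine ⟨s + a * t, b * t, -(2 * a * s + a ^ 2 * t - t) / b, ?_, ?_⟩
    · field_simp; linear_combination hst
    · field_simp; linear_combination (-t) * d

section Frobenius
variable {F : Type*} [Field F] [NeZero (2 : F)] {A : SL2 F} (hA : orderOf A = 4)
  (p k : ℕ) [ExpChar F p]

omit [NeZero (2 : F)] in
theorem combo_pow_expChar (a b : F) (M : Mat2 F) :
    (a • 1 + b • M) ^ p ^ k = (a ^ p ^ k) • 1 + (b ^ p ^ k) • M ^ p ^ k := by
  have : ExpChar (Mat2 F) p :=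
    expChar_of_injective_algebraMap (algebraMap F (Mat2 F)).injective p
  rw [add_pow_expChar_pow_of_commute p k (((Commute.one_left M).smul_left a).smul_right b),
    smul_pow, smul_pow, one_pow]

include hA in
/-- On the centralizer of an element `A` of order 4 that is fixed by the Frobenius automorphism
`x ↦ x ^ Q`, this automorphism is a power map, with an exponent congruent to 1 modulo 4. -/
theorem exists_map_iterateFrobenius_eq_zpow (hodd : Odd (p ^ k))
    (hfix : A.map (iterateFrobenius F p k) = A) : ∃ m : ℤ, (4 : ℤ) ∣ m - 1 ∧
      ∀ X : SL2 F, X * A = A * X → X.map (iterateFrobenius F p k) = X ^ m := by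
  have hA2 : (A : Mat2 F) * A = -1 := congrArg Subtype.val (sq_eq_neg_one_of_orderOf hA)
  have hA4 : (A : Mat2 F) ^ 4 = 1 := by
    rw [show 4 = 2 * 2 from rfl, pow_mul, pow_two (A : Mat2 F), hA2]; simp
  have coe_map : ∀ X : SL2 F, ∀ a b : F, (X : Mat2 F) = a • (1 : Mat2 F) + b • (A : Mat2 F) →
      (X.map (iterateFrobenius F p k) : Mat2 F) = (a ^ p ^ k) • 1 + (b ^ p ^ k) • (A : Mat2 F) := by
    intro X a b hX
    have hf := fun i j => congrFun (congrFun (congrArg Subtype.val hfix) i) j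
    ext i j
    have hf := hf i j
    simp only [Matrix.SpecialLinearGroup.map_apply_coe, RingHom.mapMatrix_apply, Matrix.map_apply]
      at hf ⊢
    rw [hX]
    simp only [Matrix.add_apply, Matrix.smul_apply, smul_eq_mul, map_add, map_mul]
    have h1 : iterateFrobenius F p k ((1 : Mat2 F) i j) = (1 : Mat2 F) i j := by
      by_cases hij : i = j
      · rw [hij, Matrix.one_apply_eq, map_one]
      · rw [Matrix.one_apply_ne hij, map_zero]
    rw [hf, h1, iterateFrobenius_def, iterateFrobenius_def]
  have h4 : p ^ k % 4 = 1 ∨ p ^ k % 4 = 3 := by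
    obtain ⟨r, hr⟩ := hodd
    omega
  -- Let Q = p ^ k and X = a + bA. Frobenius sends X to a^Q + b^Q·A, while X^Q is a^Q + b^Q·A^Q. If
  -- Q ≡ 1 mod 4 these agree. If Q ≡ 3 mod 4 then A^Q = -A, and they are inverse to each other
  -- because a² + b² = 1. So m = Q or m = -Q, in both cases 1 modulo 4.
  rcases h4 with h4 | h4
  · refine ⟨(p ^ k : ℕ), by omega, fun X hX => ?_⟩
    obtain ⟨a, b, hab, -⟩ := exists_eq_smul_add_smul hA hX
    apply Subtype.ext
    rw [zpow_natCast]
    rw [Matrix.SpecialLinearGroup.coe_pow, coe_map X a b hab, hab, combo_pow_expChar]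
    rw [← Nat.div_add_mod (p ^ k) 4, h4, pow_add (A : Mat2 F), pow_mul (A : Mat2 F), hA4, one_pow,
      one_mul, pow_one]
  · refine ⟨-(p ^ k : ℕ), by omega, fun X hX => ?_⟩
    obtain ⟨a, b, hab, h1⟩ := exists_eq_smul_add_smul hA hX
    rw [zpow_neg, zpow_natCast, eq_inv_iff_mul_eq_one]
    have h1' : (a ^ p ^ k) ^ 2 + (b ^ p ^ k) ^ 2 = 1 := by
      rw [← pow_mul, ← pow_mul, mul_comm, pow_mul, pow_mul, ← add_pow_expChar_pow, h1, one_pow]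
    have hA3 : (A : Mat2 F) ^ p ^ k = -A := by
      rw [← Nat.div_add_mod (p ^ k) 4, h4, pow_add, pow_mul, hA4, one_pow, one_mul, pow_succ,
        pow_two, hA2, neg_one_mul]
    apply Subtype.ext
    rw [Matrix.SpecialLinearGroup.coe_mul, Matrix.SpecialLinearGroup.coe_pow, coe_map X a b hab, hab,
      combo_pow_expChar, hA3]
    generalize a ^ p ^ k = c at *
    generalize b ^ p ^ k = d at *
    simp only [add_mul, mul_add, smul_mul_assoc, mul_smul_comm, one_mul, mul_one, mul_neg, hA2,
      Matrix.SpecialLinearGroup.coe_one]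
    calc _ = (c ^ 2 + d ^ 2) • (1 : Mat2 F) := by module
      _ = 1 := by rw [h1', one_smul]
end Frobenius
section Level
variable {M F : Type*} [Field M] [Field F] [Algebra M F]

theorem exists_SL2_map_eq {X : SL2 F} (h : ∀ i j, (X : Mat2 F) i j ∈ (algebraMap M F).range) :
    ∃ Y : SL2 M, Y.map (algebraMap M F) = X := by
  choose Y hY using h
  have e : (algebraMap M F).mapMatrix (Matrix.of Y) = (X : Mat2 F) := by
    ext i j
    exact hY i j
  refine ⟨⟨Matrix.of Y, (algebraMap M F).injective ?_⟩, Subtype.ext e⟩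
  rw [RingHom.map_det, e, X.2, map_one]

theorem omega_mem_spin7Over {X₁ X₂ X₃ : SL2 F}
    (h1 : ∀ i j, (X₁ : Mat2 F) i j ∈ (algebraMap M F).range)
    (h2 : ∀ i j, (X₂ : Mat2 F) i j ∈ (algebraMap M F).range)
    (h3 : ∀ i j, (X₃ : Mat2 F) i j ∈ (algebraMap M F).range) :
    omega F (X₁, X₂, X₃) ∈ spin7Over M F := by
  obtain ⟨Y₁, rfl⟩ := exists_SL2_map_eq h1
  obtain ⟨Y₂, rfl⟩ := exists_SL2_map_eq h2
  obtain ⟨Y₃, rfl⟩ := exists_SL2_map_eq h3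
  exact omega_map_mem_spin7Over M F Y₁ Y₂ Y₃

variable [NeZero (2 : F)] {A B : SL2 F}

/-- On M₂(F) and on M₂⁰(F) alike, X acts as the rotation lifting to the product of XB and B.
Regrouping puts the two copies of XB side by side, so that a factor irrational over M enters only
through its square. -/
theorem omega_diag_eq {X : SL2 F} (hB : B * B = -1) (hBX : B * X⁻¹ = X * B)
    (hZ : (X * B) * (X * B) = -1) : omegaCl (X, X, X) =
      -(vec4 ((X * B : SL2 F) : Mat2 F) * vec3 (toMat20 hZ) *
        (vec4 (B : Mat2 F) * vec3 (toMat20 hB))) := by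
  have h4 : omegaCl (X, X, 1) * vec4 (B : Mat2 F) = vec4 ((X * B : SL2 F) : Mat2 F) := by
    rw [omegaCl_apply]
    simp only [Matrix.SpecialLinearGroup.coe_one, blk3_one, mul_one]
    rw [add_mul, blk1_vec4, blk2_vec4, ← Matrix.SpecialLinearGroup.coe_inv,
      ← Matrix.SpecialLinearGroup.coe_mul, ← Matrix.SpecialLinearGroup.coe_mul, hBX, ← add_mul,
      blk12_one, one_mul]
  have h3 : omegaCl (1, 1, X) * vec3 (toMat20 hB) = vec3 (toMat20 hZ) :=
    omegaCl_mul_vec3 _ _ (Matrix.SpecialLinearGroup.coe_mul X B)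
  have e4 : omegaCl (X, X, 1) = vec4 ((X * B : SL2 F) : Mat2 F) * vec4 (B : Mat2 F) := by
    rw [← h4, mul_assoc, vec4_mul_self, mul_one]
  have e3 : omegaCl (1, 1, X) = vec3 (toMat20 hZ) * vec3 (toMat20 hB) := by
    rw [← h3, mul_assoc, vec3_mul_self, mul_one]
  have e : omegaCl (X, X, X) = omegaCl (X, X, 1) * omegaCl (1, 1, X) := by
    rw [← map_mul]; simp
  have hs : vec3 (toMat20 hZ) * vec4 (B : Mat2 F) = -(vec4 (B : Mat2 F) * vec3 (toMat20 hZ)) :=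
    swap_mixed _ _
  rw [e, e4, e3, mul_assoc, mul_assoc, ← mul_assoc (vec3 (toMat20 hZ)), hs]
  simp only [mul_assoc, neg_mul, mul_neg, neg_neg]

omit [NeZero (2 : F)] in
/-- The product of a traceless `Z ∈ M₂(F)` of determinant 1, as an element of `M₂(F)` and of
`M₂⁰(F)`, is defined over `M` if `Z` is a multiple of a matrix over `M` by a square root of an
element of `M`. -/
theorem vec4_mul_vec3_mem {Z : SL2 F} (hZ : Z * Z = -1) {s : F} {Y : Mat2 F}
    (hs : s ^ 2 ∈ (algebraMap M F).range) (hY : ∀ i j, Y i j ∈ (algebraMap M F).range)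
    (hZY : (Z : Mat2 F) = s • Y) : ∃ g ∈ spin7Over M F,
      (g : Cl7 F) = vec4 (Z : Mat2 F) * vec3 (toMat20 hZ) := by
  have hs0 : s ≠ 0 := by
    rintro rfl
    have := Z.2
    rw [hZY, zero_smul, Matrix.det_zero] at this
    exact zero_ne_one this
  have ht : Y ∈ Mat20 F := by
    have : s⁻¹ • (Z : Mat2 F) ∈ Mat20 F := Submodule.smul_mem _ _ (toMat20 hZ).2
    rwa [hZY, smul_smul, inv_mul_cancel₀ hs0, one_smul] at this
  have hd : form7 F (s ^ 2 • Y, 0) * form7 F (0, ⟨Y, ht⟩) = 1 := by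
    have := Z.2
    rw [hZY, Matrix.det_smul] at this
    simp only [form7_apply, Matrix.det_smul, Fintype.card_fin, Matrix.det_fin_two Y] at this ⊢
    simp
    linear_combination (s ^ 2 * (Y 0 0 * Y 1 1 - Y 0 1 * Y 1 0) + 1) * this
  have he : vec4 (Z : Mat2 F) * vec3 (toMat20 hZ) =
      ι (form7 F) (s ^ 2 • Y, 0) * ι (form7 F) (0, ⟨Y, ht⟩) := by
    have e1 : vec4 (Z : Mat2 F) = s • vec4 Y := by
      rw [hZY, vec4, vec4, ← map_smul]; simp
    have e2 : vec3 (toMat20 hZ) = s • vec3 ⟨Y, ht⟩ := by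
      rw [vec3, vec3, ← map_smul]
      congr 1
      exact Prod.ext (by simp) (Subtype.ext hZY)
    have e3 : ι (form7 F) (s ^ 2 • Y, 0) = s ^ 2 • vec4 Y := by
      rw [vec4, ← map_smul]; simp
    rw [e1, e2, e3, smul_mul_assoc, mul_smul_comm, smul_smul, smul_mul_assoc, pow_two]
    rfl
  refine ⟨⟨_, ι_mul_ι_mem_spin_of_mul_eq_one hd⟩, mem_spin7Over_of_ι_mul_ι rfl hd
    (mem_range_mapV ?_ ?_) (mem_range_mapV ?_ hY), he.symm⟩
  · exact fun i j => mul_mem hs (hY i j)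
  · exact fun i j => zero_mem _
  · exact fun i j => zero_mem _

variable (σ : F →+* F) (hσ : ∀ x, σ x = x ↔ x ∈ (algebraMap M F).range)
include hσ

/-- All entries of XB change sign under σ. Dividing by a nonzero entry s gives a matrix over M, and
s² lies in M, so the product of the two copies of XB is defined over M. -/
theorem omega_diag_mem {X : SL2 F} (hB : B * B = -1) (hBX : B * X⁻¹ = X * B)
    (hBσ : B.map σ = B) (hXσ : X.map σ = -X) : omega F (X, X, X) ∈ spin7Over M F := by
  have hBX' : B * X = X⁻¹ * B := by
    rw [eq_inv_mul_iff_mul_eq, ← mul_assoc, ← hBX, inv_mul_cancel_right]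
  have hZ : (X * B) * (X * B) = -1 := by
    rw [mul_assoc, ← mul_assoc B, hBX', mul_assoc, hB, ← mul_assoc, mul_inv_cancel, one_mul]
  have hZσ : (X * B).map σ = -(X * B) := by rw [map_mul, hBσ, hXσ, neg_mul]
  have hZσ' : ∀ i j, σ ((X * B : SL2 F) i j) = -((X * B : SL2 F) i j) := fun i j =>
    congrFun (congrFun (congrArg Subtype.val hZσ) i) j
  obtain ⟨i, j, hs⟩ : ∃ i j, (X * B : SL2 F) i j ≠ 0 := by
    by_contra! h
    have := (X * B).2
    rw [Matrix.det_fin_two, h 0 0, h 0 1, zero_mul, zero_mul, sub_zero] at this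
    exact zero_ne_one this
  generalize hs' : (X * B : SL2 F) i j = s at *
  have hsσ : σ s = -s := by rw [← hs']; exact hZσ' i j
  obtain ⟨g, hg, hg'⟩ := vec4_mul_vec3_mem (M := M) hZ (s := s)
    (Y := s⁻¹ • ((X * B : SL2 F) : Mat2 F))
    ((hσ _).1 (by rw [map_pow, hsσ, neg_sq]))
    (fun i j => (hσ _).1 (by
      rw [Matrix.smul_apply, smul_eq_mul, map_mul, map_inv₀, hsσ]
      rw [hZσ' i j, inv_neg, neg_mul_neg]))
    (by rw [smul_smul, mul_inv_cancel₀ hs, one_smul])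
  obtain ⟨h, hh, hh'⟩ := vec4_mul_vec3_mem (M := M) hB (s := 1) (Y := B)
    (by rw [one_pow]; exact one_mem _)
    (fun i j => (hσ _).1 (congrFun (congrFun (congrArg Subtype.val hBσ) i) j)) (one_smul _ _).symm
  have hz : zSpin F ∈ spin7Over M F := omega_mem_spin7Over
    (fun i j => (hσ _).1 (by by_cases h : i = j <;> simp [h]))
    (fun i j => (hσ _).1 (by by_cases h : i = j <;> simp [h]))
    (fun i j => (hσ _).1 (by by_cases h : i = j <;> simp [h]))
  have : omega F (X, X, X) = zSpin F * (g * h) := by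
    apply Subtype.ext
    rw [coe_omega, omega_diag_eq hB hBX hZ, Submonoid.coe_mul, Submonoid.coe_mul, coe_zSpin, hg', hh',
      neg_one_mul]
  rw [this]
  exact mul_mem hz (mul_mem hg hh)

omit [NeZero (2 : F)] in
theorem entries_mem_range {X : SL2 F} (h : X.map σ = X) (i j : Fin 2) :
    (X : Mat2 F) i j ∈ (algebraMap M F).range :=
  (hσ _).1 (congrFun (congrFun (congrArg Subtype.val h) i) j)

variable (hA : orderOf A = 4) (hB : B * B = -1) (hBA : B * A = -(A * B))

-- Both sides say that σ fixes t, since σ is the m-th power map on the torus. The substance is that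
-- a fixed t is rational even when the representatives Xᵢ are not fixed but all negated by σ.
include hA hB hBA in
theorem mem_spin7Over_iff_zpow (hBσ : B.map σ = B) {m : ℤ}
    (hm : ∀ X : SL2 F, X * A = A * X → X.map σ = X ^ m) {t : Spin7 F} (ht : t ∈ Ainf A hA) :
    t ∈ spin7Over M F ↔ t ^ m = t := by
  obtain ⟨⟨X₁, X₂, X₃⟩, rfl⟩ := ht
  change omega F (X₁.1, X₂.1, X₃.1) ∈ _ ↔ (omega F (X₁.1, X₂.1, X₃.1)) ^ m = _
  have e : (omega F (X₁.1, X₂.1, X₃.1)) ^ m =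
      omega F (X₁.1.map σ, X₂.1.map σ, X₃.1.map σ) := by
    rw [hm _ X₁.2.1, hm _ X₂.2.1, hm _ X₃.2.1, ← map_zpow]
    rfl
  rw [e]
  refine ⟨omega_map_eq_of_mem_spin7Over σ fun r => (hσ _).2 ⟨r, rfl⟩,
    fun h : _ = omega F (X₁.1, X₂.1, X₃.1) => ?_⟩
  rw [← mul_inv_eq_one, ← map_inv, ← map_mul, omega_eq_one_iff] at h
  simp only [Prod.ext_iff, Prod.fst_mul, Prod.snd_mul,
    mul_inv_eq_iff_eq_mul, one_mul, neg_mul] at h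
  rcases h with ⟨h1, h2, h3⟩ | ⟨h1, h2, h3⟩
  · exact omega_mem_spin7Over (entries_mem_range σ hσ h1) (entries_mem_range σ hσ h2)
      (entries_mem_range σ hσ h3)
  -- When σ negates all three matrices, the quotients by X₁ are fixed, so only [X₁, X₁, X₁] requires
  -- the argument with square roots.
  · have d : omega F (X₁.1, X₂.1, X₃.1) = omega F (X₁.1, X₁.1, X₁.1) *
        omega F (1, X₁.1⁻¹ * X₂.1, X₁.1⁻¹ * X₃.1) := by
      rw [← map_mul]; simp
    rw [d]
    refine mul_mem (omega_diag_mem σ hσ hB (mul_Cinf_of_anti hA hBA X₁⁻¹ |>.trans ?_) hBσ h1)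
      (omega_mem_spin7Over (entries_mem_range σ hσ (map_one _))
        (entries_mem_range σ hσ ?_) (entries_mem_range σ hσ ?_))
    · rw [inv_inv]
    · rw [map_mul, map_inv, h1, h2, inv_neg, neg_mul_neg]
    · rw [map_mul, map_inv, h1, h3, inv_neg, neg_mul_neg]
end Level
end SolSpin
end

/-! ### Finite levels, 2-torsion, and the conclusion -/

open CliffordAlgebra
noncomputable section
namespace SolSpin
section WeylLevel
variable {M F : Type*} [Field M] [Field F] [Algebra M F] [NeZero (2 : F)] {A B : SL2 F}
  (hA : A * A = -1) (hB : B * B = -1) (hBA : B * A = -(A * B))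

/-- The generators involve only A, B and the scalar ½, so they are rational as soon as A and B are.
-/
theorem weylMonoid_le_spin7Over (hAM : ∀ i j, (A : Mat2 F) i j ∈ (algebraMap M F).range)
    (hBM : ∀ i j, (B : Mat2 F) i j ∈ (algebraMap M F).range) :
    weylMonoid hB hBA hA ≤ (spin7Over M F).toSubmonoid := by
  have h1 : ∀ i j, ((1 : SL2 F) : Mat2 F) i j ∈ (algebraMap M F).range := fun i j => by
    rw [Matrix.SpecialLinearGroup.coe_one, Matrix.one_apply]
    split_ifs
    · exact one_mem _
    · exact zero_mem _
  have hAB : ∀ i j, ((A * B : SL2 F) : Mat2 F) i j ∈ (algebraMap M F).range := fun i j => by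
    rw [Matrix.SpecialLinearGroup.coe_mul, Matrix.mul_apply]
    exact sum_mem fun k _ => mul_mem (hAM i k) (hBM k j)
  refine Submonoid.closure_le.2 ?_
  intro g hg
  simp only [Set.mem_insert_iff, Set.mem_singleton_iff] at hg
  rcases hg with rfl | rfl | rfl
  · exact omega_mem_spin7Over h1 hBM h1
  · exact omega_mem_spin7Over h1 h1 hBM
  · have h2 : (2 : F)⁻¹ ∈ (algebraMap M F).range := ⟨2⁻¹, by rw [map_inv₀, map_ofNat]⟩
    refine mem_spin7Over_of_ι_mul_ι (ι_swap_mul hA hB hBA).symm (form7_swap_mul hA hB hBA)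
      (mem_range_mapV ?_ ?_) (mem_range_mapV hAB ?_)
    · exact fun i j => mul_mem h2 (hBM i j)
    · exact fun i j => mul_mem h2 (neg_mem (hBM i j))
    · exact fun i j => neg_mem (hAB i j)
end WeylLevel

section Descent
variable {K F : Type*} [Field K] [Field F] [Algebra K F]

theorem SL2_map_neg {R S : Type*} [CommRing R] [CommRing S] (f : R →+* S) (X : SL2 R) :
    (-X).map f = -X.map f := by
  ext i j
  simp

theorem SL2_map_injective : Function.Injective
    (Matrix.SpecialLinearGroup.map (n := Fin 2) (algebraMap K F)) := fun X Y h => by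
  ext i j
  exact (algebraMap K F).injective (congrFun (congrFun (congrArg Subtype.val h) i) j)

theorem exists_anticommute_over [Finite K] [NeZero (2 : F)] {A : SL2 F} (hA : A * A = -1)
    (hAK : A ∈ (Matrix.SpecialLinearGroup.map (n := Fin 2) (algebraMap K F)).range) :
    ∃ B : SL2 F, B * B = -1 ∧ B * A = -(A * B) ∧
      B ∈ (Matrix.SpecialLinearGroup.map (n := Fin 2) (algebraMap K F)).range := by
  obtain ⟨A, rfl⟩ := hAK
  have h2 : (2 : K) ≠ 0 := fun h => NeZero.ne (2 : F) (by
    rw [← map_ofNat (algebraMap K F) 2, h, map_zero])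
  obtain ⟨B, hB, hBA⟩ := exists_anticommute_SL2 h2 (A := A) (SL2_map_injective (F := F) (by
    rw [map_mul, hA, SL2_map_neg, map_one]))
  refine ⟨B.map (algebraMap K F), ?_, ?_, B, rfl⟩
  · rw [← map_mul, hB, SL2_map_neg, map_one]
  · rw [← map_mul, hBA, SL2_map_neg, map_mul]
end Descent

section Levels
variable (K : Type*) {F : Type*} [Field K] [Finite K] [Field F] [Algebra K F]

theorem exists_iterateFrobenius (F : Type*) [Field F] [Algebra K F] (n : ℕ) :
    ∃ (p k : ℕ) (_ : ExpChar F p), p ^ k = Nat.card K ^ n := by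
  have := Fintype.ofFinite K
  obtain ⟨p, hp, f, hprime, hcard⟩ := FiniteField.card' K
  have : CharP F p := charP_of_injective_algebraMap (algebraMap K F).injective p
  refine ⟨p, f * n, ExpChar.prime hprime, ?_⟩
  rw [pow_mul, Nat.card_eq_fintype_card, hcard]

theorem odd_card_pow [NeZero (2 : F)] (n : ℕ) : Odd (Nat.card K ^ n) := by
  have := Fintype.ofFinite K
  have h2 : (2 : K) ≠ 0 := fun h => NeZero.ne (2 : F) (by
    rw [← map_ofNat (algebraMap K F) 2, h, map_zero])
  rw [Nat.card_eq_fintype_card]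
  refine Odd.pow (Nat.odd_iff.2 (FiniteField.odd_card_of_char_ne_two fun h => h2 ?_))
  have := ringChar.charP K
  rw [h] at this
  exact CharP.cast_eq_zero K 2

theorem map_eq_of_mem_range {p k : ℕ} [ExpChar F p] {n : ℕ} (hpk : p ^ k = Nat.card K ^ n)
    {X : SL2 F} (hX : X ∈ (Matrix.SpecialLinearGroup.map (n := Fin 2) (algebraMap K F)).range) :
    X.map (iterateFrobenius F p k) = X := by
  obtain ⟨X, rfl⟩ := hX
  ext i j
  change iterateFrobenius F p k (algebraMap K F (X i j)) = algebraMap K F (X i j)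
  rw [iterateFrobenius_def, hpk]
  exact (subfieldQ K F n).algebraMap_mem (X i j)

theorem iterateFrobenius_eq_iff {p k : ℕ} [ExpChar F p] {n : ℕ} (hpk : p ^ k = Nat.card K ^ n)
    (x : F) : iterateFrobenius F p k x = x ↔ x ∈ (algebraMap (subfieldQ K F n) F).range := by
  rw [iterateFrobenius_def, hpk]
  exact ⟨fun h => ⟨⟨x, h⟩, rfl⟩, fun ⟨y, hy⟩ => hy ▸ y.2⟩

variable [NeZero (2 : F)] {A B : SL2 F} (hA : orderOf A = 4) (hB : B * B = -1)
  (hBA : B * A = -(A * B))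
  (hAK : A ∈ (Matrix.SpecialLinearGroup.map (n := Fin 2) (algebraMap K F)).range)
  (hBK : B ∈ (Matrix.SpecialLinearGroup.map (n := Fin 2) (algebraMap K F)).range)

include hAK hBK in
theorem weylMonoid_le_spin7Level (n : ℕ) :
    weylMonoid hB hBA (sq_eq_neg_one_of_orderOf hA) ≤ (spin7Level K F n).toSubmonoid := by
  obtain ⟨p, k, _, hpk⟩ := exists_iterateFrobenius K F n
  have hσ := iterateFrobenius_eq_iff (F := F) K hpk
  exact weylMonoid_le_spin7Over _ hB hBA
    (entries_mem_range _ hσ (map_eq_of_mem_range K hpk hAK))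
    (entries_mem_range _ hσ (map_eq_of_mem_range K hpk hBK))

include hB hBA hAK hBK in
theorem exists_mem_Alevel_iff_zpow (n : ℕ) : ∃ m : ℤ, (4 : ℤ) ∣ m - 1 ∧
    ∀ t ∈ Ainf A hA, t ∈ Alevel K A hA n ↔ t ^ m = t := by
  obtain ⟨p, k, _, hpk⟩ := exists_iterateFrobenius K F n
  obtain ⟨m, hm, h⟩ := exists_map_iterateFrobenius_eq_zpow hA p k
    (hpk ▸ odd_card_pow (F := F) K n) (map_eq_of_mem_range K hpk hAK)
  refine ⟨m, hm, fun t ht => ?_⟩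
  rw [← mem_spin7Over_iff_zpow (iterateFrobenius F p k) (iterateFrobenius_eq_iff K hpk) hA hB hBA
    (map_eq_of_mem_range K hpk hBK) h ht]
  exact ⟨fun h => h.2, fun h => ⟨ht, h⟩⟩
end Levels

section FixTwoTorsion
variable {F : Type*} [Field F] [NeZero (2 : F)] {A B : SL2 F} (hA : orderOf A = 4)
  (hB : B * B = -1) (hBA : B * A = -(A * B)) [IsAlgClosed F]
  (v : ℤ_[2]ˣ) (hv : (v : ℤ_[2]) ^ 2 + v + 2 = 0)

theorem halfTurn_inv_ne : (⟨halfTurn A 2, halfTurn_mem hA 2⟩ : Ainf A hA)⁻¹ ≠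
    ⟨halfTurn A 2, halfTurn_mem hA 2⟩ := fun h2 => by
  rw [inv_eq_iff_mul_eq_one] at h2
  have h3 : halfTurn A 2 * halfTurn A 2 = 1 := congrArg Subtype.val h2
  rw [halfTurn_mul_self hA, zSpin, omega_eq_one_iff] at h3
  simp [Prod.ext_iff, SL2_neg_one_ne_one, SL2_neg_one_ne_one.symm] at h3

include hB hBA in
theorem OmegaU_eq_range : OmegaU A hA v⁻¹ = ((torusAct A hA v hv).comp G24.subtype).range :=
  autBy_sup_zpowers_eq_range hA hB hBA v hv (Ainf A hA) le_rfl (fun φ t _ => (φ t).2)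
    (halfTurn_mem hA) ⊤ le_top

include hB hBA hv in
theorem nonempty_OmegaU_mulEquiv :
    Nonempty (OmegaU A hA v⁻¹ ≃* Multiplicative (ZMod 2) × GL (Fin 3) (ZMod 2)) :=
  nonempty_autBy_sup_zpowers_mulEquiv hA hB hBA v hv (Ainf A hA) le_rfl (fun φ t _ => (φ t).2)
    (fun t _ => t.2) (halfTurn_mem hA) ⊤ le_top

include hB hBA hv in
theorem mem_fixTwoTorsion_OmegaU (φ : MulAut (Ainf A hA)) :
    φ ∈ fixTwoTorsion (OmegaU A hA v⁻¹) ↔ φ = 1 ∨ ∀ x, φ x = x⁻¹ := by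
  constructor
  · rintro ⟨h, hφ⟩
    rw [OmegaU_eq_range hA hB hBA v hv] at h
    obtain ⟨⟨g, hg⟩, rfl⟩ := h
    rcases eq_one_or_neg_one_of_redGL hg (redGL_eq_one_of_torusAct A hA v hv fun t ht =>
      hφ t (by rwa [pow_two])) with rfl | rfl
    · left
      exact map_one (torusAct A hA v hv)
    · right
      exact fun x => torusAct_neg_one A hA v hv x
  · rintro (rfl | h)
    · exact one_mem _
    · refine ⟨?_, fun x hx => ?_⟩
      · rw [OmegaU_eq_range hA hB hBA v hv]
        exact ⟨⟨-1, neg_one_mem_G24⟩,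
          MulEquiv.ext fun x => (torusAct_neg_one A hA v hv x).trans (h x).symm⟩
      · rw [h x, inv_eq_iff_mul_eq_one, ← pow_two, hx]

include hB hBA hv in
theorem card_fixTwoTorsion_OmegaU : Nat.card (fixTwoTorsion (OmegaU A hA v⁻¹)) = 2 := by
  have hinv : ∀ x, torusAct A hA v hv (-1) x = x⁻¹ := torusAct_neg_one A hA v hv
  have : (fixTwoTorsion (OmegaU A hA v⁻¹) : Set (MulAut (Ainf A hA))) =
      {1, torusAct A hA v hv (-1)} := by
    ext φ
    rw [SetLike.mem_coe, mem_fixTwoTorsion_OmegaU hA hB hBA v hv, Set.mem_insert_iff,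
      Set.mem_singleton_iff]
    refine or_congr_right ⟨fun h => MulEquiv.ext fun x => (h x).trans (hinv x).symm, ?_⟩
    rintro rfl
    exact hinv
  refine (Nat.card_congr (Equiv.setCongr this)).trans ?_
  rw [Nat.card_coe_set_eq, Set.ncard_pair]
  intro h
  refine halfTurn_inv_ne hA ?_
  rw [← hinv, ← h, MulAut.one_apply]
end FixTwoTorsion

section Final
variable {K F : Type*} [Field K] [Finite K] [Field F] [Algebra K F]
  [NeZero (2 : F)] {A B : SL2 F} (hA : orderOf A = 4) (hB : B * B = -1) (hBA : B * A = -(A * B))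
  [IsAlgClosed F] (v : ℤ_[2]ˣ) (hv : (v : ℤ_[2]) ^ 2 + v + 2 = 0)
  (hAK : A ∈ (Matrix.SpecialLinearGroup.map (n := Fin 2) (algebraMap K F)).range)
  (hBK : B ∈ (Matrix.SpecialLinearGroup.map (n := Fin 2) (algebraMap K F)).range)

-- The condition t^m = t is preserved by every automorphism of A(q^∞). As m ≡ 1 mod 4, it holds for
-- all elements of order dividing 4, in particular for the 2-torsion and the half turns.
include hB hBA hv hAK hBK in
theorem exists_restrict_gammaU (n : ℕ) : ∃ γn : MulAut (Alevel K A hA n),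
    (∀ x : Alevel K A hA n,
      (γn x : Spin7 F) = gammaU A hA v⁻¹ ⟨(x : Spin7 F), x.2.1⟩) ∧
    Nonempty (↥(autBy (spin7Level K F n) (Alevel K A hA n) ⊔ Subgroup.zpowers γn) ≃*
      Multiplicative (ZMod 2) × GL (Fin 3) (ZMod 2)) := by
  obtain ⟨m, ⟨d, hm⟩, h⟩ := exists_mem_Alevel_iff_zpow K hA hB hBA hAK hBK n
  have hchar : ∀ (φ : MulAut (Ainf A hA)) (t : Ainf A hA), (t : Spin7 F) ∈ Alevel K A hA n →
      (φ t : Spin7 F) ∈ Alevel K A hA n := fun φ t ht => by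
    have e : t ^ m = t := Subtype.ext ((h t t.2).1 ht)
    refine (h _ (φ t).2).2 ?_
    rw [← Subgroup.coe_zpow, ← map_zpow, e]
  have of_pow : ∀ t ∈ Ainf A hA, t ^ 4 = 1 → t ∈ Alevel K A hA n := fun t ht h4 => by
    have e : m = 1 + (4 : ℕ) * d := by push_cast; omega
    rw [h t ht, e, zpow_add, zpow_one, zpow_mul, zpow_natCast, h4, one_zpow, mul_one]
  refine ⟨restrictAut hA _ inf_le_left hchar (gammaU A hA v⁻¹), fun x => rfl,
    nonempty_autBy_sup_zpowers_mulEquiv hA hB hBA v hv _ inf_le_left hchar (fun t ht => ?_)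
      (fun j => ?_) _ (weylMonoid_le_spin7Level K hA hB hBA hAK hBK n)⟩
  · refine of_pow _ t.2 ?_
    have e : (t : Spin7 F) * t = 1 := congrArg Subtype.val ht
    rw [show 4 = 2 * 2 from rfl, pow_mul, pow_two (t : Spin7 F), e, one_pow]
  · refine of_pow _ (halfTurn_mem hA j) ?_
    rw [show 4 = 2 * 2 from rfl, pow_mul, pow_two (halfTurn A j), halfTurn_mul_self hA, pow_two,
      zSpin_mul_self]
end Final
end SolSpin
end

set_option maxHeartbeats 1000000 in
theorem mainTheorem4 {K F : Type*} [Field K] [Finite K] [Field F] [Algebra K F]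
    [IsAlgClosure K F] [NeZero (2 : F)] (A : SolSpin.SL2 F) (hA : orderOf A = 4)
    (hAK : A ∈ (Matrix.SpecialLinearGroup.map (n := Fin 2) (algebraMap K F)).range) :
    ∃ u : ℤ_[2]ˣ, (4 : ℤ_[2]) ∣ (u : ℤ_[2]) - 1 ∧
      Nonempty (SolSpin.OmegaU A hA u ≃* Multiplicative (ZMod 2) × GL (Fin 3) (ZMod 2)) ∧
      (Nat.card (SolSpin.fixTwoTorsion (SolSpin.OmegaU A hA u)) = 2 ∧
        ∀ φ : MulAut (SolSpin.Ainf A hA),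
          φ ∈ SolSpin.fixTwoTorsion (SolSpin.OmegaU A hA u) ↔ φ = 1 ∨ ∀ x, φ x = x⁻¹) ∧
      ∀ n : ℕ, 1 ≤ n →
        ∃ γn : MulAut (SolSpin.Alevel K A hA n),
          (∀ x : SolSpin.Alevel K A hA n,
            (γn x : SolSpin.Spin7 F) =
              SolSpin.gammaU A hA u ⟨(x : SolSpin.Spin7 F), x.2.1⟩) ∧
          Nonempty
            (↥(SolSpin.autBy (SolSpin.spin7Level K F n) (SolSpin.Alevel K A hA n) ⊔
                Subgroup.zpowers γn) ≃*
              Multiplicative (ZMod 2) × GL (Fin 3) (ZMod 2)) := by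
  have : IsAlgClosed F := IsAlgClosure.isAlgClosed K
  obtain ⟨v, hv, c, hc⟩ := SolSpin.exists_padic_root
  obtain ⟨B, hB, hBA, hBK⟩ :=
    SolSpin.exists_anticommute_over (SolSpin.sq_eq_neg_one_of_orderOf hA) hAK
  -- The congruence passes from v to its inverse by v⁻¹ - 1 = -v⁻¹(v - 1).
  refine ⟨v⁻¹, ⟨-((v⁻¹ : ℤ_[2]ˣ) * c), ?_⟩, ?_, ⟨?_, ?_⟩, fun n _ => ?_⟩
  · have e : ((v⁻¹ : ℤ_[2]ˣ) : ℤ_[2]) * v = 1 := v.inv_mul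
    linear_combination (-((v⁻¹ : ℤ_[2]ˣ) : ℤ_[2])) * hc + e
  · exact SolSpin.nonempty_OmegaU_mulEquiv hA hB hBA v hv
  · exact SolSpin.card_fixTwoTorsion_OmegaU hA hB hBA v hv
  · exact SolSpin.mem_fixTwoTorsion_OmegaU hA hB hBA v hv
  · exact SolSpin.exists_restrict_gammaU hA hB hBA v hv hAK hBK n
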